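/- For an oriented link $L\subset S^3$, considered up to isotopy, let $P_L(a,z)\in\mathbb{Z}[a^{\pm1},z^{\pm1}]$ be the HOMFLY polynomial: the unique invariant of oriented links such that $P_O=1$ for the trivial knot $O$ and $$a^{-1}P_{L_+}(a,z)-a\,P_{L_-}(a,z)=z\,P_{L_0}(a,z)$$ whenever $L_+,L_-,L_0$ have oriented diagrams that agree except near one crossing, which is positive in $L_+$, negative in $L_-$, and replaced by its oriented smoothing in $L_0$. For an even number $m$, a positive $t_m$-move (respectively a positive $\bar t_m$-move) inserts, in some oriented diagram of a link, $m$ consecutive positive crossings into two adjacent parallel strands with equal (respectively opposite) orientations, as in the two-strand braid $\sigma_1^m$. **Proposition.** Let $K$ be a knot. 1. Let $k\ge 3$, let $\zeta\in\mathbb{C}$ be a primitive $2k$-th root of unity, and let $K'$ be obtained from $K$ by a positive $t_{2k}$-move. Then $$P_{K'}(a,\zeta-\zeta^{-1})=a^{2k}\,P_K(a,\zeta-\zeta^{-1})\quad\text{in }\mathbb{C}[a^{\pm1}].$$ 2. Let $K'$ be obtained from $K$ by a positive $t_4$-move. Then $P_K$ and $P_{K'}$ lie in $\mathbb{Z}[a^{\pm1}][z]$,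 and the reductions modulo $2$ of their values at $z=0$ satisfy $$P_{K'}(a,0)=a^{4}\,P_K(a,0)\quad\text{in }\mathbb{F}_2[a^{\pm1}].$$ 3. Let $k\ge 2$, let $\zeta\in\mathbb{C}$ be a primitive $2k$-th root of unity, and let $K'$ be obtained from $K$ by a positive $\bar t_{2k}$-move. Then $$P_{K'}(\zeta,z)=P_K(\zeta,z)\quad\text{in }\mathbb{C}[z^{\pm1}].$$ -/

import Mathlib

open scoped LaurentPolynomial Polynomial

namespace LinkDiagrams

/-! ### Oriented link diagrams

An oriented link diagram in the plane, in general position with respect to the height function, is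
read from bottom to top as a finite word of slices.  Each slice consists of vertical strands and
one elementary piece: a minimum, a maximum or a crossing.  The strands meeting a horizontal level
are recorded, from left to right, by their orientations: `true` is upward, `false` is downward. -/

/-- The elementary pieces of an oriented diagram. -/
inductive Gen : Type
  /-- A local minimum, whose left end has orientation `o` and whose right end has `!o`. -/
  | cup (o : Bool)
  /-- A local maximum, whose left end has orientation `o` and whose right end has `!o`. -/
  | cap (o : Bool)
  /-- A crossing of two strands; `p` and `q` are the orientations of the strands that start at the
  bottom left and at the bottom right.  The strand from the bottom left to the top right is the
  overpassing one if and only if `ov = true`. -/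
  | cross (ov p q : Bool)

/-- The orientations of the strands at the bottom of an elementary piece. -/
def Gen.bottom : Gen → List Bool
  | .cup _ => []
  | .cap o => [o, !o]
  | .cross _ p q => [p, q]

/-- The orientations of the strands at the top of an elementary piece. -/
def Gen.top : Gen → List Bool
  | .cup o => [o, !o]
  | .cap _ => []
  | .cross _ p q => [q, p]

/-- A slice: an elementary piece with vertical strands to its left and to its right. -/
structure Slice : Type where
  left : List Bool
  gen : Gen
  right : List Bool

def Slice.bottom (s : Slice) : List Bool := s.left ++ s.gen.bottom ++ s.right

def Slice.top (s : Slice) : List Bool := s.left ++ s.gen.top ++ s.right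

/-- Add vertical strands `l` on the left and `r` on the right of a slice. -/
def Slice.extend (l r : List Bool) (s : Slice) : Slice := ⟨l ++ s.left, s.gen, s.right ++ r⟩

/-- `IsTangle s w t`: the slices of `w` can be stacked, from bottom to top, to an oriented tangle
diagram with lower boundary `s` and upper boundary `t`. -/
def IsTangle : List Bool → List Slice → List Bool → Prop
  | s, [], t => s = t
  | s, x :: w, t => s = x.bottom ∧ IsTangle x.top w t

/-- A (non-empty) oriented link diagram. -/
structure Diagram : Type where
  word : List Slice
  nonempty : word ≠ []
  closed : IsTangle [] word []

/-! ### Isotopy -/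

/-- The local moves: the planar isotopies that change the pattern of critical levels, and the
three Reidemeister moves. -/
inductive LocalMove : List Slice → List Slice → Prop
  /-- Two distant pieces exchange their heights. -/
  | interchange (g h : Gen) (m : List Bool) :
      LocalMove [⟨[], g, m ++ h.bottom⟩, ⟨g.top ++ m, h, []⟩]
        [⟨g.bottom ++ m, h, []⟩, ⟨[], g, m ++ h.top⟩]
  /-- A minimum and a neighbouring maximum on the same strand cancel. -/
  | zigzag_left (o : Bool) : LocalMove [⟨[], .cup o, [o]⟩, ⟨[o], .cap (!o), []⟩] []
  | zigzag_right (o : Bool) : LocalMove [⟨[o], .cup (!o), []⟩, ⟨[], .cap o, [o]⟩] []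
  /-- A strand passes over or under a maximum. -/
  | slide_cap (ov o x : Bool) :
      LocalMove [⟨[o], .cross ov x (!o), []⟩, ⟨[], .cap o, [x]⟩]
        [⟨[], .cross (!ov) o x, [!o]⟩, ⟨[x], .cap o, []⟩]
  /-- A strand passes over or under a minimum. -/
  | slide_cup (ov o x : Bool) :
      LocalMove [⟨[], .cup o, [x]⟩, ⟨[o], .cross ov (!o) x, []⟩]
        [⟨[x], .cup o, []⟩, ⟨[], .cross (!ov) x o, [!o]⟩]
  /-- First Reidemeister move. -/
  | reidemeister1_cap (ov o : Bool) :
      LocalMove [⟨[], .cross ov o (!o), []⟩, ⟨[], .cap (!o), []⟩] [⟨[], .cap o, []⟩]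
  | reidemeister1_cup (ov o : Bool) :
      LocalMove [⟨[], .cup o, []⟩, ⟨[], .cross ov o (!o), []⟩] [⟨[], .cup (!o), []⟩]
  /-- Second Reidemeister move. -/
  | reidemeister2 (ov p q : Bool) :
      LocalMove [⟨[], .cross ov p q, []⟩, ⟨[], .cross (!ov) q p, []⟩] []
  /-- Third Reidemeister move. -/
  | reidemeister3 (ov p q x : Bool) :
      LocalMove
        [⟨[], .cross ov p q, [x]⟩, ⟨[q], .cross ov p x, []⟩, ⟨[], .cross ov q x, [p]⟩]
        [⟨[p], .cross ov q x, []⟩, ⟨[], .cross ov p x, [q]⟩, ⟨[x], .cross ov p q, []⟩]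

/-- One diagram arises from the other by a local move, performed inside the diagram. -/
def Diagram.Move (D E : Diagram) : Prop :=
  ∃ (u v x y : List Slice) (l r : List Bool), LocalMove x y ∧
    D.word = u ++ x.map (Slice.extend l r) ++ v ∧ E.word = u ++ y.map (Slice.extend l r) ++ v

/-- Oriented links up to isotopy: diagrams modulo the equivalence relation generated by the local
moves. -/
def OrientedLink : Type := Quot Diagram.Move

def Diagram.link (D : Diagram) : OrientedLink := Quot.mk _ D

/-! ### Components and knots -/

/-- The points of a diagram on the levels between the slices: `(j, i)` stands for the `i`-th strand
just below the `j`-th slice. -/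
def Diagram.Point (D : Diagram) : Type :=
  {x : ℕ × ℕ // ∃ s, D.word[x.1]? = some s ∧ x.2 < s.bottom.length}

/-- Two points are joined by an arc of the diagram inside a single slice. -/
inductive Joined (w : List Slice) : ℕ × ℕ → ℕ × ℕ → Prop
  | left (j i : ℕ) (s : Slice) : w[j]? = some s → i < s.left.length →
      Joined w (j, i) (j + 1, i)
  | right (j i : ℕ) (s : Slice) : w[j]? = some s → i < s.right.length →
      Joined w (j, s.left.length + s.gen.bottom.length + i)
        (j + 1, s.left.length + s.gen.top.length + i)
  | cup (j : ℕ) (l r : List Bool) (o : Bool) : w[j]? = some ⟨l, .cup o, r⟩ →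
      Joined w (j + 1, l.length) (j + 1, l.length + 1)
  | cap (j : ℕ) (l r : List Bool) (o : Bool) : w[j]? = some ⟨l, .cap o, r⟩ →
      Joined w (j, l.length) (j, l.length + 1)
  | cross_up (j : ℕ) (l r : List Bool) (ov p q : Bool) :
      w[j]? = some ⟨l, .cross ov p q, r⟩ → Joined w (j, l.length) (j + 1, l.length + 1)
  | cross_down (j : ℕ) (l r : List Bool) (ov p q : Bool) :
      w[j]? = some ⟨l, .cross ov p q, r⟩ → Joined w (j, l.length + 1) (j + 1, l.length)

/-- The components of a link diagram. -/
def Diagram.Component (D : Diagram) : Type := Quot fun x y : D.Point => Joined D.word x.1 y.1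

/-- A knot is a link with exactly one component. -/
def OrientedLink.IsKnot (K : OrientedLink) : Prop :=
  ∃ D : Diagram, D.link = K ∧ Nat.card D.Component = 1

/-- The standard diagram of the trivial knot: one minimum followed by one maximum. -/
def circle : Diagram where
  word := [⟨[], .cup true, []⟩, ⟨[], .cap true, []⟩]
  nonempty := List.cons_ne_nil _ _
  closed := ⟨rfl, rfl, rfl⟩

/-- The trivial knot. -/
def unknot : OrientedLink := circle.link

/-! ### The HOMFLY polynomial -/

/-- The value of `ov` for which a crossing of strands with orientations `p`, `q` is positive: if
both strands point upward, or both downward, then the crossing is positive when the strand from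
the bottom left to the top right is the upper one; reversing one strand changes the sign. -/
def positiveOver (p q : Bool) : Bool := p == q

/-- The oriented smoothing of a crossing of strands with orientations `p`, `q`. -/
def smoothing (l r : List Bool) (p q : Bool) : List Slice :=
  if p = q then [] else [⟨l, .cap p, r⟩, ⟨l, .cup q, r⟩]

/-- The diagrams `Dp`, `Dm`, `D0` agree except near one crossing, which is positive in `Dp`,
negative in `Dm`, and smoothed according to the orientations in `D0`. -/
def IsSkeinTriple (Dp Dm D0 : Diagram) : Prop :=
  ∃ (u v : List Slice) (l r : List Bool) (p q : Bool),
    Dp.word = u ++ [⟨l, .cross (positiveOver p q) p q, r⟩] ++ v ∧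
    Dm.word = u ++ [⟨l, .cross (!positiveOver p q) p q, r⟩] ++ v ∧
    D0.word = u ++ smoothing l r p q ++ v

/-- The ring `ℤ[a^{±1}, z^{±1}]`, as Laurent polynomials in `z` over the Laurent polynomials in
`a`. -/
abbrev HomflyRing : Type := ℤ[T;T⁻¹][T;T⁻¹]

/-- The variable `a`. -/
noncomputable def varA : HomflyRingˣ :=
  ⟨LaurentPolynomial.C (.T 1), LaurentPolynomial.C (.T (-1)),
    by rw [← map_mul, ← LaurentPolynomial.T_add]; simp,
    by rw [← map_mul, ← LaurentPolynomial.T_add]; simp⟩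

/-- The variable `z`. -/
noncomputable def varZ : HomflyRing := .T 1

/-- The properties that characterise the HOMFLY polynomial among all invariants of oriented links:
the value `1` on the trivial knot, and the skein relation `a⁻¹ P(L₊) - a P(L₋) = z P(L₀)`. -/
def IsHomfly (P : OrientedLink → HomflyRing) : Prop :=
  P unknot = 1 ∧
  ∀ Dp Dm D0 : Diagram, IsSkeinTriple Dp Dm D0 →
    (↑varA⁻¹ : HomflyRing) * P Dp.link - (↑varA : HomflyRing) * P Dm.link = varZ * P D0.link

open Classical in
/-- The HOMFLY polynomial `P_K(a, z)`, that is, the unique invariant of oriented links that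
satisfies `IsHomfly`. -/
noncomputable def homfly : OrientedLink → HomflyRing :=
  if h : ∃ P, IsHomfly P then h.choose else 0

/-! ### Specialisations -/

/-- `P(a, z) ↦ P(a, w) ∈ ℂ[a^{±1}]`, for a complex number `w ≠ 0`. -/
noncomputable def evalZ (w : ℂˣ) : HomflyRing →+* ℂ[T;T⁻¹] :=
  LaurentPolynomial.eval₂ (AddMonoidAlgebra.mapRingHom ℤ (Int.castRingHom ℂ))
    (Units.map (LaurentPolynomial.C : ℂ →+* ℂ[T;T⁻¹]).toMonoidHom w)

/-- `P(a, z) ↦ P(w, z) ∈ ℂ[z^{±1}]`, for a complex number `w ≠ 0`. -/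
noncomputable def evalA (w : ℂˣ) : HomflyRing →+* ℂ[T;T⁻¹] :=
  AddMonoidAlgebra.mapRingHom ℤ (LaurentPolynomial.eval₂ (Int.castRingHom ℂ) w)

/-- Reduction modulo two, `ℤ[a^{±1}] → 𝔽₂[a^{±1}]`. -/
noncomputable def modTwo : ℤ[T;T⁻¹] →+* (ZMod 2)[T;T⁻¹] :=
  AddMonoidAlgebra.mapRingHom ℤ (Int.castRingHom (ZMod 2))

theorem rootOfUnity_ne_zero {k : ℕ} {ζ : ℂ} (hk : 2 ≤ k) (hζ : IsPrimitiveRoot ζ (2 * k)) :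
    ζ ≠ 0 :=
  hζ.ne_zero (by omega)

theorem rootOfUnity_sub_inv_ne_zero {k : ℕ} {ζ : ℂ} (hk : 3 ≤ k)
    (hζ : IsPrimitiveRoot ζ (2 * k)) : ζ - ζ⁻¹ ≠ 0 := by
  intro h
  have h0 : ζ ≠ 0 := hζ.ne_zero (by omega)
  have h2 : ζ ^ 2 = 1 := by
    have h1 : ζ = ζ⁻¹ := sub_eq_zero.mp h
    rw [pow_two]
    nth_rewrite 2 [h1]
    exact mul_inv_cancel₀ h0
  have := Nat.le_of_dvd two_pos (hζ.dvd_of_pow_eq_one 2 h2)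
  omega

/-! ### Twist moves -/

/-- The word `σ₁^m` on two adjacent vertical strands with orientations `p`, `q` (and with further
vertical strands `l` on the left and `r` on the right), all of whose crossings are positive. -/
def twist (l r : List Bool) : ℕ → Bool → Bool → List Slice
  | 0, _, _ => []
  | m + 1, p, q => ⟨l, .cross (positiveOver p q) p q, r⟩ :: twist l r m q p

/-- `K'` is obtained from `K` by a positive `t_m`-move: in some diagram of `K`, insert `m`
consecutive positive crossings into two adjacent parallel strands with equal orientations. -/
def IsTMove (m : ℕ) (K K' : OrientedLink) : Prop :=
  ∃ (D D' : Diagram) (u v : List Slice) (l r : List Bool) (o : Bool),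
    D.link = K ∧ D'.link = K' ∧ D.word = u ++ v ∧ D'.word = u ++ twist l r m o o ++ v

/-- `K'` is obtained from `K` by a positive `t̄_m`-move: in some diagram of `K`, insert `m`
consecutive positive crossings into two adjacent parallel strands with opposite orientations. -/
def IsTBarMove (m : ℕ) (K K' : OrientedLink) : Prop :=
  ∃ (D D' : Diagram) (u v : List Slice) (l r : List Bool) (o : Bool),
    D.link = K ∧ D'.link = K' ∧ D.word = u ++ v ∧ D'.word = u ++ twist l r m o (!o) ++ v

end LinkDiagrams

namespace LinkDiagrams

/-! ### Tangles -/

/-! The skein relation at one crossing of a twist gives a linear recursion in the number of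
crossings. For equally oriented strands let `w m` be the value with `m` crossings: switching the
lowest crossing makes it cancel with the next one, and smoothing deletes it, so `a⁻¹ w (m+2) - a w m
= z w (m+1)` (`value_twist`). At `z = ζ - ζ⁻¹` the characteristic roots are `aζ` and `-aζ⁻¹`. Their
`2k`-th powers are both `a^(2k)`, and for `k ≥ 3` they are distinct, whence part 1. For `k = 2` they
coincide, and one uses instead `w 4 = a⁴(1 + z²) w 0 + a³(2 + z²) z w 1`, where `w 0` and `z w 1`
are polynomials in `z`; reducing modulo 2 at `z = 0` gives part 2. For opposite orientations the
smoothing puts a minimum below the rest of the twist, which unwinds by first Reidemeister moves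
(`value_antitwist`). The recursion is then an affine map with multiplier `a²`; at `a = ζ` the
multiplier is not `1` and has `k`-th power `1`, so the `k`-th iterate is the identity, which is part
3.

The polynomiality in part 2 rests on a bound of the pole in `z` by the number of components
(`freeValue_mem`). Components are measured by counting two-colourings with a state model. A crossing
change preserves this count, and a smoothing at most doubles it (`colourings_smoothing`), which the
factor `z` of the skein relation compensates.

Statements about all diagrams are proved by `skein_induction`: isotopies, crossing changes (at the
cost of a smoothing) and removal of circles reduce every closed diagram to the empty one. Slices are
added from bottom to top while the part already treated is kept reducible to layered tangles, in
which each arc lies over all earlier ones; a closed layered tangle is empty.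

Since `homfly` is defined by choice, existence of the invariant must also be proved
(`exists_isHomfly`). For rational `q` and each rank `N`, the R-matrix of `sl_N` gives a vertex model
whose state sum is an isotopy invariant satisfying the skein relation with `z = q - q⁻¹` and `a =
q^(-N)`. Skein induction yields for each diagram a Laurent polynomial interpolating all these
normalised state sums. The specialisations are dense enough to determine it, so it inherits
invariance and the skein relation. -/

theorem isTangle_nil {s t : List Bool} : IsTangle s [] t ↔ s = t := Iff.rfl

theorem isTangle_cons {s t : List Bool} {x : Slice} {w : List Slice} :
    IsTangle s (x :: w) t ↔ s = x.bottom ∧ IsTangle x.top w t := Iff.rfl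

theorem isTangle_append {s t : List Bool} {a b : List Slice} :
    IsTangle s (a ++ b) t ↔ ∃ u, IsTangle s a u ∧ IsTangle u b t := by
  induction a generalizing s with
  | nil => simp [isTangle_nil]
  | cons x a ih => simp [isTangle_cons, ih, and_assoc]

theorem IsTangle.append {s t u : List Bool} {a b : List Slice} (ha : IsTangle s a t)
    (hb : IsTangle t b u) : IsTangle s (a ++ b) u := isTangle_append.2 ⟨t, ha, hb⟩

theorem IsTangle.unique {s t u : List Bool} {w : List Slice} (h : IsTangle s w t)
    (h' : IsTangle s w u) : t = u := by
  induction w generalizing s with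
  | nil => exact h.symm.trans h'
  | cons x w ih => exact ih h.2 h'.2

@[simp] theorem Slice.bottom_extend (l r : List Bool) (x : Slice) :
    (x.extend l r).bottom = l ++ x.bottom ++ r := by simp [Slice.extend, Slice.bottom]

@[simp] theorem Slice.top_extend (l r : List Bool) (x : Slice) :
    (x.extend l r).top = l ++ x.top ++ r := by simp [Slice.extend, Slice.top]

@[simp] theorem Slice.extend_extend (l r l' r' : List Bool) (x : Slice) :
    (x.extend l r).extend l' r' = x.extend (l' ++ l) (r ++ r') := by simp [Slice.extend]

@[simp] theorem Slice.extend_nil (x : Slice) : x.extend [] [] = x := by simp [Slice.extend]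

@[simp] theorem Slice.extend_mk (l r a b : List Bool) (g : Gen) :
    (Slice.mk a g b).extend l r = ⟨l ++ a, g, b ++ r⟩ := rfl

/-- Add vertical strands `l` on the left and `r` on the right of a word. -/
def ext (l r : List Bool) (w : List Slice) : List Slice := w.map (Slice.extend l r)

@[simp] theorem ext_empty (l r : List Bool) : ext l r [] = [] := rfl

@[simp] theorem ext_cons (l r : List Bool) (x : Slice) (w : List Slice) :
    ext l r (x :: w) = x.extend l r :: ext l r w := rfl

@[simp] theorem ext_append (l r : List Bool) (a b : List Slice) :
    ext l r (a ++ b) = ext l r a ++ ext l r b := List.map_append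

@[simp] theorem ext_ext (l r l' r' : List Bool) (w : List Slice) :
    ext l' r' (ext l r w) = ext (l' ++ l) (r ++ r') w := by
  simp [ext, List.map_map, Function.comp_def]

@[simp] theorem ext_nil (w : List Slice) : ext [] [] w = w := by
  simp [ext, funext Slice.extend_nil]

theorem IsTangle.ext {s t : List Bool} {w : List Slice} (h : IsTangle s w t) (l r : List Bool) :
    IsTangle (l ++ s ++ r) (ext l r w) (l ++ t ++ r) := by
  induction w generalizing s with
  | nil => rw [isTangle_nil] at h; subst h; rfl
  | cons x w ih =>
    obtain ⟨rfl, h⟩ := h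
    rw [ext_cons]
    exact ⟨by simp, by simpa using ih h⟩

theorem IsTangle.of_ext {s t l r : List Bool} {w : List Slice}
    (h : IsTangle (l ++ s ++ r) (LinkDiagrams.ext l r w) t) : ∃ t', t = l ++ t' ++ r ∧
    IsTangle s w t' := by
  induction w generalizing s with
  | nil => exact ⟨s, h.symm, rfl⟩
  | cons x w ih =>
    obtain ⟨h1, h⟩ := h
    rw [Slice.top_extend] at h
    obtain ⟨t', ht, h'⟩ := ih h
    refine ⟨t', ht, ?_, h'⟩
    simpa using h1

/-! ### Isotopy of tangles -/

/-- Isotopy of tangle diagrams with lower boundary `s` and upper boundary `t`. -/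
inductive Iso : List Bool → List Bool → List Slice → List Slice → Prop
  | move {x y : List Slice} {s t : List Bool} (l r : List Bool) (h : LocalMove x y)
      (hx : IsTangle s x t) (hy : IsTangle s y t) :
      Iso (l ++ s ++ r) (l ++ t ++ r) (ext l r x) (ext l r y)
  | refl {s t : List Bool} {w : List Slice} (h : IsTangle s w t) : Iso s t w w
  | symm {s t : List Bool} {a b : List Slice} (h : Iso s t a b) : Iso s t b a
  | trans {s t : List Bool} {a b c : List Slice} (h : Iso s t a b) (h' : Iso s t b c) :
      Iso s t a c
  | comp {s t u : List Bool} {a b c d : List Slice} (h : Iso s t a b) (h' : Iso t u c d) :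
      Iso s u (a ++ c) (b ++ d)

namespace Iso

theorem isTangle {s t : List Bool} {a b : List Slice} (h : Iso s t a b) :
    IsTangle s a t ∧ IsTangle s b t := by
  induction h with
  | move l r h hx hy => exact ⟨hx.ext l r, hy.ext l r⟩
  | refl h => exact ⟨h, h⟩
  | symm _ ih => exact ih.symm
  | trans _ _ ih ih' => exact ⟨ih.1, ih'.2⟩
  | comp _ _ ih ih' => exact ⟨ih.1.append ih'.1, ih.2.append ih'.2⟩

theorem extend {s t : List Bool} {a b : List Slice} (h : Iso s t a b) (l r : List Bool) :
    Iso (l ++ s ++ r) (l ++ t ++ r) (ext l r a) (ext l r b) := by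
  induction h with
  | move l' r' h hx hy =>
    rw [ext_ext, ext_ext]
    simpa using Iso.move (l ++ l') (r' ++ r) h hx hy
  | refl h => exact .refl (h.ext l r)
  | symm _ ih => exact ih.symm
  | trans _ _ ih ih' => exact ih.trans ih'
  | comp _ _ ih ih' =>
    simp only [ext_append] at ih ih' ⊢
    exact ih.comp ih'

theorem append_right {s t u : List Bool} {a b c : List Slice} (h : Iso s t a b)
    (hc : IsTangle t c u) : Iso s u (a ++ c) (b ++ c) := h.comp (.refl hc)

theorem append_left {s t u : List Bool} {a b c : List Slice} (h : Iso t u a b)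
    (hc : IsTangle s c t) : Iso s u (c ++ a) (c ++ b) := (Iso.refl hc).comp h

/-- An elementary piece on the left of a tangle can be moved past it. -/
theorem comm_left {s t : List Bool} {w : List Slice} (hw : IsTangle s w t) (l m : List Bool)
    (g : Gen) : Iso (l ++ g.bottom ++ m ++ s) (l ++ g.top ++ m ++ t)
      (ext (l ++ g.bottom ++ m) [] w ++ [⟨l, g, m ++ t⟩])
      (⟨l, g, m ++ s⟩ :: ext (l ++ g.top ++ m) [] w) := by
  induction w generalizing s with
  | nil =>
    rw [isTangle_nil] at hw
    subst hw
    exact .refl ⟨by simp [Slice.bottom], by simp [isTangle_nil, Slice.top]⟩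
  | cons x w ih =>
    obtain ⟨rfl, hw⟩ := hw
    obtain ⟨xl, h, xr⟩ := x
    have h1 := (Iso.move l xr (LocalMove.interchange g h (m ++ xl))
      (s := g.bottom ++ m ++ xl ++ h.bottom) (t := g.top ++ m ++ xl ++ h.top)
      ⟨by simp [Slice.bottom], by simp [Slice.bottom, Slice.top], by
        simp [isTangle_nil, Slice.top]⟩
      ⟨by simp [Slice.bottom], by simp [Slice.bottom, Slice.top], by
        simp [isTangle_nil, Slice.top]⟩)
    have h2 := h1.append_right (c := ext (l ++ g.top ++ m) [] w)
      (u := l ++ g.top ++ m ++ t) (by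
        have := hw.ext (l ++ g.top ++ m) []
        simpa [Slice.top] using this)
    have h3 := (ih hw).append_left (c := [Slice.extend (l ++ g.bottom ++ m) [] ⟨xl, h, xr⟩])
      (s := l ++ g.bottom ++ m ++ (xl ++ h.bottom ++ xr))
      ⟨by simp [Slice.bottom, Slice.extend], by simp [isTangle_nil, Slice.top, Slice.extend]⟩
    simp [Slice.extend, Slice.bottom, Slice.top] at h2 h3 ⊢
    exact h3.trans h2.symm

/-- An elementary piece on the right of a tangle can be moved past it. -/
theorem comm_right {s t : List Bool} {w : List Slice} (hw : IsTangle s w t) (m r : List Bool)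
    (g : Gen) : Iso (s ++ m ++ g.bottom ++ r) (t ++ m ++ g.top ++ r)
      (ext [] (m ++ g.bottom ++ r) w ++ [⟨t ++ m, g, r⟩])
      (⟨s ++ m, g, r⟩ :: ext [] (m ++ g.top ++ r) w) := by
  induction w generalizing s with
  | nil =>
    rw [isTangle_nil] at hw
    subst hw
    exact .refl ⟨by simp [Slice.bottom], by simp [isTangle_nil, Slice.top]⟩
  | cons x w ih =>
    obtain ⟨rfl, hw⟩ := hw
    obtain ⟨xl, h, xr⟩ := x
    have h1 := (Iso.move xl r (LocalMove.interchange h g (xr ++ m))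
      (s := h.bottom ++ xr ++ m ++ g.bottom) (t := h.top ++ xr ++ m ++ g.top)
      ⟨by simp [Slice.bottom], by simp [Slice.bottom, Slice.top], by
        simp [isTangle_nil, Slice.top]⟩
      ⟨by simp [Slice.bottom], by simp [Slice.bottom, Slice.top], by
        simp [isTangle_nil, Slice.top]⟩)
    have h2 := h1.append_right (c := ext [] (m ++ g.top ++ r) w)
      (u := t ++ m ++ g.top ++ r) (by
        have := hw.ext [] (m ++ g.top ++ r)
        simpa [Slice.top] using this)
    have h3 := (ih hw).append_left (c := [Slice.extend [] (m ++ g.bottom ++ r) ⟨xl, h, xr⟩])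
      (s := xl ++ h.bottom ++ xr ++ m ++ g.bottom ++ r)
      ⟨by simp [Slice.bottom, Slice.extend], by simp [isTangle_nil, Slice.top, Slice.extend]⟩
    simp [Slice.extend, Slice.bottom, Slice.top] at h2 h3 ⊢
    exact h3.trans h2

end Iso
/-! ### Strands passing over other strands -/

/-- The strand `x` passes from left to right over the strands `m`. -/
def overpass (x : Bool) : List Bool → List Slice
  | [] => []
  | y :: m => ⟨[], .cross true x y, m⟩ :: ext [y] [] (overpass x m)

theorem overpass_isTangle (x : Bool) (m : List Bool) : IsTangle (x :: m) (overpass x m) (m ++ [x]) := by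
  induction m with
  | nil => rfl
  | cons y m ih => exact ⟨rfl, by simpa [Slice.top, Gen.top] using ih.ext [y] []⟩

theorem overpass_append (x : Bool) (m n : List Bool) :
    overpass x (m ++ n) = ext [] n (overpass x m) ++ ext m [] (overpass x n) := by
  induction m with
  | nil => simp [overpass]
  | cons y m ih => simp [overpass, ih]

/-- An arc that passes over the strands `m`: its left end has orientation `o`. -/
def arc (o : Bool) (m : List Bool) : List Slice :=
  ⟨[], .cup o, m⟩ :: ext [o] [] (overpass (!o) m)

theorem arc_isTangle (o : Bool) (m : List Bool) : IsTangle m (arc o m) (o :: m ++ [!o]) :=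
  ⟨rfl, by simpa [Slice.top, Gen.top] using (overpass_isTangle (!o) m).ext [o] []⟩

theorem arc_append (o : Bool) (m n : List Bool) :
    arc o (m ++ n) = ext [] n (arc o m) ++ ext (o :: m) [] (overpass (!o) n) := by
  simp [arc, overpass_append]

/-! ### Isotopies of overpasses and arcs. -/

namespace Iso

/-- Apply an isotopy inside a word. -/
theorem step {s t s' t' : List Bool} {a b w w' : List Slice} (hw : IsTangle s' w t')
    (h : Iso s t a b) (ha : a ≠ []) (u v : List Slice) (e : w = u ++ (a ++ v))
    (e' : w' = u ++ (b ++ v)) : Iso s' t' w w' := by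
  subst e e'
  obtain ⟨s1, hu, hw⟩ := isTangle_append.1 hw
  obtain ⟨t1, ha1, hv⟩ := isTangle_append.1 hw
  -- A non-empty word determines its lower boundary; an empty one could sit at any level.
  have hs : s1 = s := by
    cases a with
    | nil => exact absurd rfl ha
    | cons x a => exact ha1.1.trans h.isTangle.1.1.symm
  subst hs
  obtain rfl := ha1.unique h.isTangle.1
  exact (h.append_right hv).append_left hu

theorem zigzag_left (o : Bool) (l r : List Bool) :
    Iso (l ++ o :: r) (l ++ o :: r) [⟨l, .cup o, o :: r⟩, ⟨l ++ [o], .cap (!o), r⟩] [] := by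
  simpa using Iso.move l r (LocalMove.zigzag_left o) (s := [o]) (t := [o])
    ⟨rfl, by simp [Slice.bottom, Slice.top, Gen.bottom, Gen.top], rfl⟩ rfl

theorem zigzag_right (o : Bool) (l r : List Bool) :
    Iso (l ++ o :: r) (l ++ o :: r) [⟨l ++ [o], .cup (!o), r⟩, ⟨l, .cap o, o :: r⟩] [] := by
  simpa using Iso.move l r (LocalMove.zigzag_right o) (s := [o]) (t := [o])
    ⟨rfl, by simp [Slice.bottom, Slice.top, Gen.bottom, Gen.top],
      by simp [isTangle_nil, Slice.top, Gen.top]⟩ rfl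

theorem slide_cap (ov o x : Bool) (l r : List Bool) :
    Iso (l ++ o :: x :: (!o) :: r) (l ++ x :: r)
      [⟨l ++ [o], .cross ov x (!o), r⟩, ⟨l, .cap o, x :: r⟩]
      [⟨l, .cross (!ov) o x, (!o) :: r⟩, ⟨l ++ [x], .cap o, r⟩] := by
  simpa using Iso.move l r (LocalMove.slide_cap ov o x)
    (s := [o, x, !o]) (t := [x]) ⟨rfl, rfl, rfl⟩ ⟨rfl, rfl, rfl⟩

theorem slide_cup (ov o x : Bool) (l r : List Bool) :
    Iso (l ++ x :: r) (l ++ o :: x :: (!o) :: r)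
      [⟨l, .cup o, x :: r⟩, ⟨l ++ [o], .cross ov (!o) x, r⟩]
      [⟨l ++ [x], .cup o, r⟩, ⟨l, .cross (!ov) x o, (!o) :: r⟩] := by
  simpa using Iso.move l r (LocalMove.slide_cup ov o x)
    (s := [x]) (t := [o, x, !o]) ⟨rfl, rfl, rfl⟩ ⟨rfl, rfl, rfl⟩

theorem reidemeister1_cap (ov o : Bool) (l r : List Bool) :
    Iso (l ++ o :: (!o) :: r) (l ++ r)
      [⟨l, .cross ov o (!o), r⟩, ⟨l, .cap (!o), r⟩] [⟨l, .cap o, r⟩] := by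
  simpa using Iso.move l r (LocalMove.reidemeister1_cap ov o)
    (s := [o, !o]) (t := []) ⟨rfl, by simp [Slice.bottom, Slice.top, Gen.bottom, Gen.top], rfl⟩
      ⟨rfl, rfl⟩

theorem reidemeister1_cup (ov o : Bool) (l r : List Bool) :
    Iso (l ++ r) (l ++ (!o) :: o :: r)
      [⟨l, .cup o, r⟩, ⟨l, .cross ov o (!o), r⟩] [⟨l, .cup (!o), r⟩] := by
  simpa using Iso.move l r (LocalMove.reidemeister1_cup ov o)
    (s := []) (t := [!o, o]) ⟨rfl, rfl, rfl⟩
      ⟨rfl, by simp [isTangle_nil, Slice.top, Gen.top]⟩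

theorem reidemeister2 (ov p q : Bool) (l r : List Bool) :
    Iso (l ++ p :: q :: r) (l ++ p :: q :: r)
      [⟨l, .cross ov p q, r⟩, ⟨l, .cross (!ov) q p, r⟩] [] := by
  simpa using Iso.move l r (LocalMove.reidemeister2 ov p q)
    (s := [p, q]) (t := [p, q]) ⟨rfl, rfl, rfl⟩ rfl

theorem reidemeister3 (ov p q x : Bool) (l r : List Bool) :
    Iso (l ++ p :: q :: x :: r) (l ++ x :: q :: p :: r)
      [⟨l, .cross ov p q, x :: r⟩, ⟨l ++ [q], .cross ov p x, r⟩, ⟨l, .cross ov q x, p :: r⟩]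
      [⟨l ++ [p], .cross ov q x, r⟩, ⟨l, .cross ov p x, q :: r⟩,
        ⟨l ++ [x], .cross ov p q, r⟩] := by
  simpa using Iso.move l r (LocalMove.reidemeister3 ov p q x)
    (s := [p, q, x]) (t := [x, q, p]) ⟨rfl, rfl, rfl, rfl⟩ ⟨rfl, rfl, rfl, rfl⟩

/-- A strand that passes over a crossing can be moved past it. -/
theorem overpass_cross (ov x p q : Bool) :
    Iso [x, p, q] [q, p, x] (overpass x [p, q] ++ [⟨[], .cross ov p q, [x]⟩])
      (⟨[x], .cross ov p q, []⟩ :: overpass x [q, p]) := by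
  cases ov with
  | true => simpa [overpass] using Iso.reidemeister3 true x p q [] []
  -- The third move has three crossings of the same kind. For the other kind, conjugate: insert a
  -- cancelling pair below, apply the move to the inverse crossing, and cancel the pair that appears
  -- on top.
  | false =>
    have h1 := Iso.reidemeister3 true x q p [] []
    have h2 := Iso.reidemeister2 false p q [x] []
    have h3 := Iso.reidemeister2 true q p [] [x]
    have h4 := (h2.append_right (c := overpass x [p, q] ++ [⟨[], .cross false p q, [x]⟩])
      (u := [q, p, x]) (by exact ⟨rfl, rfl, rfl, rfl⟩))
    have h5 := h1.append_left (c := [⟨[x], .cross false p q, []⟩]) (s := [x, p, q]) ⟨rfl, rfl⟩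
    have h6 := h5.append_right (c := [⟨[], .cross false p q, [x]⟩]) (u := [q, p, x]) ⟨rfl, rfl⟩
    have h7 := h3.append_left (c := ⟨[x], .cross false p q, []⟩ :: overpass x [q, p])
      (s := [x, p, q]) ⟨rfl, rfl, rfl, rfl⟩
    simp [overpass] at h4 h5 h6 h7 ⊢
    exact h4.symm.trans (h6.symm.trans h7)

/-- A strand that passes over a maximum can be moved past it. -/
theorem overpass_cap (x p : Bool) :
    Iso [x, p, !p] [x] (overpass x [p, !p] ++ [⟨[], .cap p, [x]⟩]) [⟨[x], .cap p, []⟩] := by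
  have h1 := (Iso.slide_cap true p x [] []).append_left (c := [⟨[], .cross true x p, [!p]⟩])
    (s := [x, p, !p]) ⟨rfl, rfl⟩
  have h2 := (Iso.reidemeister2 true x p [] [!p]).append_right (c := [⟨[x], .cap p, []⟩])
    (u := [x]) ⟨rfl, rfl⟩
  simp [overpass] at h1 h2 ⊢
  exact h1.trans h2

end Iso

theorem Gen.bottom_eq_cross_or_cap {g : Gen} (hg : g.bottom ≠ []) :
    (∃ ov p q, g = .cross ov p q) ∨ ∃ p, g = .cap p := by
  cases g with
  | cup o => exact absurd rfl hg
  | cap o => exact .inr ⟨o, rfl⟩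
  | cross ov p q => exact .inl ⟨ov, p, q, rfl⟩

namespace Iso

theorem overpass_gen (x : Bool) {g : Gen} (hg : g.bottom ≠ []) :
    Iso (x :: g.bottom) (g.top ++ [x]) (overpass x g.bottom ++ [⟨[], g, [x]⟩])
      (⟨[x], g, []⟩ :: overpass x g.top) := by
  rcases Gen.bottom_eq_cross_or_cap hg with ⟨ov, p, q, rfl⟩ | ⟨p, rfl⟩
  · exact overpass_cross ov x p q
  · exact overpass_cap x p

/-- A crossing or maximum below an arc can be moved past it. -/
theorem arc_gen (o : Bool) (m n : List Bool) {g : Gen} (hg : g.bottom ≠ []) :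
    Iso (m ++ g.bottom ++ n) (o :: m ++ g.top ++ n ++ [!o])
      (arc o (m ++ g.bottom ++ n) ++ [⟨o :: m, g, n ++ [!o]⟩])
      (⟨m, g, n⟩ :: arc o (m ++ g.top ++ n)) := by
  have h0 := (arc_isTangle o (m ++ g.bottom ++ n)).append (b := [⟨o :: m, g, n ++ [!o]⟩])
    (u := o :: m ++ g.top ++ n ++ [!o]) ⟨by simp [Slice.bottom], by simp [isTangle_nil, Slice.top]⟩
  -- The arc crosses `m`, then the strands of `g`, then `n`. The piece is pushed down through these
  -- three segments, starting with the one over `n`.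
  have h1 := step h0 (comm_left (overpass_isTangle (!o) n) (o :: m) [] g) (by simp)
    (ext [] (g.bottom ++ n) (arc o m) ++ ext (o :: m) n (overpass (!o) g.bottom)) []
    (by simp [arc_append, overpass_append]) rfl
  have h2 := step h1.isTangle.2 ((overpass_gen (!o) hg).extend (o :: m) n) (by simp)
    (ext [] (g.bottom ++ n) (arc o m)) (ext (o :: m ++ g.top) [] (overpass (!o) n))
    (by simp) rfl
  have h3 := step h2.isTangle.2 (comm_right (arc_isTangle o m) [] n g) (by simp)
    [] (ext (o :: m) n (overpass (!o) g.top) ++ ext (o :: m ++ g.top) [] (overpass (!o) n))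
    (by simp) rfl
  refine (h1.trans h2).trans (h3.trans ?_)
  convert Iso.refl h3.isTangle.2 using 1
  simp [arc_append, overpass_append]

/-- Shift the left end of an arc to the left. -/
theorem arc_cross_left (o p : Bool) (m : List Bool) :
    Iso (p :: m) (o :: p :: m ++ [!o])
      (ext [p] [] (arc o m) ++ [⟨[], .cross false p o, m ++ [!o]⟩]) (arc o (p :: m)) := by
  have h0 := ((arc_isTangle o m).ext [p] []).append (b := [⟨[], .cross false p o, m ++ [!o]⟩])
    (u := o :: p :: m ++ [!o]) ⟨by simp [Slice.bottom, Gen.bottom],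
      by simp [isTangle_nil, Slice.top, Gen.top]⟩
  have h1 := step h0 (comm_left (overpass_isTangle (!o) m) [] [] (.cross false p o)) (by simp)
    [⟨[p], .cup o, m⟩] [] (by simp [arc, Gen.bottom]) rfl
  have h2 := step h1.isTangle.2 (slide_cup true o p [] m).symm (by simp) []
    (ext [o, p] [] (overpass (!o) m)) (by simp [Gen.top]) rfl
  simpa [arc, overpass] using h1.trans h2

/-- A maximum that connects a strand with the left end of an arc straightens the arc. -/
theorem arc_cap_left (p : Bool) (m : List Bool) :
    Iso (p :: m) (m ++ [p])
      (ext [p] [] (arc (!p) m) ++ [⟨[], .cap p, m ++ [p]⟩]) (overpass p m) := by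
  have h0 := ((arc_isTangle (!p) m).ext [p] []).append (b := [⟨[], .cap p, m ++ [p]⟩])
    (u := m ++ [p]) ⟨by simp [Slice.bottom, Gen.bottom],
      by simp [isTangle_nil, Slice.top, Gen.top]⟩
  have h1 := step h0 (comm_left (overpass_isTangle p m) [] [] (.cap p)) (by simp)
    [⟨[p], .cup (!p), m⟩] [] (by simp [arc, Gen.bottom]) rfl
  have h2 := step h1.isTangle.2 (zigzag_right p [] m) (by simp) []
    (overpass p m) (by simp [Gen.top]) rfl
  simpa using h1.trans h2

/-- Shift the left end of an arc to the right. -/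
theorem arc_cross_right (o q : Bool) (m : List Bool) :
    Iso (q :: m) (q :: o :: m ++ [!o])
      (arc o (q :: m) ++ [⟨[], .cross true o q, m ++ [!o]⟩]) (ext [q] [] (arc o m)) := by
  have h0 := (arc_cross_left o q m).symm.append_right
    (c := [⟨[], .cross true o q, m ++ [!o]⟩]) (u := q :: o :: m ++ [!o])
    ⟨rfl, by simp [isTangle_nil, Slice.top, Gen.top]⟩
  have h1 := step h0.isTangle.2 (reidemeister2 false q o [] (m ++ [!o])) (by simp)
    (ext [q] [] (arc o m)) [] (by simp) rfl
  simpa using h0.trans h1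

/-- A maximum that connects the left end of an arc with a strand below the arc. -/
theorem arc_cap_inner_left (o : Bool) (m : List Bool) :
    Iso ((!o) :: m) (m ++ [!o])
      (arc o ((!o) :: m) ++ [⟨[], .cap o, m ++ [!o]⟩]) (overpass (!o) m) := by
  have h0 := (arc_cross_left o (!o) m).symm.append_right
    (c := [⟨[], .cap o, m ++ [!o]⟩]) (u := m ++ [!o])
    ⟨rfl, by simp [isTangle_nil, Slice.top, Gen.top]⟩
  have h1 := step h0.isTangle.2 (reidemeister1_cap false (!o) [] (m ++ [!o])) (by simp)
    (ext [!o] [] (arc o m)) [] (by simp) rfl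
  have h2 := arc_cap_left (!o) m
  simp at h0 h1 h2
  exact h0.trans (h1.trans h2)

theorem arc_curl (ov o : Bool) :
    Iso [] [!o, o] (arc o [] ++ [⟨[], .cross ov o (!o), []⟩]) (arc (!o) []) := by
  simpa [arc, overpass] using reidemeister1_cup ov o [] []

/-- Shift the right end of an arc to the left. -/
theorem arc_cross_inner_right (o p : Bool) (m : List Bool) :
    Iso (m ++ [p]) (o :: m ++ [!o, p])
      (arc o (m ++ [p]) ++ [⟨o :: m, .cross false p (!o), []⟩]) (ext [] [p] (arc o m)) := by
  have h0 := (arc_isTangle o (m ++ [p])).append (b := [⟨o :: m, .cross false p (!o), []⟩])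
    (u := o :: m ++ [!o, p]) ⟨by simp [Slice.bottom, Gen.bottom],
      by simp [isTangle_nil, Slice.top, Gen.top]⟩
  have h1 := step h0 (reidemeister2 true (!o) p (o :: m) []) (by simp)
    (ext [] [p] (arc o m)) [] (by simp [arc_append, overpass]) rfl
  simpa using h1

/-- A maximum that connects the right end of an arc with a strand below the arc. -/
theorem arc_cap_inner_right (o : Bool) (m : List Bool) :
    Iso (m ++ [o]) (o :: m) (arc o (m ++ [o]) ++ [⟨o :: m, .cap o, []⟩])
      (ext [] [o] (arc o m) ++ [⟨o :: m, .cap (!o), []⟩]) := by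
  have h0 := (arc_isTangle o (m ++ [o])).append (b := [⟨o :: m, .cap o, []⟩])
    (u := o :: m) ⟨by simp [Slice.bottom, Gen.bottom],
      by simp [isTangle_nil, Slice.top, Gen.top]⟩
  have h1 := step h0 (reidemeister1_cap true (!o) (o :: m) []) (by simp)
    (ext [] [o] (arc o m)) [] (by simp [arc_append, overpass]) rfl
  simpa using h1

/-- A maximum that connects the right end of an arc with the next strand, which therefore passes
to the left end of the arc. -/
theorem arc_cap_right (o x : Bool) (m : List Bool) :
    Iso (m ++ [x, o]) (o :: m ++ [x])
      (ext [] [o] (arc o (m ++ [x])) ++ [⟨o :: m ++ [x], .cap (!o), []⟩])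
      (⟨m, .cross false x o, []⟩ ::
        ext [] [x] (ext [] [o] (arc o m) ++ [⟨o :: m, .cap (!o), []⟩])) := by
  have h0 := ((arc_isTangle o (m ++ [x])).ext [] [o]).append
    (b := [⟨o :: m ++ [x], .cap (!o), []⟩])
    (u := o :: m ++ [x]) ⟨by simp [Slice.bottom, Gen.bottom],
      by simp [isTangle_nil, Slice.top, Gen.top]⟩
  have h1 := step h0 (by simpa using (slide_cap false (!o) x (o :: m) []).symm) (by simp)
    (ext [] [x, o] (arc o m)) [] (by simp [arc_append, overpass]) rfl
  have h2 := step h1.isTangle.2 (comm_right (arc_isTangle o m) [] [] (.cross false x o)) (by simp)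
    [] [⟨o :: m, .cap (!o), [x]⟩] (by simp [Gen.bottom]) rfl
  simpa [Gen.top] using h1.trans h2

end Iso

/-! ### Layered tangles -/

/-- Tangle diagrams without lower boundary that consist of arcs of which each one passes over all
earlier ones. -/
inductive Layered : List Bool → List Slice → Prop
  | nil : Layered [] []
  | arc {l m r : List Bool} {w : List Slice} (o : Bool) (h : Layered (l ++ m ++ r) w) :
      Layered (l ++ (o :: m ++ [!o]) ++ r) (w ++ ext l r (arc o m))

/-- The tangle diagrams without lower boundary that can be reduced to layered ones by isotopy,
the skein relation, and removal of circles. -/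
inductive Reducible : List Bool → List Slice → Prop
  | layered {t : List Bool} {w : List Slice} (h : Layered t w) : Reducible t w
  | iso {t : List Bool} {a b : List Slice} (h : Iso [] t a b) (ha : Reducible t a) : Reducible t b
  | skein {t l r : List Bool} {u v : List Slice} {ov p q : Bool}
      (h : Reducible t (u ++ [⟨l, .cross ov p q, r⟩] ++ v))
      (h0 : Reducible t (u ++ smoothing l r p q ++ v)) :
      Reducible t (u ++ [⟨l, .cross (!ov) p q, r⟩] ++ v)
  | loop {t l r : List Bool} {u v : List Slice} {o : Bool} (hu : IsTangle [] u (l ++ r))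
      (h : Reducible t (u ++ v)) :
      Reducible t (u ++ [⟨l, .cup o, r⟩, ⟨l, .cap o, r⟩] ++ v)

theorem Layered.isTangle {t : List Bool} {w : List Slice} (h : Layered t w) :
    IsTangle [] w t := by
  induction h with
  | nil => rfl
  | arc o _ ih => exact ih.append ((arc_isTangle o _).ext _ _)

theorem loop_isTangle (l r : List Bool) (o : Bool) :
    IsTangle (l ++ r) [⟨l, .cup o, r⟩, ⟨l, .cap o, r⟩] (l ++ r) :=
  ⟨by simp [Slice.bottom, Gen.bottom], rfl, by simp [isTangle_nil, Slice.top, Gen.top]⟩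

namespace Reducible

theorem isTangle {t : List Bool} {w : List Slice} (h : Reducible t w) : IsTangle [] w t := by
  induction h with
  | layered h => exact h.isTangle
  | iso h _ _ => exact h.isTangle.2
  | skein _ _ ih _ =>
    simp only [List.append_assoc, isTangle_append, List.singleton_append, isTangle_cons] at ih ⊢
    exact ih
  | loop hu _ ih =>
    obtain ⟨s, hs, hv⟩ := isTangle_append.1 ih
    obtain rfl := hs.unique hu
    exact (hu.append (loop_isTangle _ _ _)).append hv

/-- It suffices to check on layered tangles that a tangle on top preserves reducibility. -/
theorem append_of_layered {s t : List Bool} {v : List Slice} (hv : IsTangle s v t)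
    (H : ∀ w, Layered s w → Reducible t (w ++ v)) {w : List Slice} (hw : Reducible s w) :
    Reducible t (w ++ v) := by
  induction hw with
  | layered h => exact H _ h
  | iso h _ ih => exact .iso (h.append_right hv) ih
  | skein _ _ ih ih0 =>
    have h1 := ih
    have h2 := ih0
    simp only [List.append_assoc] at h1 h2 ⊢
    simpa using Reducible.skein (v := _ ++ v) (by simpa using h1) (by simpa using h2)
  | loop hu _ ih =>
    have h1 := ih
    simpa using Reducible.loop (v := _ ++ v) hu (by simpa using h1)

/-- On a layered tangle a further arc is again layered by definition, and the reduction steps below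
the arc are unaffected by it. -/
theorem append_arc {l m r : List Bool} {w : List Slice} (o : Bool)
    (hw : Reducible (l ++ m ++ r) w) :
    Reducible (l ++ (o :: m ++ [!o]) ++ r) (w ++ ext l r (arc o m)) :=
  append_of_layered ((arc_isTangle o m).ext l r) (fun _ h => .layered (.arc o h)) hw

theorem append_cup {l r : List Bool} {w : List Slice} (o : Bool) (hw : Reducible (l ++ r) w) :
    Reducible (l ++ o :: (!o) :: r) (w ++ [⟨l, .cup o, r⟩]) := by
  have := append_arc (m := []) o (by simpa using hw)
  simpa [arc, overpass] using this

theorem of_iso {l r s t t' : List Bool} {w a b : List Slice} (h : Iso s t a b)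
    (hw : IsTangle [] w (l ++ s ++ r)) (hb : Reducible t' (w ++ ext l r b))
    (ht : t' = l ++ t ++ r) : Reducible t' (w ++ ext l r a) := by
  subst ht
  exact .iso ((h.symm.extend l r).append_left hw) hb

/-- If the smoothings are reducible, then a crossing may be replaced by the opposite one. -/
theorem cross_of_cross {l r : List Bool} {p q ov : Bool} {w : List Slice}
    (hw : Reducible (l ++ p :: q :: r) w)
    (hcap : q = !p → Reducible (l ++ r) (w ++ [⟨l, .cap p, r⟩]))
    (hov : Reducible (l ++ q :: p :: r) (w ++ [⟨l, .cross ov p q, r⟩])) (ov' : Bool) :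
    Reducible (l ++ q :: p :: r) (w ++ [⟨l, .cross ov' p q, r⟩]) := by
  by_cases h : ov' = ov
  · rwa [h]
  · obtain rfl : ov' = !ov := by cases ov <;> cases ov' <;> simp_all
    -- For parallel strands the smoothing is `w` itself; for antiparallel ones it is the maximum of
    -- `hcap` followed by a minimum, which is an arc over nothing.
    have key : Reducible (l ++ q :: p :: r) (w ++ smoothing l r p q) := by
      by_cases hpq : p = q
      · subst hpq
        simpa [smoothing] using hw
      · have hq : q = !p := by cases p <;> cases q <;> simp_all
        have h1 := append_cup q (hcap hq)
        simpa [smoothing, hpq, hq] using h1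
    simpa using Reducible.skein (v := []) (by simpa using hov) (by simpa using key)

/-- Reducibility is preserved by crossings and maxima on top of at most `n` strands. -/
def ClosedBelow (n : ℕ) : Prop :=
  ∀ (x : Slice) (w : List Slice), x.gen.bottom ≠ [] → x.bottom.length < n →
    Reducible x.bottom w → Reducible x.top (w ++ [x])

/-- An overpass consists of crossings on an unchanged number of strands, so the induction hypothesis
`ClosedBelow n` applies to each of them. -/
theorem append_overpass {n : ℕ} (hn : ClosedBelow n) {x : Bool} {l m r t : List Bool}
    {w : List Slice} (hw : Reducible (l ++ x :: m ++ r) w) (hl : (l ++ x :: m ++ r).length < n)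
    (ht : t = l ++ (m ++ [x]) ++ r) :
    Reducible t (w ++ ext l r (overpass x m)) := by
  subst ht
  induction m generalizing l w with
  | nil => simpa [overpass] using hw
  | cons y m ih =>
    have h1 := hn ⟨l, .cross true x y, m ++ r⟩ w (by simp [Gen.bottom])
      (by simpa [Slice.bottom, Gen.bottom] using hl)
      (by simpa [Slice.bottom, Gen.bottom] using hw)
    have h2 := @ih (l ++ [y]) _ (by simpa [Slice.top, Gen.top] using h1) (by
      simp at hl ⊢; omega)
    simpa [overpass] using h2

/-- The maximum joins the arc to the strand on its right, which thus becomes a strand passing over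
`m` from right to left. It is unrolled into crossings one strand of `m` at a time, each within the
bound of `ClosedBelow n`, and finally straightened. -/
theorem append_arc_cap_right {n : ℕ} (hn : ClosedBelow n) {o : Bool} {l m r : List Bool}
    {w : List Slice} (hw : Reducible (l ++ (m ++ [o]) ++ r) w)
    (hl : (l ++ (m ++ [o]) ++ r).length < n) :
    Reducible (l ++ (o :: m) ++ r)
      (w ++ ext l r (ext [] [o] (arc o m) ++ [⟨o :: m, .cap (!o), []⟩])) := by
  induction m using List.reverseRecOn generalizing r w with
  | nil =>
    refine of_iso (s := [o]) (t := [o]) (b := []) ?_ hw.isTangle (by simpa using hw) rfl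
    simpa [arc, overpass] using Iso.zigzag_left o [] []
  | append_singleton m x ih =>
    refine of_iso (by simpa using Iso.arc_cap_right o x m) (by simpa using hw.isTangle) ?_
      (by simp)
    have h1 := hn ⟨l ++ m, .cross false x o, r⟩ w (by simp [Gen.bottom])
      (by simpa [Slice.bottom, Gen.bottom] using hl)
      (by simpa [Slice.bottom, Gen.bottom] using hw)
    have h2 := @ih (x :: r) _ (by simpa [Slice.top, Gen.top] using h1) (by
      simp at hl ⊢; omega)
    simpa using h2

end Reducible

/-- The marked entry `x` stands to the left of `y`, at the same place, or to its right; this locates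
strands relative to the ends of an arc. -/
theorem append_cons_eq_append_cons {α : Type*} {a b c d : List α} {x y : α} :
    a ++ x :: b = c ++ y :: d ↔ (∃ e, c = a ++ x :: e ∧ b = e ++ y :: d) ∨
      (a = c ∧ x = y ∧ b = d) ∨ ∃ e, a = c ++ y :: e ∧ d = e ++ x :: b := by
  induction a generalizing c with
  | nil => cases c <;> simp [eq_comm]
  | cons z a ih =>
    cases c with
    | nil => simp [eq_comm]
    | cons z' c => simp [ih, and_or_left, exists_and_left, eq_comm, and_assoc]

/-! ### Two adjacent strands at the top of a layered tangle. -/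

namespace Layered

/-- What has to be shown about two adjacent strands at the top of a tangle. -/
def Adjacent (l r : List Bool) (p q : Bool) (w : List Slice) : Prop :=
  (q = !p → Reducible (l ++ r) (w ++ [⟨l, .cap p, r⟩])) ∧
    ∃ ov, Reducible (l ++ q :: p :: r) (w ++ [⟨l, .cross ov p q, r⟩])

theorem adjacent_of_gen {l r : List Bool} {p q : Bool} {w : List Slice}
    (h : ∀ g : Gen, g.bottom = [p, q] → Reducible (l ++ g.top ++ r) (w ++ [⟨l, g, r⟩])) :
    Adjacent l r p q w := by
  refine ⟨fun hq => ?_, true, ?_⟩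
  · simpa [Gen.top] using h (.cap p) (by simp [Gen.bottom, hq])
  · simpa [Gen.top] using h (.cross true p q) rfl

open Reducible in
-- Compare the two strands with the ends of the last arc. If neither is an end, the new piece slides
-- below the arc, where there are two strands fewer. If exactly one is an end, the convenient
-- crossing lengthens or shortens the arc, and a maximum turns the arc into an overpass. One kind of
-- crossing suffices, because the skein relation supplies the other.
theorem adjacent {n : ℕ} (hn : ClosedBelow n) {l r : List Bool} {p q : Bool} {w : List Slice}
    (hw : Layered (l ++ p :: q :: r) w) (hl : (l ++ p :: q :: r).length ≤ n) :
    Adjacent l r p q w := by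
  generalize ht : l ++ p :: q :: r = t at hw hl
  cases hw with
  | nil => simp at ht
  | @arc l' m r' w o hw =>
  have hlen : (l' ++ m ++ r').length < n := by simp at hl ⊢; omega
  have hR := Reducible.layered hw
  have ht' : l ++ p :: (q :: r) = l' ++ o :: (m ++ (!o) :: r') := by simpa using ht
  rcases append_cons_eq_append_cons.1 ht' with ⟨e, rfl, h⟩ | ⟨rfl, rfl, h⟩ | ⟨e, rfl, h⟩
  · rcases e with _ | ⟨q', e⟩
    · simp at h
      obtain ⟨rfl, rfl⟩ := h
      refine ⟨?_, false, ?_⟩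
      · rintro rfl
        have := of_iso (l := l) (r := r') (Iso.arc_cap_left p m) (w := w)
          (by simpa using hw.isTangle)
          (append_overpass hn (by simpa using hR) (by simpa using hlen) rfl) rfl
        simpa using this
      · have h1 := append_arc (l := l) (m := p :: m) (r := r') q (by simpa using hR)
        have := of_iso (l := l) (r := r') (Iso.arc_cross_left q p m) (w := w)
          (by simpa using hw.isTangle) h1 rfl
        simpa using this
    · simp at h
      obtain ⟨rfl, rfl⟩ := h
      refine adjacent_of_gen fun g hg => ?_
      have h1 := hn ⟨l, g, e ++ m ++ r'⟩ w (by simp [hg])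
        (by simpa [Slice.bottom, hg] using hlen) (by simpa [Slice.bottom, hg] using hR)
      have h2 := append_arc (l := l ++ g.top ++ e) (m := m) (r := r') o
        (by simpa [Slice.top] using h1)
      have := of_iso (l := l) (r := r') (Iso.comm_left (arc_isTangle o m) [] e g) (w := w)
        (by simpa [hg] using hw.isTangle) (by simpa using h2) rfl
      simpa [hg] using this
  · rcases m with _ | ⟨q', m⟩
    · simp at h
      obtain ⟨rfl, rfl⟩ := h
      -- Both strands are ends of the same arc over nothing: a maximum closes a circle, and a
      -- crossing is a curl. This is the only place where circles split off.
      refine ⟨fun _ => ?_, true, ?_⟩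
      · have := Reducible.loop (o := p) (v := []) (by simpa using hw.isTangle)
          (by simpa using hR)
        simpa [LinkDiagrams.arc, overpass] using this
      · have := of_iso (l := l) (r := r) (Iso.arc_curl true p) (w := w)
          (by simpa using hw.isTangle) (append_arc (!p) hR) (by simp)
        simpa using this
    · simp at h
      obtain ⟨rfl, rfl⟩ := h
      refine ⟨?_, true, ?_⟩
      · rintro rfl
        have := of_iso (l := l) (r := r') (Iso.arc_cap_inner_left p m) (w := w)
          (by simpa using hw.isTangle)
          (append_overpass hn (by simpa using hR) (by simpa using hlen) rfl) rfl
        simpa using this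
      · have h1 := append_arc (l := l ++ [q]) (m := m) (r := r') p (by simpa using hR)
        have := of_iso (l := l) (r := r') (Iso.arc_cross_right p q m) (w := w)
          (by simpa using hw.isTangle) (by simpa using h1) (by simp)
        simpa using this
  -- Both strands lie to the right of the left end of the arc; now compare them with its right end.
  · rcases append_cons_eq_append_cons.1 h with ⟨f, rfl, rfl⟩ | ⟨rfl, rfl, rfl⟩ | ⟨f, rfl, hf⟩
    · refine adjacent_of_gen fun g hg => ?_
      have h1 := hn ⟨l' ++ m ++ f, g, r⟩ w (by simp [hg])
        (by simpa [Slice.bottom, hg] using hlen) (by simpa [Slice.bottom, hg] using hR)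
      have h2 := append_arc (l := l') (m := m) (r := f ++ g.top ++ r) o
        (by simpa [Slice.top] using h1)
      have := of_iso (l := l') (r := r) (Iso.comm_right (arc_isTangle o m) f [] g) (w := w)
        (by simpa [hg] using hw.isTangle) (by simpa using h2) rfl
      simpa [hg] using this
    · refine ⟨?_, true, ?_⟩
      · intro hq
        obtain rfl : q = o := by simpa using hq
        have := append_arc_cap_right hn (l := l') (m := m) (r := r) (o := q)
          (by simpa using hR) (by simpa using hlen)
        simpa using this
      · have h1 := append_arc (l := l') (m := m ++ [q]) (r := r) o (by simpa using hR)
        simpa [arc_append, overpass] using h1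
    · rcases f with _ | ⟨q', f⟩
      · obtain ⟨hq, rfl⟩ := List.cons.inj hf
        subst hq
        refine ⟨?_, false, ?_⟩
        · intro hq
          obtain rfl : o = p := by simpa using hq
          have h1 := append_arc_cap_right hn (l := l') (m := e) (r := r) (o := o)
            (by simpa using hR) (by simpa using hlen)
          have := of_iso (l := l') (r := r) (Iso.arc_cap_inner_right o e) (w := w)
            (by simpa using hw.isTangle) h1 rfl
          simpa using this
        · have h1 := append_arc (l := l') (m := e) (r := p :: r) o (by simpa using hR)
          have := of_iso (l := l') (r := r) (Iso.arc_cross_inner_right o p e) (w := w)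
            (by simpa using hw.isTangle) (by simpa using h1) (by simp)
          simpa using this
      · simp at hf
        obtain ⟨rfl, rfl⟩ := hf
        refine adjacent_of_gen fun g hg => ?_
        have h1 := hn ⟨l' ++ e, g, f ++ r'⟩ w (by simp [hg])
          (by simpa [Slice.bottom, hg] using hlen) (by simpa [Slice.bottom, hg] using hR)
        have h2 := append_arc (l := l') (m := e ++ g.top ++ f) (r := r') o
          (by simpa [Slice.top] using h1)
        have := of_iso (l := l') (r := r') (Iso.arc_gen o e f (g := g) (by simp [hg])) (w := w)
          (by simpa [hg] using hw.isTangle) (by simpa using h2) (by simp)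
        simpa [hg] using this

end Layered

/-! ### Every tangle without lower boundary is reducible. -/

namespace Reducible

/-- Induction on the number of strands: taking off the last arc of a layered tangle leaves two
strands fewer. The bound in `ClosedBelow` is strict, so `n = 0` is vacuous. -/
theorem closedBelow (n : ℕ) : ClosedBelow n := by
  induction n with
  | zero => exact fun x w _ h _ => absurd h (Nat.not_lt_zero _)
  | succ n ih =>
    intro x w hx hl hw
    refine append_of_layered (v := [x]) ⟨rfl, rfl⟩ (fun w hw => ?_) hw
    obtain ⟨l, g, r⟩ := x
    rcases Gen.bottom_eq_cross_or_cap hx with ⟨ov, p, q, rfl⟩ | ⟨p, rfl⟩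
    · have hw' : Layered (l ++ p :: q :: r) w := by
        simpa [Slice.bottom, Gen.bottom] using hw
      obtain ⟨h1, ov', h2⟩ := hw'.adjacent ih (by
        simp [Slice.bottom, Gen.bottom] at hl ⊢; omega)
      simpa [Slice.top, Gen.top] using cross_of_cross (.layered hw') h1 h2 ov
    · have hw' : Layered (l ++ p :: (!p) :: r) w := by
        simpa [Slice.bottom, Gen.bottom] using hw
      obtain ⟨h1, -⟩ := hw'.adjacent ih (by
        simp [Slice.bottom, Gen.bottom] at hl ⊢; omega)
      simpa [Slice.top, Gen.top] using h1 rfl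

theorem append_slice {w : List Slice} (x : Slice) (hw : Reducible x.bottom w) :
    Reducible x.top (w ++ [x]) := by
  by_cases hx : x.gen.bottom = []
  · obtain ⟨l, g, r⟩ := x
    cases g with
    | cup o =>
      simpa [Slice.top, Gen.top] using append_cup o (by
        simpa [Slice.bottom, Gen.bottom] using hw)
    | cap o => simp [Gen.bottom] at hx
    | cross ov p q => simp [Gen.bottom] at hx
  · exact closedBelow _ x w hx (Nat.lt_succ_self _) hw

theorem append {s t : List Bool} {w v : List Slice} (hw : Reducible s w) (hv : IsTangle s v t) :
    Reducible t (w ++ v) := by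
  induction v generalizing s w with
  | nil =>
    obtain rfl := hv
    simpa using hw
  | cons x v ih =>
    obtain ⟨rfl, hv⟩ := hv
    simpa using ih (append_slice x hw) hv

theorem of_isTangle {t : List Bool} {w : List Slice} (hw : IsTangle [] w t) : Reducible t w :=
  append (.layered .nil) hw

end Reducible

/-- Induction over link diagrams: a property of closed diagrams that is invariant under isotopy,
compatible with the skein relation and with adding a circle, and true for the empty diagram holds
for all closed diagrams. -/
theorem skein_induction (G : List Slice → Prop) (empty : G [])
    (iso : ∀ a b, Iso [] [] a b → G a → G b)
    (skein : ∀ u v l r ov p q, IsTangle [] (u ++ [⟨l, .cross ov p q, r⟩] ++ v) [] →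
      G (u ++ [⟨l, .cross ov p q, r⟩] ++ v) → G (u ++ smoothing l r p q ++ v) →
      G (u ++ [⟨l, .cross (!ov) p q, r⟩] ++ v))
    (loop : ∀ u v l r o, IsTangle [] u (l ++ r) → IsTangle (l ++ r) v [] → G (u ++ v) →
      G (u ++ [⟨l, .cup o, r⟩, ⟨l, .cap o, r⟩] ++ v))
    {w : List Slice} (hw : IsTangle [] w []) : G w := by
  have h := Reducible.of_isTangle hw
  generalize ht : ([] : List Bool) = t at h
  induction h with
  | layered h =>
    cases h with
    | nil => exact empty
    -- Every arc adds two ends at the top, so a closed layered tangle is empty.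
    | arc o h => simp at ht
  | iso h _ ih => subst ht; exact iso _ _ h (ih h.isTangle.1)
  | skein h h0 ih ih0 =>
    subst ht
    exact skein _ _ _ _ _ _ _ h.isTangle (ih h.isTangle) (ih0 h0.isTangle)
  | loop hu h ih =>
    subst ht
    obtain ⟨s, hs, hv⟩ := isTangle_append.1 h.isTangle
    obtain rfl := hs.unique hu
    exact loop _ _ _ _ _ hu hv (ih h.isTangle)

/-! ### State models

A state model assigns to each elementary piece a linear operator, which acts on functions of the
labels of the strands at a level (from left to right) and changes only the labels at the piece. -/

section StateModel

variable {A K : Type*}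

/-- Operators on functions of the labels at a level, from the top to the bottom of a tangle. -/
abbrev Operator (A K : Type*) : Type _ := (List A → K) → List A → K

/-- Apply an operator to the right of the first `n` strands. -/
def Operator.shift : ℕ → Operator A K → Operator A K
  | 0, φ, F, c => φ F c
  | _ + 1, _, F, [] => F []
  | n + 1, φ, F, a :: c => shift n φ (fun d => F (a :: d)) c

/-- The operator of a word, for given operators of the elementary pieces. -/
def evalWord (φ : Gen → Operator A K) : List Slice → Operator A K
  | [], F => F
  | x :: w, F => (φ x.gen).shift x.left.length (evalWord φ w F)

namespace Operator

theorem shift_id (n : ℕ) (F : List A → K) (c : List A) : shift n (fun F => F) F c = F c := by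
  induction n generalizing F c with
  | zero => rfl
  | succ n ih => cases c with
    | nil => rfl
    | cons a c => exact ih _ _

theorem shift_comp (n : ℕ) (φ ψ : Operator A K) (F : List A → K) (c : List A) :
    shift n (fun F => φ (ψ F)) F c = shift n φ (shift n ψ F) c := by
  induction n generalizing F c with
  | zero => rfl
  | succ n ih => cases c with
    | nil => rfl
    | cons a c => exact ih _ _

theorem shift_shift (m n : ℕ) (φ : Operator A K) (F : List A → K) (c : List A) :
    shift m (shift n φ) F c = shift (m + n) φ F c := by
  induction m generalizing F c with
  | zero => rw [Nat.zero_add]; rfl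
  | succ m ih =>
    rw [Nat.succ_add]
    cases c with
    | nil => rfl
    | cons a c => exact ih _ _

theorem isLinearMap_shift [CommSemiring K] (n : ℕ) {φ : Operator A K} (h : IsLinearMap K φ) :
    IsLinearMap K (shift n φ) := by
  induction n with
  | zero => exact h
  | succ n ih =>
    constructor
    · intro F G
      funext c
      cases c with
      | nil => rfl
      | cons a c => exact congrFun (ih.map_add (fun d => F (a :: d)) (fun d => G (a :: d))) c
    · intro k F
      funext c
      cases c with
      | nil => rfl
      | cons a c => exact congrFun (ih.map_smul k (fun d => F (a :: d))) c

theorem shift_congr_operator {k : ℕ} {φ ψ : Operator A K}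
    (h : ∀ F c, k ≤ c.length → φ F c = ψ F c) (n : ℕ) (F : List A → K) (c : List A)
    (hc : n + k ≤ c.length) : shift n φ F c = shift n ψ F c := by
  induction n generalizing F c with
  | zero => exact h F c (by omega)
  | succ n ih => cases c with
    | nil => rfl
    | cons a c => exact ih _ _ (by simp at hc; omega)

/-- Operators have junk values on lists that are too short, so functions need only be compared on
lists of at least the right length; `j` counts the strands on the right. -/
theorem shift_congr {k k' : ℕ} {φ : Operator A K}
    (h : ∀ (j : ℕ) (F G : List A → K) (c : List A), (∀ d, k + j ≤ d.length → F d = G d) →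
      k' + j ≤ c.length → φ F c = φ G c) (n j : ℕ) (F G : List A → K) (c : List A)
    (hFG : ∀ d, n + k + j ≤ d.length → F d = G d) (hc : n + k' + j ≤ c.length) :
    shift n φ F c = shift n φ G c := by
  induction n generalizing F G c with
  | zero => exact h j F G c (by simpa using hFG) (by omega)
  | succ n ih => cases c with
    | nil => simp at hc
    | cons a c =>
      exact ih _ _ _ (fun d hd => hFG _ (by simp; omega)) (by simp at hc; omega)

end Operator

open Operator

theorem evalWord_append (φ : Gen → Operator A K) (a b : List Slice) (F : List A → K) :
    evalWord φ (a ++ b) F = evalWord φ a (evalWord φ b F) := by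
  induction a with
  | nil => rfl
  | cons x a ih => simp only [List.cons_append, evalWord, ih]

/-- Strands on the right leave no trace: pieces act at the front of a list of labels and carry the
tail along. Only strands on the left require a shift. -/
theorem evalWord_ext (φ : Gen → Operator A K) (l r : List Bool) (w : List Slice)
    (F : List A → K) : evalWord φ (ext l r w) F = shift l.length (evalWord φ w) F := by
  induction w generalizing F with
  | nil => funext c; exact (shift_id _ _ _).symm
  | cons x w ih =>
    funext c
    have h := shift_comp l.length (shift x.left.length (φ x.gen)) (evalWord φ w) F c
    rw [shift_shift] at h
    simp only [ext_cons, evalWord, ih, Slice.extend, List.length_append]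
    exact h.symm

/-- The operators of a state model are linear and change only the labels at the piece. -/
structure IsLocal [CommSemiring K] (φ : Gen → Operator A K) : Prop where
  linear : ∀ g, IsLinearMap K (φ g)
  congr : ∀ (g : Gen) (j : ℕ) (F G : List A → K) (c : List A),
    (∀ d, g.top.length + j ≤ d.length → F d = G d) → g.bottom.length + j ≤ c.length →
      φ g F c = φ g G c
  natural : ∀ (g : Gen) (n : ℕ) (ψ : Operator A K), IsLinearMap K ψ → ∀ (F : List A → K)
    (c : List A), g.bottom.length ≤ c.length →
      φ g (shift (g.top.length + n) ψ F) c = shift (g.bottom.length + n) ψ (φ g F) c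

/-- The conditions under which a state model is invariant under isotopy. -/
structure IsModel [CommSemiring K] (φ : Gen → Operator A K) : Prop extends IsLocal φ where
  move : ∀ x y s t, LocalMove x y → IsTangle s x t →
    (∀ g h m, x ≠ [⟨[], g, m ++ h.bottom⟩, ⟨g.top ++ m, h, []⟩]) →
      ∀ F c, s.length ≤ c.length → evalWord φ x F c = evalWord φ y F c

theorem IsLocal.evalWord_congr [CommSemiring K] {φ : Gen → Operator A K} (hφ : IsLocal φ)
    {s t : List Bool} {w : List Slice} (hw : IsTangle s w t)
    {F G : List A → K} (h : ∀ d, t.length ≤ d.length → F d = G d) (c : List A)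
    (hc : s.length ≤ c.length) : evalWord φ w F c = evalWord φ w G c := by
  induction w generalizing s c with
  | nil => obtain rfl := hw; exact h c hc
  | cons x w ih =>
    obtain ⟨rfl, hw⟩ := hw
    refine shift_congr (hφ.congr x.gen) x.left.length x.right.length _ _ _ (fun d hd => ?_) ?_
    · exact ih hw d (by simpa [Slice.top, add_assoc] using hd)
    · simpa [Slice.bottom, add_assoc] using hc

theorem IsLocal.evalWord_interchange [CommSemiring K] {φ : Gen → Operator A K} (hφ : IsLocal φ)
    (g h : Gen) (m : List Bool) (F : List A → K) (c : List A) (hc : g.bottom.length ≤ c.length) :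
    evalWord φ [⟨[], g, m ++ h.bottom⟩, ⟨g.top ++ m, h, []⟩] F c =
      evalWord φ [⟨g.bottom ++ m, h, []⟩, ⟨[], g, m ++ h.top⟩] F c := by
  have := hφ.natural g m.length (φ h) (hφ.linear h) F c hc
  simpa [evalWord, shift] using this

namespace IsModel

variable [CommSemiring K] {φ : Gen → Operator A K}

/-- Interchanges follow from naturality alone, which is why `IsModel.move` exempts words of their
shape. No other move starts with a word of that shape. -/
theorem evalWord_localMove (hφ : IsModel φ) {x y : List Slice} {s t : List Bool}
    (h : LocalMove x y) (hx : IsTangle s x t) (F : List A → K) (c : List A) (hc : s.length ≤ c.length) :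
    evalWord φ x F c = evalWord φ y F c := by
  by_cases hi : ∀ g h m, x ≠ [⟨[], g, m ++ h.bottom⟩, ⟨g.top ++ m, h, []⟩]
  · exact hφ.move x y s t h hx hi F c hc
  · cases h with
    | interchange g h m =>
      obtain ⟨rfl, -⟩ := hx
      exact hφ.evalWord_interchange g h m F c (by simp [Slice.bottom] at hc; omega)
    | _ => exact absurd (fun g h m he => by
        simp at he <;> cases g <;> simp_all [Gen.top, Gen.bottom]) hi

theorem evalWord_move (hφ : IsModel φ) {x y : List Slice} {s t : List Bool}
    (h : LocalMove x y) {l r : List Bool}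
    (hx : IsTangle s (ext l r x) t) (hne : x ≠ []) (F : List A → K) (c : List A)
    (hc : s.length ≤ c.length) :
    evalWord φ (ext l r x) F c = evalWord φ (ext l r y) F c := by
  cases x with
  | nil => exact absurd rfl hne
  | cons a x =>
    have hs := hx.1
    rw [Slice.bottom_extend] at hs
    subst hs
    obtain ⟨t', -, hx'⟩ := hx.of_ext
    rw [evalWord_ext, evalWord_ext]
    exact shift_congr_operator (hφ.evalWord_localMove h hx') _ F c (by
      simp at hc ⊢; omega)

end IsModel

end StateModel

theorem LocalMove.ne_nil {x y : List Slice} (h : LocalMove x y) : x ≠ [] := by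
  cases h <;> exact List.cons_ne_nil _ _

theorem IsModel.evalWord_iso {A K : Type*} [CommSemiring K] {φ : Gen → Operator A K}
    (hφ : IsModel φ) {s t : List Bool} {a b : List Slice} (h : Iso s t a b) (F : List A → K)
    (c : List A) (hc : s.length ≤ c.length) : evalWord φ a F c = evalWord φ b F c := by
  induction h generalizing F c with
  | move l r h hx hy => exact hφ.evalWord_move h (hx.ext l r) h.ne_nil F c hc
  | refl _ => rfl
  | symm _ ih => exact (ih F c hc).symm
  | trans _ _ ih ih' => exact (ih F c hc).trans (ih' F c hc)
  | comp h _ ih ih' =>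
    rw [evalWord_append, evalWord_append, ih _ c hc]
    exact hφ.evalWord_congr h.isTangle.2 (fun d hd => ih' F d hd) c hc

open Operator

/-- Transports pointwise relations between up to three operators, such as the skein relation, past
strands on the left. -/
theorem Operator.shift_rel {A K : Type*} {k : ℕ} {φ₁ φ₂ φ₃ : Operator A K}
    {R : K → K → K → Prop} (h : ∀ F c, k ≤ c.length → R (φ₁ F c) (φ₂ F c) (φ₃ F c)) (n : ℕ)
    (F : List A → K) (c : List A) (hc : n + k ≤ c.length) :
    R (shift n φ₁ F c) (shift n φ₂ F c) (shift n φ₃ F c) := by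
  induction n generalizing F c with
  | zero => exact h F c (by omega)
  | succ n ih => cases c with
    | nil => simp at hc
    | cons a c => exact ih _ _ (by simp at hc; omega)

theorem Operator.shift_append {A K : Type*} (φ : Operator A K) (F : List A → K) (b c : List A) :
    shift b.length φ F (b ++ c) = φ (fun d => F (b ++ d)) c := by
  induction b generalizing F with
  | nil => rfl
  | cons a b ih => exact ih _

theorem isLinearMap_evalWord {A K : Type*} [CommSemiring K] {φ : Gen → Operator A K}
    (hφ : IsLocal φ) (w : List Slice) : IsLinearMap K (evalWord φ w) := by
  induction w with
  | nil => exact ⟨fun _ _ => rfl, fun _ _ => rfl⟩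
  | cons x w ih =>
    have h := isLinearMap_shift x.left.length (hφ.linear x.gen)
    exact ⟨fun F G => by simp only [evalWord, ih.map_add, h.map_add],
      fun k F => by simp only [evalWord, ih.map_smul, h.map_smul]⟩

/-! ### Counting colourings -/

/-- The state model that counts the colourings of the components by two colours. -/
def colour : Gen → Operator Bool ℕ
  | .cup _, F, c => F (false :: false :: c) + F (true :: true :: c)
  | .cap _, F, x :: y :: c => if x = y then F c else 0
  | .cap _, _, _ => 0
  | .cross _ _ _, F, x :: y :: c => F (y :: x :: c)
  | .cross _ _ _, _, _ => 0

theorem exists_cons_of_succ_le_length {α : Type*} {n : ℕ} {c : List α} (h : n + 1 ≤ c.length) :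
    ∃ x d, c = x :: d ∧ n ≤ d.length := by
  cases c with
  | nil => simp at h
  | cons x d => exact ⟨x, d, rfl, by simpa using h⟩

theorem exists_cons_cons {α : Type*} {c : List α} (h : 2 ≤ c.length) :
    ∃ x y d, c = x :: y :: d := by
  obtain ⟨x, c, rfl, h1⟩ := exists_cons_of_succ_le_length h
  obtain ⟨y, c, rfl, -⟩ := exists_cons_of_succ_le_length h1
  exact ⟨x, y, c, rfl⟩

theorem exists_cons_cons_cons {α : Type*} {c : List α} (h : 3 ≤ c.length) :
    ∃ x y z d, c = x :: y :: z :: d := by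
  obtain ⟨x, c, rfl, h1⟩ := exists_cons_of_succ_le_length h
  obtain ⟨y, z, c, rfl⟩ := exists_cons_cons h1
  exact ⟨x, y, z, c, rfl⟩

theorem isLocal_colour : IsLocal colour where
  linear g := by
    constructor
    · intro F G
      funext c
      cases g with
      | cup o => simp only [colour, Pi.add_apply]; ring
      | _ =>
        rcases c with _ | ⟨x, _ | ⟨y, c⟩⟩ <;> simp only [colour, Pi.add_apply, add_zero]
        try split_ifs <;> rfl
    · intro k F
      funext c
      cases g with
      | cup o => simp only [colour, Pi.smul_apply, smul_add]
      | _ =>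
        rcases c with _ | ⟨x, _ | ⟨y, c⟩⟩ <;>
          simp only [colour, Pi.smul_apply, smul_zero]
        try split_ifs <;> simp
  congr g j F G c h hc := by
    cases g with
    | cup o =>
      simp only [colour]
      rw [h _ (by simp [Gen.top, Gen.bottom] at hc ⊢; omega),
        h _ (by simp [Gen.top, Gen.bottom] at hc ⊢; omega)]
    | _ =>
      rcases c with _ | ⟨x, _ | ⟨y, c⟩⟩ <;> simp only [colour]
      rw [h _ (by simp [Gen.top, Gen.bottom] at hc ⊢; omega)]
  natural g n ψ hψ F c hc := by
    have hL := isLinearMap_shift n hψ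
    cases g with
    | cup o =>
      have := congrFun (hL.map_add (fun d => F (false :: false :: d))
        (fun d => F (true :: true :: d))) c
      simp [Gen.top, Gen.bottom, colour, add_comm _ n, shift]
      exact this.symm
    | cap o =>
      rcases c with _ | ⟨x, _ | ⟨y, c⟩⟩
      · simp [Gen.bottom] at hc
      · simp [Gen.bottom] at hc
      · by_cases hxy : x = y
        · simp [Gen.top, Gen.bottom, colour, add_comm _ n, shift, hxy]
        · have := congrFun hL.map_zero c
          simp [Gen.bottom, colour, add_comm _ n, shift, hxy]
          exact this.symm
    | cross ov p q =>
      rcases c with _ | ⟨x, _ | ⟨y, c⟩⟩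
      · simp [Gen.bottom] at hc
      · simp [Gen.bottom] at hc
      · simp [Gen.top, Gen.bottom, colour, add_comm _ n, shift]

/-- The model ignores orientations and over/under information; all moves preserve which ends are
connected. -/
theorem isModel_colour : IsModel colour where
  toIsLocal := isLocal_colour
  move x y s t h hx hi F c hc := by
    obtain rfl | ⟨a, x', rfl⟩ : x = [] ∨ ∃ a x', x = a :: x' := by cases x <;> simp
    · exact absurd rfl h.ne_nil
    have hs := hx.1
    subst hs
    cases h with
    | interchange g h m => exact absurd rfl (hi g h m)
    | zigzag_left o =>
      obtain ⟨a, c, rfl, -⟩ := exists_cons_of_succ_le_length hc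
      cases a <;> simp [evalWord, shift, colour]
    | zigzag_right o =>
      obtain ⟨a, c, rfl, -⟩ := exists_cons_of_succ_le_length hc
      cases a <;> simp [evalWord, shift, colour]
    | slide_cap ov o x =>
      obtain ⟨a, b, e, c, rfl⟩ := exists_cons_cons_cons hc
      simp [evalWord, shift, colour]
    | slide_cup ov o x =>
      obtain ⟨a, c, rfl, hc⟩ := exists_cons_of_succ_le_length hc
      simp [evalWord, shift, colour]
    | reidemeister1_cap ov o =>
      obtain ⟨a, b, c, rfl⟩ := exists_cons_cons hc
      simp [evalWord, shift, colour, eq_comm]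
    | reidemeister1_cup ov o =>
      simp [evalWord, shift, colour]
    | reidemeister2 ov p q =>
      obtain ⟨a, b, c, rfl⟩ := exists_cons_cons hc
      simp [evalWord, shift, colour]
    | reidemeister3 ov p q x =>
      obtain ⟨a, b, e, c, rfl⟩ := exists_cons_cons_cons hc
      simp [evalWord, shift, colour]

/-- The value of a state model at the closed end of a diagram. -/
def closing (A K : Type*) [Zero K] [One K] : List A → K
  | [] => 1
  | _ :: _ => 0

/-- The number of colourings of the components of a diagram by two colours. -/
def colourings (w : List Slice) : ℕ := evalWord colour w (closing Bool ℕ) []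

theorem colourings_iso {a b : List Slice} (h : Iso [] [] a b) : colourings a = colourings b :=
  isModel_colour.evalWord_iso h _ _ le_rfl

theorem evalWord_colour_cross (u v : List Slice) (l r : List Bool) (ov ov' p q : Bool)
    (F : List Bool → ℕ) : evalWord colour (u ++ [⟨l, .cross ov p q, r⟩] ++ v) F =
      evalWord colour (u ++ [⟨l, .cross ov' p q, r⟩] ++ v) F := by
  have h : colour (.cross ov p q) = colour (.cross ov' p q) := by
    funext F c
    rcases c with _ | ⟨x, _ | ⟨y, c⟩⟩ <;> rfl
  simp only [evalWord_append, evalWord, h]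

theorem colourings_cross (u v : List Slice) (l r : List Bool) (ov ov' p q : Bool) :
    colourings (u ++ [⟨l, .cross ov p q, r⟩] ++ v) =
      colourings (u ++ [⟨l, .cross ov' p q, r⟩] ++ v) :=
  congrFun (evalWord_colour_cross u v l r ov ov' p q _) []

theorem colourings_loop {u v : List Slice} {l r : List Bool} (o : Bool)
    (hu : IsTangle [] u (l ++ r)) :
    colourings (u ++ [⟨l, .cup o, r⟩, ⟨l, .cap o, r⟩] ++ v) = 2 * colourings (u ++ v) := by
  simp only [colourings, evalWord_append]
  have h : ∀ d : List Bool, (l ++ r).length ≤ d.length →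
      evalWord colour [⟨l, .cup o, r⟩, ⟨l, .cap o, r⟩] (evalWord colour v (closing Bool ℕ)) d =
        (2 • evalWord colour v (closing Bool ℕ)) d := by
    intro d hd
    have h1 := shift_comp l.length (colour (.cup o)) (colour (.cap o))
      (evalWord colour v (closing Bool ℕ)) d
    have h2 := shift_rel (k := 0) (φ₁ := fun F => colour (.cup o) (colour (.cap o) F))
      (φ₂ := fun F => F) (φ₃ := fun F => F) (R := fun a b _ => a = 2 * b)
      (fun F c _ => by simp [colour]; ring) l.length
      (evalWord colour v (closing Bool ℕ)) d (by simp at hd ⊢; omega)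
    rw [shift_id] at h2
    simpa [evalWord] using h1.symm.trans h2
  rw [isModel_colour.evalWord_congr hu h [] le_rfl,
    (isLinearMap_evalWord isLocal_colour u).map_smul]
  simp

/-- Needed for the logarithm of the count to behave well under doubling. -/
theorem colourings_pos {w : List Slice} (hw : IsTangle [] w []) : 0 < colourings w := by
  refine skein_induction (fun w => 0 < colourings w) Nat.one_pos ?_ ?_ ?_ hw
  · intro a b h ha
    rwa [← colourings_iso h]
  · intro u v l r ov p q _ h _
    rwa [colourings_cross u v l r _ ov]
  · intro u v l r o hu _ h
    rw [colourings_loop o hu]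
    omega

/-- A relation between three functions of colours, which expresses that their supports are cosets
of a group of colourings, on which they are constant. -/
def Coset (n : ℕ) (F₁ F₂ F₃ : List Bool → ℕ) : Prop :=
  ∀ d c, d.length = n → c.length = n → F₁ d ≠ 0 → F₂ c = F₃ (List.zipWith xor c d)

theorem Coset.shift {k k' : ℕ} {φ₁ φ₂ φ₃ : Operator Bool ℕ}
    (h : ∀ j F₁ F₂ F₃, Coset (k + j) F₁ F₂ F₃ → Coset (k' + j) (φ₁ F₁) (φ₂ F₂) (φ₃ F₃))
    (n j : ℕ) {F₁ F₂ F₃ : List Bool → ℕ} (hF : Coset (n + k + j) F₁ F₂ F₃) :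
    Coset (n + k' + j) (shift n φ₁ F₁) (shift n φ₂ F₂) (shift n φ₃ F₃) := by
  induction n generalizing F₁ F₂ F₃ with
  | zero =>
    rw [Nat.zero_add] at hF ⊢
    exact h j F₁ F₂ F₃ hF
  | succ n ih =>
    intro d c hd hc hne
    obtain ⟨e, d, rfl, -⟩ := exists_cons_of_succ_le_length (n := n) (c := d) (by omega)
    obtain ⟨a, c, rfl, -⟩ := exists_cons_of_succ_le_length (n := n) (c := c) (by omega)
    -- Freezing the first labels `e` and `a` leaves functions of the tails, where the third one must
    -- have the head `a xor e`.
    refine ih (F₁ := fun t => F₁ (e :: t)) (F₂ := fun t => F₂ (a :: t))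
      (F₃ := fun t => F₃ ((a ^^ e) :: t)) (fun d' c' hd' hc' hne' => ?_) d c
      (by simp at hd; omega) (by simp at hc; omega) hne
    exact hF (e :: d') (a :: c') (by simp; omega) (by simp; omega) hne'

theorem Coset.colour {g : Gen} (j : ℕ) (F₁ F₂ F₃ : List Bool → ℕ)
    (h : Coset (g.top.length + j) F₁ F₂ F₃) :
    Coset (g.bottom.length + j) (colour g F₁) (colour g F₂) (colour g F₃) := by
  intro d c hd hc hne
  cases g with
  | cup o =>
    simp only [LinkDiagrams.colour] at hne ⊢
    simp [Gen.bottom] at hd hc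
    have h1 : F₁ (false :: false :: d) ≠ 0 ∨ F₁ (true :: true :: d) ≠ 0 := by omega
    have key : ∀ x y : Bool, F₁ (x :: x :: d) ≠ 0 →
        F₂ (y :: y :: c) = F₃ ((y ^^ x) :: (y ^^ x) :: List.zipWith xor c d) := fun x y hx =>
      h (x :: x :: d) (y :: y :: c) (by simp [Gen.top]; omega) (by simp [Gen.top]; omega) hx
    -- A single extension of `d` with nonzero value suffices. Translation by its new colour matches
    -- the two summands for `F₂` with those for `F₃`, in the opposite order if that colour is
    -- `true`.
    rcases h1 with h1 | h1
    · rw [key _ _ h1, key _ _ h1]; rfl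
    · rw [key _ _ h1, key _ _ h1, add_comm]; rfl
  | cap o =>
    obtain ⟨d1, d2, d, rfl⟩ := exists_cons_cons (c := d) (by simp [Gen.bottom] at hd; omega)
    obtain ⟨c1, c2, c, rfl⟩ := exists_cons_cons (c := c) (by simp [Gen.bottom] at hc; omega)
    simp [LinkDiagrams.colour, Gen.bottom] at hne hd hc ⊢
    obtain ⟨rfl, hne⟩ := hne
    have := h d c (by simp [Gen.top]; omega) (by simp [Gen.top]; omega) hne
    rw [this]
    cases d1 <;> cases c1 <;> cases c2 <;> rfl
  | cross ov p q =>
    obtain ⟨d1, d2, d, rfl⟩ := exists_cons_cons (c := d) (by simp [Gen.bottom] at hd; omega)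
    obtain ⟨c1, c2, c, rfl⟩ := exists_cons_cons (c := c) (by simp [Gen.bottom] at hc; omega)
    simp [LinkDiagrams.colour, Gen.bottom] at hne hd hc ⊢
    exact h (d2 :: d1 :: d) (c2 :: c1 :: c) (by simp [Gen.top]; omega)
      (by simp [Gen.top]; omega) hne

theorem Coset.evalWord {s t : List Bool} {w : List Slice} (hw : IsTangle s w t)
    {F₁ F₂ F₃ : List Bool → ℕ} (h : Coset t.length F₁ F₂ F₃) :
    Coset s.length (evalWord LinkDiagrams.colour w F₁) (evalWord LinkDiagrams.colour w F₂)
      (evalWord LinkDiagrams.colour w F₃) := by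
  induction w generalizing s with
  | nil => obtain rfl := hw; exact h
  | cons x w ih =>
    obtain ⟨rfl, hw⟩ := hw
    have := Coset.shift (Coset.colour (g := x.gen)) x.left.length x.right.length
      (by simpa [Slice.top, add_assoc] using ih hw)
    simpa [Slice.bottom, LinkDiagrams.evalWord, add_assoc] using this

theorem coset_closing : Coset 0 (closing Bool ℕ) (closing Bool ℕ) (closing Bool ℕ) := by
  intro d c hd hc _
  obtain rfl := List.eq_nil_of_length_eq_zero hd
  obtain rfl := List.eq_nil_of_length_eq_zero hc
  rfl

/-- Restrict to equal colours of the first two strands. -/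
def equalColours : Operator Bool ℕ
  | F, x :: y :: c => if x = y then F (x :: y :: c) else 0
  | _, _ => 0

/-- The other colourings of the smoothing of a crossing, for strands with equal or opposite
orientations. -/
def otherColours : Bool → Operator Bool ℕ
  | true, F, x :: y :: c => if x = y then 0 else F (x :: y :: c)
  | false, F, x :: y :: c => if x = y then F ((!x) :: (!y) :: c) else 0
  | _, _, _ => 0

/-- The sum of two colourings that differ across the smoothed place agrees across it, because there
are only two colours. So the other colourings form a translate of the equal ones, unless there are
none. -/
theorem coset_otherColours (e : Bool) (j : ℕ) (F₁ F₂ F₃ : List Bool → ℕ)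
    (h : Coset (2 + j) F₁ F₂ F₃) :
    Coset (2 + j) (otherColours e F₁) (otherColours e F₂) (equalColours F₃) := by
  intro d c hd hc hne
  obtain ⟨d1, d2, d, rfl⟩ := exists_cons_cons (c := d) (by omega)
  obtain ⟨c1, c2, c, rfl⟩ := exists_cons_cons (c := c) (by omega)
  cases e with
  | true =>
    have h1 := h (d1 :: d2 :: d) (c1 :: c2 :: c) hd hc
    revert hne h1
    cases c1 <;> cases c2 <;> cases d1 <;> cases d2 <;> simp [otherColours, equalColours] <;> tauto
  | false =>
    have h1 := h ((!d1) :: (!d2) :: d) ((!c1) :: (!c2) :: c) (by simpa using hd) (by simpa using hc)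
    revert hne h1
    cases c1 <;> cases c2 <;> cases d1 <;> cases d2 <;> simp [otherColours, equalColours] <;> tauto

theorem evalWord_smoothing (l r : List Bool) (p q : Bool) (F : List Bool → ℕ) (c : List Bool)
    (hc : l.length + 2 ≤ c.length) :
    evalWord colour (smoothing l r p q) F c =
      shift l.length equalColours F c + shift l.length (otherColours (p == q)) F c := by
  by_cases hpq : p = q
  · have h := shift_rel (k := 2) (φ₁ := fun F => F) (φ₂ := equalColours)
      (φ₃ := otherColours true) (R := fun a b c => a = b + c) (fun F c hc => by
        obtain ⟨c1, c2, c, rfl⟩ := exists_cons_cons hc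
        by_cases h : c1 = c2 <;> simp [equalColours, otherColours, h]) l.length F c hc
    rw [shift_id] at h
    simpa [smoothing, hpq, evalWord] using h
  · have h := shift_rel (k := 2) (φ₁ := fun F => colour (.cap p) (colour (.cup q) F))
      (φ₂ := equalColours) (φ₃ := otherColours false) (R := fun a b c => a = b + c)
      (fun F c hc => by
        obtain ⟨c1, c2, c, rfl⟩ := exists_cons_cons hc
        cases c1 <;> cases c2 <;> simp [equalColours, otherColours, colour, add_comm])
      l.length F c hc
    rw [shift_comp] at h
    have hpq' : (p == q) = false := by simpa using hpq
    simpa [smoothing, hpq, hpq', evalWord] using h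

theorem smoothing_isTangle (l r : List Bool) (p q : Bool) :
    IsTangle (l ++ [p, q] ++ r) (smoothing l r p q) (l ++ [q, p] ++ r) := by
  cases p <;> cases q <;>
    simp [smoothing, isTangle_nil, isTangle_cons, Slice.bottom, Slice.top, Gen.bottom, Gen.top]

/-- Smoothing a crossing increases the number of components by at most one. -/
theorem colourings_smoothing {u v : List Slice} {l r : List Bool} {ov p q : Bool}
    (h : IsTangle [] (u ++ [⟨l, .cross ov p q, r⟩] ++ v) []) :
    colourings (u ++ smoothing l r p q ++ v) ≤
      2 * colourings (u ++ [⟨l, .cross ov p q, r⟩] ++ v) := by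
  obtain ⟨t, h1, hv⟩ := isTangle_append.1 h
  obtain ⟨s, hu, hs, ht⟩ := isTangle_append.1 h1
  subst hs ht
  simp only [colourings, evalWord_append]
  set F := evalWord colour v (closing Bool ℕ) with hF
  set E := shift l.length equalColours F with hE
  set O := shift l.length (otherColours (p == q)) F with hO
  set X := evalWord colour [⟨l, .cross ov p q, r⟩] F with hX
  have hlin := isLinearMap_evalWord isLocal_colour u
  have h1 : evalWord colour u (evalWord colour (smoothing l r p q) F) [] =
      evalWord colour u E [] + evalWord colour u O [] := by
    rw [isModel_colour.evalWord_congr hu (G := E + O) (fun d hd => evalWord_smoothing _ _ _ _ _ _ (by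
      simp [Slice.bottom, Gen.bottom] at hd; omega)) [] le_rfl, hlin.map_add]
    rfl
  -- A colouring with the same colour at all four ends also colours the crossing. Monotonicity over
  -- `ℕ` is obtained from linearity by writing `X = E + (X - E)`.
  have h2 : evalWord colour u E [] ≤ evalWord colour u X [] := by
    have : ∀ d : List Bool, (Slice.bottom ⟨l, .cross ov p q, r⟩).length ≤ d.length →
        X d = (E + (X - E)) d := by
      intro d hd
      refine (Nat.add_sub_cancel' ?_).symm
      refine shift_rel (k := 2) (R := fun a b _ => a ≤ b) (φ₁ := equalColours)
        (φ₂ := colour (.cross ov p q)) (φ₃ := equalColours) (fun F c hc => ?_) l.length F d (by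
          simp [Slice.bottom, Gen.bottom] at hd; omega)
      obtain ⟨c1, c2, c, rfl⟩ := exists_cons_cons hc
      cases c1 <;> cases c2 <;> simp [equalColours, colour]
    rw [isModel_colour.evalWord_congr hu this [] le_rfl, hlin.map_add]
    exact Nat.le_add_right _ _
  -- If there is any other colouring, the coset relation at the empty boundary gives equality of the
  -- two counts.
  have h3 : evalWord colour u O [] ≤ evalWord colour u E [] := by
    have hc := Coset.evalWord hv coset_closing
    have hc' := Coset.shift (coset_otherColours (p == q)) l.length r.length
      (by simpa [Slice.top, Gen.top, add_assoc, add_comm 2] using hc)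
    have hc'' := Coset.evalWord (t := Slice.bottom ⟨l, .cross ov p q, r⟩) hu
      (by simpa [Slice.bottom, Gen.bottom, add_assoc, add_comm 2] using hc')
    by_cases hne : evalWord colour u O [] = 0
    · omega
    · exact (hc'' [] [] rfl rfl hne).le
  omega

/-! ### Colourings of knots -/

/-- The colourings of the points of a word by two colours, for given colours of the strands at
the bottom. -/
def pointColourings (w : List Slice) (c : List Bool) : Set (ℕ × ℕ → Bool) :=
  {f | (∀ x y, Joined w x y → f x = f y) ∧ (∀ i, f (0, i) = c.getD i false) ∧
    ∀ x, f x = true → ∃ s, w[x.1]? = some s ∧ x.2 < s.bottom.length}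

/-- Add a level at the bottom of a colouring. -/
def consLevel (c : List Bool) (f : ℕ × ℕ → Bool) : ℕ × ℕ → Bool
  | (0, i) => c.getD i false
  | (j + 1, i) => f (j, i)

theorem consLevel_injective (c : List Bool) : Function.Injective (consLevel c) := by
  intro f g h
  funext ⟨j, i⟩
  exact congrFun h (j + 1, i)

/-- The colours at the bottom and at the top of an elementary piece fit together. -/
def Gen.Fits : Gen → List Bool → List Bool → Prop
  | .cup _, b, t => ∃ a, b = [] ∧ t = [a, a]
  | .cap _, b, t => ∃ a, b = [a, a] ∧ t = []
  | .cross _ _ _, b, t => ∃ a e, b = [a, e] ∧ t = [e, a]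

theorem Gen.Fits.length {g : Gen} {b t : List Bool} (h : g.Fits b t) :
    b.length = g.bottom.length ∧ t.length = g.top.length := by
  cases g with
  | cup o => obtain ⟨a, rfl, rfl⟩ := h; exact ⟨rfl, rfl⟩
  | cap o => obtain ⟨a, rfl, rfl⟩ := h; exact ⟨rfl, rfl⟩
  | cross ov p q => obtain ⟨a, e, rfl, rfl⟩ := h; exact ⟨rfl, rfl⟩

theorem getD_append_append {c₁ b c₂ : List Bool} {m n : ℕ} (hm : c₁.length = m)
    (hn : b.length = n) (i : ℕ) :
    (c₁ ++ b ++ c₂).getD (m + n + i) false = c₂.getD i false := by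
  subst hm hn
  rw [List.getD_append_right _ _ _ _ (by simp)]
  simp

/-- Colourings extend downwards through one slice; this matches the recursion of `evalWord` with
honest colourings of points. -/
theorem consLevel_mem {l r : List Bool} {g : Gen} {w : List Slice} {c₁ b t c₂ : List Bool}
    {f : ℕ × ℕ → Bool} (hl : c₁.length = l.length) (hr : c₂.length = r.length)
    (hg : g.Fits b t) (hf : f ∈ pointColourings w (c₁ ++ t ++ c₂)) :
    consLevel (c₁ ++ b ++ c₂) f ∈ pointColourings (⟨l, g, r⟩ :: w) (c₁ ++ b ++ c₂) := by
  obtain ⟨hJ, h0, hs⟩ := hf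
  obtain ⟨hb, ht⟩ := hg.length
  refine ⟨fun x y h => ?_, fun _ => rfl, ?_⟩
  · cases h with
    | left j i s hs hi =>
      cases j with
      | zero =>
        obtain rfl : _ = s := by simpa using hs
        simp only [consLevel, h0, List.append_assoc]
        rw [List.getD_append _ _ _ _ (by simpa [hl] using hi),
          List.getD_append _ _ _ _ (by simpa [hl] using hi)]
      | succ j => exact hJ _ _ (.left j i s (by simpa using hs) hi)
    | right j i s hs hi =>
      cases j with
      | zero =>
        obtain rfl : _ = s := by simpa using hs
        simp only [consLevel, h0]
        rw [getD_append_append hl hb, getD_append_append hl ht]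
      | succ j => exact hJ _ _ (.right j i s (by simpa using hs) hi)
    | cup j l r o hs =>
      cases j with
      | zero =>
        simp at hs
        obtain ⟨rfl, rfl, rfl⟩ := hs
        obtain ⟨a, rfl, rfl⟩ := hg
        simp [consLevel, h0, ← hl]
      | succ j => exact hJ _ _ (.cup j l r o (by simpa using hs))
    | cap j l r o hs =>
      cases j with
      | zero =>
        simp at hs
        obtain ⟨rfl, rfl, rfl⟩ := hs
        obtain ⟨a, rfl, rfl⟩ := hg
        simp [consLevel, ← hl]
      | succ j => exact hJ _ _ (.cap j l r o (by simpa using hs))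
    | cross_up j l r ov p q hs =>
      cases j with
      | zero =>
        simp at hs
        obtain ⟨rfl, rfl, rfl⟩ := hs
        obtain ⟨a, e, rfl, rfl⟩ := hg
        simp [consLevel, h0, ← hl]
      | succ j => exact hJ _ _ (.cross_up j l r ov p q (by simpa using hs))
    | cross_down j l r ov p q hs =>
      cases j with
      | zero =>
        simp at hs
        obtain ⟨rfl, rfl, rfl⟩ := hs
        obtain ⟨a, e, rfl, rfl⟩ := hg
        simp [consLevel, h0, ← hl]
      | succ j => exact hJ _ _ (.cross_down j l r ov p q (by simpa using hs))
  · rintro ⟨j, i⟩ hx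
    cases j with
    | zero =>
      refine ⟨⟨l, g, r⟩, rfl, ?_⟩
      by_contra hi
      simp only [Slice.bottom, List.length_append, not_lt] at hi
      simp only [consLevel] at hx
      rw [List.getD_eq_default _ _ (by simp; omega)] at hx
      exact absurd hx (by simp)
    | succ j => simpa using hs (j, i) hx

/-- Only this inequality is needed: each term of the state sum contributes distinct colourings of
the points, and a bound on the latter bounds the state sum. -/
theorem evalWord_le_encard {s : List Bool} {w : List Slice} (hw : IsTangle s w [])
    (c : List Bool) (hc : c.length = s.length) :
    ((evalWord colour w (closing Bool ℕ) c : ℕ) : ℕ∞) ≤ (pointColourings w c).encard := by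
  induction w generalizing s c with
  | nil =>
    obtain rfl := hw
    obtain rfl := List.eq_nil_of_length_eq_zero hc
    have : (fun _ => false) ∈ pointColourings [] [] := ⟨fun _ _ _ => rfl, by simp, by simp⟩
    simpa [evalWord, closing] using ⟨_, this⟩
  | cons x w ih =>
    obtain ⟨rfl, hw⟩ := hw
    obtain ⟨l, g, r⟩ := x
    simp only [Slice.bottom, List.length_append] at hc
    obtain ⟨c₁, c, rfl, hl⟩ : ∃ c₁ c', c = c₁ ++ c' ∧ c₁.length = l.length :=
      ⟨c.take l.length, c.drop l.length, by simp, by simp; omega⟩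
    have hsub : ∀ b t c₂, c = b ++ c₂ → g.Fits b t → c₂.length = r.length →
        consLevel (c₁ ++ b ++ c₂) '' pointColourings w (c₁ ++ t ++ c₂) ⊆
          pointColourings (⟨l, g, r⟩ :: w) (c₁ ++ c) := by
      rintro b t c₂ rfl hg hr _ ⟨f, hf, rfl⟩
      simpa using consLevel_mem hl hr hg hf
    have hle : ∀ t c₂, t.length = g.top.length → c₂.length = r.length →
        ((evalWord colour w (closing Bool ℕ) (c₁ ++ (t ++ c₂)) : ℕ) : ℕ∞) ≤
          (pointColourings w (c₁ ++ (t ++ c₂))).encard := fun t c₂ ht hr =>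
      ih hw _ (by simp [Slice.top, hl, ht, hr])
    simp only [evalWord, ← hl, Operator.shift_append]
    cases g with
    | cup o =>
      simp [Gen.bottom, hl] at hc
      have h1 := Set.encard_le_encard (Set.union_subset (hsub [] [false, false] c rfl ⟨_, rfl, rfl⟩ hc)
        (hsub [] [true, true] c rfl ⟨_, rfl, rfl⟩ hc))
      rw [Set.encard_union_eq, (consLevel_injective _).encard_image,
        (consLevel_injective _).encard_image] at h1
      · refine le_trans ?_ h1
        simp only [colour, Nat.cast_add]
        exact add_le_add (by simpa using hle [false, false] c rfl hc)
          (by simpa using hle [true, true] c rfl hc)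
      -- The two families are distinguished by the colour at the left end of the minimum.
      · rw [Set.disjoint_left]
        rintro _ ⟨f, hf, rfl⟩ ⟨f', hf', h⟩
        obtain rfl := consLevel_injective _ h
        have e1 := hf.2.1 c₁.length
        have e2 := hf'.2.1 c₁.length
        simp at e1 e2
        simp [e1] at e2
    | cap o =>
      simp [Gen.bottom, hl] at hc
      obtain ⟨x, y, c, rfl⟩ := exists_cons_cons (c := c) (by omega)
      by_cases hxy : x = y
      · subst hxy
        have hr : c.length = r.length := by simp at hc; omega
        have h1 := Set.encard_le_encard (hsub [x, x] [] c rfl ⟨_, rfl, rfl⟩ hr)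
        rw [(consLevel_injective _).encard_image] at h1
        refine le_trans ?_ h1
        simpa [colour] using hle [] c rfl hr
      · simp [colour, hxy]
    | cross ov p q =>
      simp [Gen.bottom, hl] at hc
      obtain ⟨x, y, c, rfl⟩ := exists_cons_cons (c := c) (by omega)
      have hr : c.length = r.length := by simp at hc; omega
      have h1 := Set.encard_le_encard (hsub [x, y] [y, x] c rfl ⟨_, _, rfl, rfl⟩ hr)
      rw [(consLevel_injective _).encard_image] at h1
      refine le_trans ?_ h1
      simpa [colour] using hle [y, x] c rfl hr

/-- A colouring is constant on components and `false` off the diagram, so it is zero or the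
indicator function of the diagram. -/
theorem colourings_le_two {D : Diagram} (hD : Nat.card D.Component = 1) :
    colourings D.word ≤ 2 := by
  have h := evalWord_le_encard D.closed [] rfl
  obtain ⟨hsub, -⟩ := Nat.card_eq_one_iff_unique.1 hD
  classical
  have h2 : pointColourings D.word [] ⊆ {fun _ => false,
      fun x => decide (∃ s, D.word[x.1]? = some s ∧ x.2 < s.bottom.length)} := by
    rintro f ⟨hJ, -, hs⟩
    by_cases hf : ∃ x, f x = true
    · right
      obtain ⟨x, hx⟩ := hf
      rw [Set.mem_singleton_iff]
      funext y
      by_cases hy : ∃ s, D.word[y.1]? = some s ∧ y.2 < s.bottom.length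
      · let F : D.Component → Bool := Quot.lift (fun x : D.Point => f x.1) fun _ _ h => hJ _ _ h
        let a : D.Component := Quot.mk _ ⟨x, hs x hx⟩
        let b : D.Component := Quot.mk _ ⟨y, hy⟩
        have : f x = f y := congrArg F (Subsingleton.elim a b)
        simpa [hy, hx] using this.symm
      · simpa [hy] using mt (hs y) hy
    · left
      funext y
      simpa using fun h => hf ⟨y, h⟩
  have h3 := (h.trans (Set.encard_le_encard h2)).trans (Set.encard_insert_le _ _)
  rw [Set.encard_singleton] at h3
  exact_mod_cast h3

theorem colourings_move {D E : Diagram} (h : D.Move E) :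
    colourings D.word = colourings E.word := by
  obtain ⟨u, v, x, y, l, r, hxy, hD, hE⟩ := h
  have hc := D.closed
  rw [hD, List.append_assoc] at hc
  obtain ⟨s, hu, hc⟩ := isTangle_append.1 hc
  obtain ⟨t, hx, hv⟩ := isTangle_append.1 hc
  rw [hD, hE]
  simp only [colourings, evalWord_append]
  exact isModel_colour.evalWord_congr hu
    (fun d hd => isModel_colour.evalWord_move hxy hx hxy.ne_nil _ d hd) [] le_rfl

theorem colourings_eq_of_link_eq {D E : Diagram} (h : D.link = E.link) :
    colourings D.word = colourings E.word := by
  have h' := Quot.eqvGen_exact h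
  clear h
  induction h' with
  | rel _ _ h => exact colourings_move h
  | refl _ => rfl
  | symm _ _ _ ih => exact ih.symm
  | trans _ _ _ _ _ ih ih' => exact ih.trans ih'

/-- Being a knot concerns some diagram of the link. Invariance of the count carries the bound to the
diagram in which the twist is inserted. -/
theorem colourings_le_two_of_isKnot {D : Diagram} (h : D.link.IsKnot) :
    colourings D.word ≤ 2 := by
  obtain ⟨E, hE, hcard⟩ := h
  rw [← colourings_eq_of_link_eq hE]
  exact colourings_le_two hcard

/-! ### Values of a HOMFLY invariant on words -/

/-- Guarantees that a local move never empties a closed diagram: if the result is empty, the move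
took place on strands and something lies below it. -/
theorem LocalMove.ne_nil_or {x y : List Slice} {s t : List Bool} (h : LocalMove x y)
    (hx : IsTangle s x t) : y ≠ [] ∨ s ≠ [] := by
  cases h <;> first
    | exact .inl (List.cons_ne_nil _ _)
    | (right; rw [hx.1]; simp [Slice.bottom, Gen.bottom])

theorem IsTangle.ne_nil {u v : List Slice} {x : Slice} {t : List Bool}
    (h : IsTangle [] (u ++ [x] ++ v) t) (hx : x.bottom ≠ []) : u ≠ [] := by
  rintro rfl
  exact hx h.1.symm

theorem IsTangle.of_append_singleton {u v : List Slice} {x : Slice} {t : List Bool}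
    (h : IsTangle [] (u ++ [x] ++ v) t) : IsTangle [] u x.bottom ∧ IsTangle x.top v t := by
  obtain ⟨s, hu, hv⟩ := isTangle_append.1 h
  obtain ⟨s', hu', rfl, rfl⟩ := isTangle_append.1 hu
  exact ⟨hu', hv⟩

section Value

variable (P : OrientedLink → HomflyRing)

open Classical in
/-- The value of a link invariant on a word, which is zero if the word is not a link diagram. -/
noncomputable def value (w : List Slice) : HomflyRing :=
  if h : w ≠ [] ∧ IsTangle [] w [] then P (Diagram.mk w h.1 h.2).link else 0

theorem value_word (D : Diagram) : value P D.word = P D.link :=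
  dif_pos ⟨D.nonempty, D.closed⟩

theorem value_iso_append {s t : List Bool} {a b : List Slice} (h : Iso s t a b)
    {u v : List Slice} (hu : IsTangle [] u s) (hv : IsTangle t v []) :
    value P (u ++ a ++ v) = value P (u ++ b ++ v) := by
  induction h generalizing u v with
  | @move x y s t l r h hx hy =>
    have h1 : u ++ ext l r x ++ v ≠ [] := by simp [ext, h.ne_nil]
    have h2 : u ++ ext l r y ++ v ≠ [] := by
      rcases h.ne_nil_or hx with hy | hs
      · simp [ext, hy]
      · have : u ≠ [] := by
          rintro rfl
          have := isTangle_nil.1 hu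
          simp [hs] at this
        simp [this]
    have h3 := (hu.append (hx.ext l r)).append hv
    have h4 := (hu.append (hy.ext l r)).append hv
    rw [value, value, dif_pos ⟨h1, h3⟩, dif_pos ⟨h2, h4⟩]
    exact congrArg P (Quot.sound ⟨u, v, x, y, l, r, h, rfl, rfl⟩)
  | refl _ => rfl
  | symm _ ih => exact (ih hu hv).symm
  | trans _ _ ih ih' => exact (ih hu hv).trans (ih' hu hv)
  | @comp s t t' a b c d h h' ih ih' =>
    have h1 := ih hu (h'.isTangle.1.append hv)
    have h2 := ih' (hu.append h.isTangle.2) hv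
    simp only [List.append_assoc] at h1 h2 ⊢
    exact h1.trans h2

theorem value_iso {a b : List Slice} (h : Iso [] [] a b) : value P a = value P b := by
  simpa using value_iso_append P h (u := []) (v := []) rfl rfl

variable {P}

theorem value_skein (hP : IsHomfly P) {u v : List Slice} {l r : List Bool} {p q ov : Bool}
    (h : IsTangle [] (u ++ [⟨l, .cross ov p q, r⟩] ++ v) []) :
    (↑varA⁻¹ : HomflyRing) * value P (u ++ [⟨l, .cross (positiveOver p q) p q, r⟩] ++ v) -
      (↑varA : HomflyRing) * value P (u ++ [⟨l, .cross (!positiveOver p q) p q, r⟩] ++ v) =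
        varZ * value P (u ++ smoothing l r p q ++ v) := by
  have hu := h.ne_nil (by simp [Slice.bottom, Gen.bottom])
  obtain ⟨hu', hv'⟩ := h.of_append_singleton
  have hc : ∀ ov, IsTangle [] (u ++ [⟨l, .cross ov p q, r⟩] ++ v) [] := fun ov' =>
    (hu'.append (show IsTangle _ [⟨l, .cross ov' p q, r⟩] _ from ⟨rfl, rfl⟩)).append hv'
  have h0 := (hu'.append (smoothing_isTangle l r p q)).append hv'
  exact (value_word P ⟨_, by simp, hc (positiveOver p q)⟩) ▸
    (value_word P ⟨_, by simp, hc (!positiveOver p q)⟩) ▸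
    (value_word P ⟨_, by simp [hu], h0⟩) ▸ hP.2 _ _ _ ⟨u, v, l, r, p, q, rfl, rfl, rfl⟩

/-- Meant for a kink: either crossing can be undone, so both values agree, while the smoothing
splits off a circle. -/
theorem value_smoothing (hP : IsHomfly P) {u v : List Slice} {l r : List Bool} {p q : Bool}
    {c : HomflyRing} (h : IsTangle [] (u ++ [⟨l, .cross true p q, r⟩] ++ v) [])
    (hc : ∀ ov, value P (u ++ [⟨l, .cross ov p q, r⟩] ++ v) = c) :
    varZ * value P (u ++ smoothing l r p q ++ v) =
      ((↑varA⁻¹ : HomflyRing) - (↑varA : HomflyRing)) * c := by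
  rw [← value_skein hP h, hc, hc, sub_mul]

end Value

/-! ### Reversing circles and removing kinks. -/

namespace Iso

/-- The orientation of a circle may be reversed. -/
theorem loop_reverse (o : Bool) (l r : List Bool) :
    Iso (l ++ r) (l ++ r) [⟨l, .cup o, r⟩, ⟨l, .cap o, r⟩]
      [⟨l, .cup (!o), r⟩, ⟨l, .cap (!o), r⟩] := by
  have h0 := loop_isTangle l r o
  have h1 := step h0 (reidemeister1_cap true o l r).symm (by simp) [⟨l, .cup o, r⟩] []
    (by simp) rfl
  have h2 := step h1.isTangle.2 (reidemeister1_cup true o l r) (by simp) []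
    [⟨l, .cap (!o), r⟩] (by simp) rfl
  simpa using h1.trans h2

/-- A kink on the right of a strand can be removed. -/
theorem kink_right (ov x : Bool) (l r : List Bool) :
    Iso (l ++ x :: r) (l ++ x :: r) [⟨l ++ [x], .cup x, r⟩, ⟨l, .cross ov x x, (!x) :: r⟩,
      ⟨l ++ [x], .cap x, r⟩] [] := by
  have h0 : IsTangle (l ++ x :: r) [⟨l ++ [x], .cup x, r⟩, ⟨l, .cross ov x x, (!x) :: r⟩,
      ⟨l ++ [x], .cap x, r⟩] (l ++ x :: r) :=
    ⟨by simp [Slice.bottom, Gen.bottom], by simp [Slice.bottom, Slice.top, Gen.bottom, Gen.top],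
      by simp [Slice.bottom, Slice.top, Gen.bottom, Gen.top],
      by simp [isTangle_nil, Slice.top, Gen.top]⟩
  have h1 := step h0 (by simpa using (slide_cup (!ov) x x l r).symm) (by simp) []
    [⟨l ++ [x], .cap x, r⟩] (by simp) rfl
  have h2 := step h1.isTangle.2 (by simpa using reidemeister1_cap (!ov) (!x) (l ++ [x]) r)
    (by simp) [⟨l, .cup x, x :: r⟩] [] (by simp) rfl
  have h3 := step h2.isTangle.2 (zigzag_left x l r) (by simp) [] [] (by simp) rfl
  exact (h1.trans h2).trans h3

/-- A kink on the left of a strand can be removed. -/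
theorem kink_left (ov x : Bool) (l r : List Bool) :
    Iso (l ++ x :: r) (l ++ x :: r) [⟨l, .cup (!x), x :: r⟩, ⟨l ++ [!x], .cross ov x x, r⟩,
      ⟨l, .cap (!x), x :: r⟩] [] := by
  have h0 : IsTangle (l ++ x :: r) [⟨l, .cup (!x), x :: r⟩, ⟨l ++ [!x], .cross ov x x, r⟩,
      ⟨l, .cap (!x), x :: r⟩] (l ++ x :: r) :=
    ⟨by simp [Slice.bottom, Gen.bottom], by simp [Slice.bottom, Slice.top, Gen.bottom, Gen.top],
      by simp [Slice.bottom, Slice.top, Gen.bottom, Gen.top],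
      by simp [isTangle_nil, Slice.top, Gen.top]⟩
  have h1 := step h0 (by simpa using slide_cup ov (!x) x l r) (by simp) []
    [⟨l, .cap (!x), x :: r⟩] (by simp) rfl
  have h2 := step h1.isTangle.2 (by simpa using reidemeister1_cap (!ov) x l (x :: r))
    (by simp) [⟨l ++ [x], .cup (!x), r⟩] [] (by simp) rfl
  have h3 := step h2.isTangle.2 (zigzag_right x l r) (by simp) [] [] (by simp) rfl
  exact (h1.trans h2).trans h3

end Iso

theorem Slice.eq_cap_of_top {x : Slice} (h : x.top = []) : ∃ p, x = ⟨[], .cap p, []⟩ := by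
  obtain ⟨l, g, r⟩ := x
  cases g <;> simp [Slice.top, Gen.top] at h ⊢
  exact h

theorem Slice.eq_cup_of_bottom {x : Slice} (h : x.bottom = []) : ∃ p, x = ⟨[], .cup p, []⟩ := by
  obtain ⟨l, g, r⟩ := x
  cases g <;> simp [Slice.bottom, Gen.bottom] at h ⊢
  exact h

/-! ### The value of a diagram with a split circle. -/

section Value

variable {P : OrientedLink → HomflyRing}

theorem value_loop_orientation {u v : List Slice} {l r : List Bool} (o o' : Bool)
    (hu : IsTangle [] u (l ++ r)) (hv : IsTangle (l ++ r) v []) :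
    value P (u ++ [⟨l, .cup o, r⟩, ⟨l, .cap o, r⟩] ++ v) =
      value P (u ++ [⟨l, .cup o', r⟩, ⟨l, .cap o', r⟩] ++ v) := by
  by_cases h : o = o'
  · rw [h]
  · obtain rfl : o' = !o := by cases o <;> cases o' <;> simp_all
    exact value_iso_append P (Iso.loop_reverse o l r) hu hv

/-- The circle is the smoothing of a kink in a neighbouring arc, and kinks of both signs are
trivial. The orientation of the circle is adjusted to that of the arc. -/
theorem value_loop (hP : IsHomfly P) {u v : List Slice} {l r : List Bool} (o : Bool)
    (hu : IsTangle [] u (l ++ r)) (hv : IsTangle (l ++ r) v []) (hne : u ++ v ≠ []) :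
    varZ * value P (u ++ [⟨l, .cup o, r⟩, ⟨l, .cap o, r⟩] ++ v) =
      ((↑varA⁻¹ : HomflyRing) - (↑varA : HomflyRing)) * value P (u ++ v) := by
  rcases List.eq_nil_or_concat' l with rfl | ⟨l, x, rfl⟩
  · rcases r with _ | ⟨x, r⟩
    -- With no strand at this level, the curl is placed at the maximum that must end `u` or, if `u`
    -- is empty, at the minimum that must begin `v`.
    · rcases List.eq_nil_or_concat' u with rfl | ⟨u, y, rfl⟩
      · rcases v with _ | ⟨y, v⟩
        · exact absurd rfl hne
        · obtain ⟨hy, hv'⟩ := hv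
          obtain ⟨p, rfl⟩ := Slice.eq_cup_of_bottom hy.symm
          have h0 : IsTangle [] [⟨[], .cup (!p), []⟩, ⟨[], .cross true (!p) p, []⟩] [p, !p] :=
            ⟨rfl, by simp [Slice.bottom, Slice.top, Gen.bottom, Gen.top], rfl⟩
          have key := value_smoothing hP (u := [⟨[], .cup (!p), []⟩]) (v := v) (l := []) (r := [])
            (p := !p) (q := p) (c := value P (⟨[], .cup p, []⟩ :: v)) (h0.append hv')
            (fun ov => by
              have := Iso.reidemeister1_cup ov (!p) [] []
              simp only [Bool.not_not] at this
              simpa using value_iso_append P this (u := []) (v := v) rfl hv')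
          rw [value_loop_orientation (v := _ :: v) o (!p) hu (by exact ⟨hy, hv'⟩)]
          simpa [smoothing] using key
      · obtain ⟨s, hu', hs, hy⟩ := isTangle_append.1 hu
        subst hs
        obtain ⟨p, rfl⟩ := Slice.eq_cap_of_top hy
        have h0 : IsTangle [p, !p] [⟨[], .cross true p (!p), []⟩, ⟨[], .cap (!p), []⟩] [] :=
          ⟨rfl, by simp [Slice.bottom, Slice.top, Gen.bottom, Gen.top], rfl⟩
        have key := value_smoothing hP (u := u) (v := ⟨[], .cap (!p), []⟩ :: v) (l := []) (r := [])
          (p := p) (q := !p) (c := value P (u ++ [⟨[], .cap p, []⟩] ++ v))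
          (by simpa using (hu'.append h0).append hv)
          (fun ov => by
            simpa using value_iso_append P (Iso.reidemeister1_cap ov p [] []) hu' hv)
        rw [value_loop_orientation o (!p) hu hv]
        simpa [smoothing] using key
    · have hk := fun ov => Iso.kink_left ov x [] r
      have key := value_smoothing hP (u := u ++ [⟨[], .cup (!x), x :: r⟩])
        (v := ⟨[], .cap (!x), x :: r⟩ :: v) (l := [!x]) (r := r) (p := x) (q := x)
        (c := value P (u ++ v))
        (by simpa using (hu.append (hk true).isTangle.1).append hv)
        (fun ov => by simpa using value_iso_append P (hk ov) hu hv)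
      rw [value_loop_orientation o (!x) hu hv]
      simpa [smoothing] using key
  · have hk := fun ov => Iso.kink_right ov x l r
    have hu' : IsTangle [] u (l ++ x :: r) := by simpa using hu
    have hv' : IsTangle (l ++ x :: r) v [] := by simpa using hv
    have key := value_smoothing hP (u := u ++ [⟨l ++ [x], .cup x, r⟩])
      (v := ⟨l ++ [x], .cap x, r⟩ :: v) (l := l) (r := (!x) :: r) (p := x) (q := x)
      (c := value P (u ++ v))
      (by simpa using (hu'.append (hk true).isTangle.1).append hv')
      (fun ov => by simpa using value_iso_append P (hk ov) hu' hv')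
    rw [value_loop_orientation o x hu hv]
    simpa [smoothing] using key

theorem value_circle (hP : IsHomfly P) (o : Bool) :
    value P [⟨[], .cup o, []⟩, ⟨[], .cap o, []⟩] = 1 := by
  have h1 := value_loop_orientation (P := P) (u := []) (v := []) (l := []) (r := []) o true rfl rfl
  have h2 := value_word P circle
  exact h1.trans (h2.trans hP.1)

/-! ### Integrality -/

/-- The inverse of `z`. -/
noncomputable def varZInv : HomflyRing := .T (-1)

theorem varZ_mul_varZInv : varZ * varZInv = 1 := by
  rw [varZ, varZInv, ← LaurentPolynomial.T_add]
  simp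

variable (P) in
open Classical in
/-- The HOMFLY polynomial without normalisation: its value on the empty diagram is `1`. -/
noncomputable def freeValue (w : List Slice) : HomflyRing :=
  if w = [] then 1 else ((↑varA⁻¹ : HomflyRing) - (↑varA : HomflyRing)) * varZInv * value P w

theorem freeValue_of_ne {w : List Slice} (h : w ≠ []) :
    freeValue P w = ((↑varA⁻¹ : HomflyRing) - (↑varA : HomflyRing)) * varZInv * value P w :=
  if_neg h

theorem freeValue_loop (hP : IsHomfly P) {u v : List Slice} {l r : List Bool} (o : Bool)
    (hu : IsTangle [] u (l ++ r)) (hv : IsTangle (l ++ r) v []) :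
    varZ * freeValue P (u ++ [⟨l, .cup o, r⟩, ⟨l, .cap o, r⟩] ++ v) =
      ((↑varA⁻¹ : HomflyRing) - (↑varA : HomflyRing)) * freeValue P (u ++ v) := by
  rw [freeValue_of_ne (by simp)]
  by_cases hne : u ++ v = []
  · obtain ⟨rfl, rfl⟩ := List.append_eq_nil_iff.1 hne
    have := isTangle_nil.1 hu
    obtain ⟨rfl, rfl⟩ := List.append_eq_nil_iff.1 this.symm
    simp only [List.nil_append, List.append_nil]
    rw [value_circle hP, freeValue, if_pos rfl]
    linear_combination ((↑varA⁻¹ : HomflyRing) - (↑varA : HomflyRing)) * varZ_mul_varZInv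
  · rw [freeValue_of_ne hne]
    have := value_loop hP o hu hv hne
    linear_combination ((↑varA⁻¹ : HomflyRing) - (↑varA : HomflyRing)) * varZInv * this

/-- The empty diagram is not a `Diagram` and is treated separately, so isotopies must not create or
destroy it. -/
theorem Iso.append_eq_nil_iff {s t : List Bool} {a b : List Slice} (h : Iso s t a b)
    {u : List Slice} (hu : IsTangle [] u s) : u ++ a = [] ↔ u ++ b = [] := by
  induction h generalizing u with
  | move l r h hx hy =>
    have h2 : ¬ (u = [] ∧ ext l r _ = []) := fun hh => by
      rcases h.ne_nil_or hx with hy | hs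
      · exact hy (by simpa [ext] using hh.2)
      · obtain ⟨rfl, -⟩ := hh
        have := isTangle_nil.1 hu
        simp [hs] at this
    simp only [List.append_eq_nil_iff]
    exact ⟨fun hh => absurd (by simpa [ext] using hh.2) h.ne_nil, fun hh => absurd hh h2⟩
  | refl _ => rfl
  | symm _ ih => exact (ih hu).symm
  | trans _ _ ih ih' => exact (ih hu).trans (ih' hu)
  | comp h _ ih ih' =>
    rw [← List.append_assoc, ← List.append_assoc, ih' (hu.append h.isTangle.1),
      List.append_eq_nil_iff, ih hu, ← List.append_eq_nil_iff]

theorem freeValue_iso {a b : List Slice} (h : Iso [] [] a b) :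
    freeValue P a = freeValue P b := by
  have := h.append_eq_nil_iff (u := []) rfl
  simp only [List.nil_append] at this
  simp only [freeValue, this, value_iso P h]

theorem freeValue_skein (hP : IsHomfly P) {u v : List Slice} {l r : List Bool} {p q ov : Bool}
    (h : IsTangle [] (u ++ [⟨l, .cross ov p q, r⟩] ++ v) []) :
    (↑varA⁻¹ : HomflyRing) * freeValue P (u ++ [⟨l, .cross (positiveOver p q) p q, r⟩] ++ v) -
      (↑varA : HomflyRing) * freeValue P (u ++ [⟨l, .cross (!positiveOver p q) p q, r⟩] ++ v) =
        varZ * freeValue P (u ++ smoothing l r p q ++ v) := by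
  have hu := h.ne_nil (by simp [Slice.bottom, Gen.bottom])
  rw [freeValue_of_ne (by simp), freeValue_of_ne (by simp), freeValue_of_ne (by simp [hu])]
  linear_combination ((↑varA⁻¹ : HomflyRing) - (↑varA : HomflyRing)) * varZInv * value_skein hP h

/-- The Laurent polynomials without negative powers of `z`. -/
noncomputable def integral : Subring HomflyRing :=
  (Polynomial.toLaurent : ℤ[T;T⁻¹][X] →+* HomflyRing).range

theorem varA_mem : (↑varA : HomflyRing) ∈ integral :=
  ⟨.C (.T 1), Polynomial.toLaurent_C _⟩

theorem varA_inv_mem : (↑varA⁻¹ : HomflyRing) ∈ integral :=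
  ⟨.C (.T (-1)), Polynomial.toLaurent_C _⟩

theorem varZ_mem : varZ ∈ integral := ⟨.X, Polynomial.toLaurent_X⟩

theorem varA_inv_mul : (↑varA⁻¹ : HomflyRing) * (↑varA : HomflyRing) = 1 := Units.inv_mul _

/-- The factor does not involve `z` and is a nonzero element of the domain `ℤ[a^{±1}]`, so
multiplication by it cannot cancel negative powers of `z`. -/
theorem mem_integral_of_mul {f : HomflyRing}
    (h : ((↑varA⁻¹ : HomflyRing) - (↑varA : HomflyRing)) * f ∈ integral) : f ∈ integral := by
  obtain ⟨n, g, hg⟩ := f.exists_T_pow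
  obtain ⟨k, hk⟩ := h
  have e : Polynomial.toLaurent (.C (LaurentPolynomial.T (-1) - .T 1 : ℤ[T;T⁻¹])) =
      ((↑varA⁻¹ : HomflyRing) - (↑varA : HomflyRing)) := by
    rw [Polynomial.toLaurent_C, map_sub]; rfl
  have h1 : (.C (LaurentPolynomial.T (-1) - .T 1 : ℤ[T;T⁻¹])) * g = .X ^ n * k := by
    apply Polynomial.toLaurent_injective
    rw [map_mul, map_mul, e, hg, hk, Polynomial.toLaurent_X_pow]
    ring
  have hne : (LaurentPolynomial.T (-1) - .T 1 : ℤ[T;T⁻¹]) ≠ 0 := by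
    intro h
    have := congrArg (fun f : ℤ[T;T⁻¹] => f.coeff 1) h
    simp [LaurentPolynomial.T_apply] at this
  have h2 : Polynomial.X ^ n ∣ g := by
    rw [Polynomial.X_pow_dvd_iff]
    intro d hd
    have := (Polynomial.X_pow_dvd_iff.1 (Dvd.intro _ h1.symm)) d hd
    rw [Polynomial.coeff_C_mul] at this
    exact (mul_eq_zero.1 this).resolve_left hne
  obtain ⟨g', rfl⟩ := h2
  refine ⟨g', ?_⟩
  have : (LaurentPolynomial.T n : HomflyRing) * Polynomial.toLaurent g' = .T n * f := by
    rw [← Polynomial.toLaurent_X_pow, ← map_mul, hg, Polynomial.toLaurent_X_pow, mul_comm]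
  exact (LaurentPolynomial.isUnit_T _).mul_left_cancel this

theorem pow_mul_mem {m n : ℕ} (h : m ≤ n) {f : HomflyRing} (hf : varZ ^ m * f ∈ integral) :
    varZ ^ n * f ∈ integral := by
  obtain ⟨k, rfl⟩ := Nat.exists_eq_add_of_le h
  rw [pow_add, mul_right_comm, mul_comm]
  exact integral.mul_mem (integral.pow_mem varZ_mem k) hf

/-- Skein induction. A smoothing raises the exponent by at most one, which the `z` of the skein
relation absorbs; a circle raises it by exactly one and contributes `(a⁻¹ - a) / z`. With the
rounded logarithm it need not be known that the count is a power of two. -/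
theorem freeValue_mem (hP : IsHomfly P) {w : List Slice} (hw : IsTangle [] w []) :
    varZ ^ Nat.log 2 (colourings w) * freeValue P w ∈ integral := by
  refine skein_induction (fun w => varZ ^ Nat.log 2 (colourings w) * freeValue P w ∈ integral)
    ?_ ?_ ?_ ?_ hw
  · simp [colourings, evalWord, closing, freeValue]
  · intro a b h ha
    rwa [← colourings_iso h, ← freeValue_iso h]
  · intro u v l r ov p q h hov h0
    rw [colourings_cross u v l r _ ov]
    set k := Nat.log 2 (colourings (u ++ [⟨l, .cross ov p q, r⟩] ++ v)) with hk
    have hle : Nat.log 2 (colourings (u ++ smoothing l r p q ++ v)) ≤ k + 1 := by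
      refine (Nat.log_mono_right (colourings_smoothing h)).trans ?_
      rw [mul_comm, Nat.log_mul_base one_lt_two (colourings_pos h).ne']
    have h0' := pow_mul_mem hle h0
    have hs := freeValue_skein hP h
    have ha := varA_inv_mul
    by_cases hov' : ov = positiveOver p q
    · rw [← hov'] at hs
      have : varZ ^ k * freeValue P (u ++ [⟨l, .cross (!ov) p q, r⟩] ++ v) =
          (↑varA⁻¹ : HomflyRing) * ((↑varA⁻¹ : HomflyRing) *
            (varZ ^ k * freeValue P (u ++ [⟨l, .cross ov p q, r⟩] ++ v)) -
            varZ ^ (k + 1) * freeValue P (u ++ smoothing l r p q ++ v)) := by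
        linear_combination (-varZ ^ k * freeValue P (u ++ [⟨l, .cross (!ov) p q, r⟩] ++ v)) * ha -
          (↑varA⁻¹ : HomflyRing) * varZ ^ k * hs
      rw [this]
      exact integral.mul_mem varA_inv_mem
        (integral.sub_mem (integral.mul_mem varA_inv_mem hov) h0')
    · have hov'' : positiveOver p q = !ov := by
        revert hov'; cases positiveOver p q <;> cases ov <;> simp
      rw [hov'', Bool.not_not] at hs
      have : varZ ^ k * freeValue P (u ++ [⟨l, .cross (!ov) p q, r⟩] ++ v) =
          (↑varA : HomflyRing) * ((↑varA : HomflyRing) *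
            (varZ ^ k * freeValue P (u ++ [⟨l, .cross ov p q, r⟩] ++ v)) +
            varZ ^ (k + 1) * freeValue P (u ++ smoothing l r p q ++ v)) := by
        linear_combination (-varZ ^ k * freeValue P (u ++ [⟨l, .cross (!ov) p q, r⟩] ++ v)) * ha +
          (↑varA : HomflyRing) * varZ ^ k * hs
      rw [this]
      exact integral.mul_mem varA_mem (integral.add_mem (integral.mul_mem varA_mem hov) h0')
  · intro u v l r o hu hv h
    rw [colourings_loop o hu, mul_comm 2, Nat.log_mul_base one_lt_two
      (colourings_pos (hu.append hv)).ne', pow_succ, mul_assoc, freeValue_loop hP o hu hv,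
      mul_left_comm]
    exact integral.mul_mem (integral.sub_mem varA_inv_mem varA_mem) h

/-- The HOMFLY polynomial of a link with at most `k + 1` components has no term of degree less
than `-k` in `z`. -/
theorem value_mem (hP : IsHomfly P) {w : List Slice} (hw : IsTangle [] w []) (hne : w ≠ [])
    {k : ℕ} (hk : colourings w < 2 ^ (k + 2)) : varZ ^ k * value P w ∈ integral := by
  have h1 := freeValue_mem hP hw
  -- The exponent `k + 1` drops to `k` because `freeValue` contains one factor `z⁻¹`; its factor
  -- `a⁻¹ - a` is then divided out.
  have h2 : Nat.log 2 (colourings w) ≤ k + 1 := by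
    have := Nat.log_lt_of_lt_pow (colourings_pos hw).ne' hk
    omega
  have h3 := pow_mul_mem h2 h1
  rw [freeValue_of_ne hne] at h3
  apply mem_integral_of_mul
  convert h3 using 1
  linear_combination (-((↑varA⁻¹ : HomflyRing) - (↑varA : HomflyRing)) * varZ ^ k * value P w) *
    varZ_mul_varZInv

end Value

/-! ### Twists -/

section Twist

variable {P : OrientedLink → HomflyRing}

theorem twist_isTangle_even (l r : List Bool) (p q : Bool) (m : ℕ) :
    IsTangle (l ++ [p, q] ++ r) (twist l r (2 * m) p q) (l ++ [p, q] ++ r) := by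
  induction m with
  | zero => rfl
  | succ m ih => exact ⟨rfl, rfl, ih⟩

theorem twist_isTangle_same (l r : List Bool) (o : Bool) (m : ℕ) :
    IsTangle (l ++ [o, o] ++ r) (twist l r m o o) (l ++ [o, o] ++ r) := by
  induction m with
  | zero => rfl
  | succ m ih => exact ⟨rfl, ih⟩

/-- Apply the skein relation at the lowest crossing; made negative, it cancels with the one above it
by the second Reidemeister move. -/
theorem value_twist (hP : IsHomfly P) {u v : List Slice} {l r : List Bool} {p q : Bool} {m : ℕ}
    (hu : IsTangle [] u (l ++ [p, q] ++ r))
    (hv : IsTangle (l ++ [p, q] ++ r) (twist l r m p q ++ v) []) :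
    (↑varA⁻¹ : HomflyRing) * value P (u ++ twist l r (m + 2) p q ++ v) -
      (↑varA : HomflyRing) * value P (u ++ twist l r m p q ++ v) =
        varZ * value P (u ++ smoothing l r p q ++ twist l r (m + 1) q p ++ v) := by
  have h := value_skein hP (u := u) (v := twist l r (m + 1) q p ++ v) (l := l) (r := r)
    (p := p) (q := q) (ov := true) (by
      have h1 : IsTangle (l ++ [p, q] ++ r)
        (⟨l, .cross true p q, r⟩ :: (twist l r (m + 1) q p ++ v)) [] := ⟨rfl, rfl, hv⟩
      simpa using hu.append h1)
  have e : positiveOver q p = positiveOver p q := Bool.beq_comm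
  have h2 := value_iso_append P (Iso.reidemeister2 (!positiveOver p q) p q l r)
    (u := u) (v := twist l r m p q ++ v) (by simpa using hu) (by simpa using hv)
  simp only [Bool.not_not, List.append_nil] at h2
  simp only [twist, List.append_assoc, List.cons_append,
    List.nil_append, e] at h h2 ⊢
  rw [← h2]
  exact h

/-- Each crossing is removed by a first Reidemeister move, which reverses the minimum; an even
number restores its orientation. -/
theorem Iso.cup_twist (o : Bool) (l r : List Bool) (m : ℕ) :
    Iso (l ++ r) (l ++ [o, !o] ++ r) (⟨l, .cup o, r⟩ :: twist l r (2 * m) o (!o))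
      [⟨l, .cup o, r⟩] := by
  induction m with
  | zero => exact .refl ⟨by simp [Slice.bottom, Gen.bottom], rfl⟩
  | succ m ih =>
    have h0 : IsTangle (l ++ r) (⟨l, .cup o, r⟩ :: twist l r (2 * (m + 1)) o (!o))
        (l ++ [o, !o] ++ r) := ⟨by simp [Slice.bottom, Gen.bottom], twist_isTangle_even l r o _ _⟩
    have h1 := step h0 (reidemeister1_cup (positiveOver o (!o)) o l r) (by simp) []
      (⟨l, .cross (positiveOver (!o) o) (!o) o, r⟩ :: twist l r (2 * m) o (!o))
      (by simp [twist, Nat.mul_succ]) rfl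
    have h2 := step h1.isTangle.2
      (by simpa using reidemeister1_cup (positiveOver (!o) o) (!o) l r) (by simp) []
      (twist l r (2 * m) o (!o)) (by simp) rfl
    exact (h1.trans h2).trans ih

/-- After smoothing the lowest crossing, the other `2m + 1` crossings sit on a minimum and unwind,
so the right-hand side does not depend on `m`. Their odd number turns `.cup (!o)` into `.cup o`. -/
theorem value_antitwist (hP : IsHomfly P) {u v : List Slice} {l r : List Bool} {o : Bool} (m : ℕ)
    (hu : IsTangle [] u (l ++ [o, !o] ++ r)) (hv : IsTangle (l ++ [o, !o] ++ r) v []) :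
    (↑varA⁻¹ : HomflyRing) * value P (u ++ twist l r (2 * (m + 1)) o (!o) ++ v) -
      (↑varA : HomflyRing) * value P (u ++ twist l r (2 * m) o (!o) ++ v) =
        varZ * value P (u ++ [⟨l, .cap o, r⟩, ⟨l, .cup o, r⟩] ++ v) := by
  rw [Nat.mul_succ, value_twist hP hu ((twist_isTangle_even l r o _ m).append hv)]
  have h1 := Iso.reidemeister1_cup (positiveOver (!o) o) (!o) l r
  simp only [Bool.not_not] at h1
  have h2 : IsTangle (l ++ r) (⟨l, .cup (!o), r⟩ :: twist l r (2 * m + 1) (!o) o)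
      (l ++ [o, !o] ++ r) :=
    ⟨by simp [Slice.bottom, Gen.bottom], by
      simp only [Slice.top, Gen.top, Bool.not_not]
      exact ⟨rfl, twist_isTangle_even l r o _ m⟩⟩
  have h3 := (Iso.step h2 h1 (by simp) [] (twist l r (2 * m) o (!o)) (by simp [twist]) rfl).trans
    (Iso.cup_twist o l r m)
  have hcap : IsTangle (l ++ [o, !o] ++ r) [⟨l, .cap o, r⟩] (l ++ r) :=
    ⟨rfl, by simp [isTangle_nil, Slice.top, Gen.top]⟩
  have h4 := value_iso_append P h3 (hu.append hcap) hv
  have hs : smoothing l r o (!o) = [⟨l, .cap o, r⟩, ⟨l, .cup (!o), r⟩] := by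
    simp [smoothing]
  rw [hs]
  simp only [List.append_assoc, List.cons_append, List.nil_append] at h4 ⊢
  rw [h4]

/-- The tangles below and above the place where a twist is inserted. -/
theorem isTangle_of_twist {u v : List Slice} {l r : List Bool} {p q : Bool} {m : ℕ} (hm : m ≠ 0)
    (h : IsTangle [] (u ++ v) []) (h' : IsTangle [] (u ++ twist l r m p q ++ v) []) :
    IsTangle [] u (l ++ [p, q] ++ r) ∧ IsTangle (l ++ [p, q] ++ r) v [] := by
  obtain ⟨m, rfl⟩ := Nat.exists_eq_succ_of_ne_zero hm
  rw [List.append_assoc] at h'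
  obtain ⟨s, hu, hs, -⟩ := isTangle_append.1 h'
  subst hs
  obtain ⟨s, hu', hv⟩ := isTangle_append.1 h
  obtain rfl := hu.unique hu'
  exact ⟨hu, hv⟩

end Twist

/-! ### The linear recursions -/

/-- The characteristic roots are `a * s` and `-(a * t)`. The factor `s + t`, their difference up to
the unit `a`, replaces division in the closed formula. -/
theorem twist_recursion {R : Type*} [CommRing R] {a b s t : R} {w : ℕ → R} (hab : b * a = 1)
    (hst : s * t = 1) (hw : ∀ m, b * w (m + 2) - a * w m = (s - t) * w (m + 1)) (n : ℕ) :
    (s + t) * w n =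
      a ^ n * (s ^ n * (b * w 1 + t * w 0) + (-t) ^ n * (s * w 0 - b * w 1)) := by
  induction n using Nat.twoStepInduction with
  | zero => ring
  | one => linear_combination (-(s + t) * w 1) * hab
  | more n h0 h1 =>
    have hw' : w (n + 2) = a * a * w n + a * (s - t) * w (n + 1) := by
      linear_combination a * hw n - w (n + 2) * hab
    rw [hw']
    linear_combination a * a * h0 + a * (s - t) * h1 - a ^ (n + 2) * (
      s ^ n * (b * w 1 + t * w 0) + (-t) ^ n * (s * w 0 - b * w 1)) * hst

/-- The quantity `(c - 1) * x + d` is the deviation from the fixed point of the affine map, cleared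
of denominators, so each step multiplies it by `c`. -/
theorem antitwist_recursion {R : Type*} [CommRing R] {c d e : R} {x : ℕ → R}
    (hx : ∀ m, x (m + 1) = c * x m + d) (n : ℕ) (he : e = (c - 1) * x 0 + d) :
    (c - 1) * x n + d = c ^ n * e := by
  induction n with
  | zero => rw [he]; ring
  | succ n ih => rw [hx, pow_succ]; linear_combination c * ih

/-! ### Specialisations -/

theorem mapRingHom_T {R S : Type*} [Semiring R] [Semiring S] (f : R →+* S) (n : ℤ) :
    AddMonoidAlgebra.mapRingHom ℤ f (LaurentPolynomial.T n) = (.T n : S[T;T⁻¹]) := by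
  refine (AddMonoidAlgebra.mapRingHom_single f n 1).trans ?_
  rw [map_one]
  rfl

theorem mapRingHom_C {R S : Type*} [Semiring R] [Semiring S] (f : R →+* S) (x : R) :
    AddMonoidAlgebra.mapRingHom ℤ f (LaurentPolynomial.C x) = (.C (f x) : S[T;T⁻¹]) :=
  AddMonoidAlgebra.mapRingHom_single f 0 x

theorem evalZ_varA (w : ℂˣ) : evalZ w varA = .T 1 :=
  (LaurentPolynomial.eval₂_C _ _ _).trans (mapRingHom_T _ _)

theorem evalZ_varA_inv (w : ℂˣ) : evalZ w (↑varA⁻¹ : HomflyRing) = .T (-1) :=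
  (LaurentPolynomial.eval₂_C _ _ _).trans (mapRingHom_T _ _)

theorem evalZ_varZ (w : ℂˣ) : evalZ w varZ = LaurentPolynomial.C (w : ℂ) := by
  simp [evalZ, varZ]

theorem evalA_varA (w : ℂˣ) : evalA w varA = LaurentPolynomial.C (w : ℂ) := by
  refine (mapRingHom_C _ _).trans ?_
  simp

theorem evalA_varA_inv (w : ℂˣ) :
    evalA w (↑varA⁻¹ : HomflyRing) = LaurentPolynomial.C ((w : ℂ)⁻¹) := by
  refine (mapRingHom_C _ _).trans ?_
  rw [LaurentPolynomial.eval₂_T]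
  simp

theorem evalA_varZ (w : ℂˣ) : evalA w varZ = .T 1 := mapRingHom_T _ _

theorem modTwo_T (n : ℤ) : modTwo (.T n) = .T n := mapRingHom_T _ _

/-! ### The effect of twist moves -/

section Moves

variable {P : OrientedLink → HomflyRing}

theorem evalZ_tMove (hP : IsHomfly P) {k : ℕ} (hk : 3 ≤ k) {ζ : ℂ}
    (hζ : IsPrimitiveRoot ζ (2 * k)) {K K' : OrientedLink} (h : IsTMove (2 * k) K K') :
    evalZ (Units.mk0 (ζ - ζ⁻¹) (rootOfUnity_sub_inv_ne_zero hk hζ)) (P K') =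
      LaurentPolynomial.T (2 * (k : ℤ)) *
        evalZ (Units.mk0 (ζ - ζ⁻¹) (rootOfUnity_sub_inv_ne_zero hk hζ)) (P K) := by
  obtain ⟨D, D', u, v, l, r, o, rfl, rfl, hD, hD'⟩ := h
  set φ := evalZ (Units.mk0 (ζ - ζ⁻¹) (rootOfUnity_sub_inv_ne_zero hk hζ)) with hφ
  have hc := D.closed
  have hc' := D'.closed
  rw [hD] at hc
  rw [hD'] at hc'
  obtain ⟨hu, hv⟩ := isTangle_of_twist (by omega) hc hc'
  rw [← value_word P D, ← value_word P D', hD, hD']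
  have h0 : ζ ≠ 0 := rootOfUnity_ne_zero (by omega) hζ
  have hrec := twist_recursion (a := (.T 1 : ℂ[T;T⁻¹])) (b := .T (-1))
    (s := LaurentPolynomial.C ζ) (t := LaurentPolynomial.C ζ⁻¹)
    (w := fun m => φ (value P (u ++ twist l r m o o ++ v)))
    (by rw [← LaurentPolynomial.T_add]; simp)
    (by rw [← map_mul, mul_inv_cancel₀ h0, map_one])
    (fun m => by
      have := congrArg φ (value_twist hP (m := m) hu ((twist_isTangle_same l r o m).append hv))
      rw [map_sub, map_mul, map_mul, map_mul, hφ, evalZ_varA, evalZ_varA_inv, evalZ_varZ] at this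
      simpa [smoothing] using this) (2 * k)
  have hs : (LaurentPolynomial.C ζ : ℂ[T;T⁻¹]) ^ (2 * k) = 1 := by
    rw [← map_pow, hζ.pow_eq_one, map_one]
  have ht : (-(LaurentPolynomial.C ζ⁻¹ : ℂ[T;T⁻¹])) ^ (2 * k) = 1 := by
    rw [(even_two_mul k).neg_pow, ← map_pow, inv_pow, hζ.pow_eq_one, inv_one, map_one]
  -- The two roots are distinct: otherwise `ζ ^ 4 = 1`, whereas `ζ` has order `2 * k ≥ 6`. This is
  -- where `k = 2` fails.
  have hne : ζ + ζ⁻¹ ≠ 0 := by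
    intro h
    have h1 : ζ ^ 2 = -1 := by
      have : ζ * (ζ + ζ⁻¹) = 0 := by rw [h, mul_zero]
      rw [mul_add, mul_inv_cancel₀ h0] at this
      linear_combination this
    have h2 : ζ ^ 4 = 1 := by
      linear_combination (ζ ^ 2 - 1) * h1
    have := Nat.le_of_dvd (by norm_num) (hζ.dvd_of_pow_eq_one 4 h2)
    omega
  have hunit : IsUnit (LaurentPolynomial.C ζ + LaurentPolynomial.C ζ⁻¹ : ℂ[T;T⁻¹]) := by
    rw [← map_add]
    exact (IsUnit.mk0 _ hne).map _
  rw [hs, ht, LaurentPolynomial.T_pow] at hrec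
  refine hunit.mul_left_cancel ?_
  simp only [twist, List.append_nil] at hrec
  rw [hrec]
  push_cast
  rw [mul_one]
  ring

theorem value_mem_of_isKnot (hP : IsHomfly P) {D : Diagram} (h : D.link.IsKnot) :
    value P D.word ∈ integral := by
  have := value_mem hP D.closed D.nonempty (k := 0)
    (lt_of_le_of_lt (colourings_le_two_of_isKnot h) (by norm_num))
  simpa using this

theorem modTwo_tMove (hP : IsHomfly P) {K K' : OrientedLink} (hK : K.IsKnot)
    (h : IsTMove 4 K K') : ∃ p p' : ℤ[T;T⁻¹][X], Polynomial.toLaurent p = P K ∧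
      Polynomial.toLaurent p' = P K' ∧
      modTwo (p'.eval 0) = LaurentPolynomial.T 4 * modTwo (p.eval 0) := by
  obtain ⟨D, D', u, v, l, r, o, rfl, rfl, hD, hD'⟩ := h
  have hc := D.closed
  have hc' := D'.closed
  rw [hD] at hc
  rw [hD'] at hc'
  obtain ⟨hu, hv⟩ := isTangle_of_twist (by omega) hc hc'
  obtain ⟨p, hp⟩ := value_mem_of_isKnot hP hK
  have hle := colourings_le_two_of_isKnot hK
  rw [hD] at hp hle
  rw [← value_word P D, ← value_word P D', hD, hD']
  have htw : ∀ m, IsTangle [] (u ++ twist l r m o o ++ v) [] := fun m =>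
    (hu.append (twist_isTangle_same l r o m)).append hv
  -- The diagram with one crossing is a smoothing of the knot diagram with a cancelling pair of
  -- crossings inserted, so it has at most four colourings.
  have h2 : colourings (u ++ twist l r 1 o o ++ v) ≤ 2 * colourings (u ++ v) := by
    have h3 := colourings_smoothing (u := u) (v := twist l r 1 o o ++ v) (l := l)
      (r := r) (ov := false) (p := o) (q := o) (by
        have h1 : IsTangle (l ++ [o, o] ++ r)
          (⟨l, .cross false o o, r⟩ :: (twist l r 1 o o ++ v)) [] := ⟨rfl, rfl, hv⟩
        simpa using hu.append h1)
    have h4 : colourings (u ++ [⟨l, .cross false o o, r⟩] ++ (twist l r 1 o o ++ v)) =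
        colourings (u ++ v) := by
      refine colourings_iso ?_
      have e := ((Iso.reidemeister2 false o o l r).append_right (by simpa using hv)).append_left
        (c := u) (s := []) (by simpa using hu)
      simpa [twist, positiveOver] using e
    rw [h4] at h3
    simpa [smoothing] using h3
  obtain ⟨p₁, hp₁⟩ := value_mem hP (htw 1) (by simp [twist]) (k := 1)
    (lt_of_le_of_lt (h2.trans (Nat.mul_le_mul_left 2 hle)) (by norm_num))
  have hw : ∀ m, (↑varA⁻¹ : HomflyRing) * value P (u ++ twist l r (m + 2) o o ++ v) -
      (↑varA : HomflyRing) * value P (u ++ twist l r m o o ++ v) =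
        varZ * value P (u ++ twist l r (m + 1) o o ++ v) := fun m => by
    simpa [smoothing] using
      value_twist hP (m := m) hu ((twist_isTangle_same l r o m).append hv)
  have w2 := hw 0
  have w3 := hw 1
  have w4 := hw 2
  have ha := varA_inv_mul
  set W : ℕ → HomflyRing := fun m => value P (u ++ twist l r m o o ++ v) with hW
  have hp0 : W 0 = Polynomial.toLaurent p := by simpa [hW, twist] using hp.symm
  have hp1 : varZ * W 1 = Polynomial.toLaurent p₁ := by simpa [hW] using hp₁.symm
  change ↑varA⁻¹ * W 2 - ↑varA * W 0 = varZ * W 1 at w2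
  change ↑varA⁻¹ * W 3 - ↑varA * W 1 = varZ * W 2 at w3
  change ↑varA⁻¹ * W 4 - ↑varA * W 2 = varZ * W 3 at w4
  let A : ℤ[T;T⁻¹][X] := .C (.T 1)
  have hA : Polynomial.toLaurent A = (↑varA : HomflyRing) := Polynomial.toLaurent_C _
  have hX : Polynomial.toLaurent (.X : ℤ[T;T⁻¹][X]) = varZ := Polynomial.toLaurent_X
  have e2 : W 2 = ↑varA * ↑varA * W 0 + ↑varA * (varZ * W 1) := by
    linear_combination (↑varA : HomflyRing) * w2 - W 2 * ha
  have e3 : W 3 = ↑varA * ↑varA * W 1 + ↑varA * (varZ * W 2) := by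
    linear_combination (↑varA : HomflyRing) * w3 - W 3 * ha
  have e4 : W 4 = ↑varA * ↑varA * W 2 + ↑varA * (varZ * W 3) := by
    linear_combination (↑varA : HomflyRing) * w4 - W 4 * ha
  -- The recursion solved for `W 4` in terms of `W 0` and `varZ * W 1`. It also shows that the value
  -- of `K'` is a polynomial in `z`.
  refine ⟨p, A ^ 4 * (1 + .X ^ 2) * p + A ^ 3 * (2 + .X ^ 2) * p₁, hp, ?_, ?_⟩
  · change _ = W 4
    simp only [map_add, map_mul, map_pow, hA, hX, map_ofNat, ← hp0, ← hp1, map_one]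
    rw [e4, e3, e2]
    ring
  · have e : modTwo 2 = 0 := by
      rw [map_ofNat, ← map_ofNat LaurentPolynomial.C 2, show (OfNat.ofNat 2 : ZMod 2) = 0 from rfl,
        map_zero]
    simp [A, modTwo_T, e, LaurentPolynomial.T_pow]

theorem evalA_tBarMove (hP : IsHomfly P) {k : ℕ} (hk : 2 ≤ k) {ζ : ℂ}
    (hζ : IsPrimitiveRoot ζ (2 * k)) {K K' : OrientedLink} (h : IsTBarMove (2 * k) K K') :
    evalA (Units.mk0 ζ (rootOfUnity_ne_zero hk hζ)) (P K') =
      evalA (Units.mk0 ζ (rootOfUnity_ne_zero hk hζ)) (P K) := by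
  obtain ⟨D, D', u, v, l, r, o, rfl, rfl, hD, hD'⟩ := h
  set φ := evalA (Units.mk0 ζ (rootOfUnity_ne_zero hk hζ)) with hφ
  have hc := D.closed
  have hc' := D'.closed
  rw [hD] at hc
  rw [hD'] at hc'
  obtain ⟨hu, hv⟩ := isTangle_of_twist (by omega) hc hc'
  rw [← value_word P D, ← value_word P D', hD, hD']
  have h0 : ζ ≠ 0 := rootOfUnity_ne_zero hk hζ
  have hab : (LaurentPolynomial.C ζ * LaurentPolynomial.C ζ⁻¹ : ℂ[T;T⁻¹]) = 1 := by
    rw [← map_mul, mul_inv_cancel₀ h0, map_one]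
  have hrec := antitwist_recursion (c := (LaurentPolynomial.C ζ : ℂ[T;T⁻¹]) ^ 2)
    (d := LaurentPolynomial.C ζ * (.T 1 * φ (value P (u ++ [⟨l, .cap o, r⟩, ⟨l, .cup o, r⟩] ++ v))))
    (x := fun m => φ (value P (u ++ twist l r (2 * m) o (!o) ++ v)))
    (fun m => by
      have := congrArg φ (value_antitwist hP m hu hv)
      rw [map_sub, map_mul, map_mul, map_mul, hφ, evalA_varA, evalA_varA_inv, evalA_varZ] at this
      simp only [Units.val_mk0] at this
      rw [← this]
      linear_combination (-φ (value P (u ++ twist l r (2 * (m + 1)) o (!o) ++ v))) * hab) k rfl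
  have hpow : ((LaurentPolynomial.C ζ : ℂ[T;T⁻¹]) ^ 2) ^ k = 1 := by
    rw [← pow_mul, ← map_pow, hζ.pow_eq_one, map_one]
  -- The multiplier of the affine recursion is not `1`, since `ζ` has order at least four.
  have hne : ζ ^ 2 - 1 ≠ 0 := by
    intro h
    have := Nat.le_of_dvd two_pos (hζ.dvd_of_pow_eq_one 2 (sub_eq_zero.1 h))
    omega
  have hunit : IsUnit ((LaurentPolynomial.C ζ : ℂ[T;T⁻¹]) ^ 2 - 1) := by
    rw [← map_pow, ← map_one LaurentPolynomial.C, ← map_sub]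
    exact (IsUnit.mk0 _ hne).map _
  rw [hpow, one_mul] at hrec
  simpa [twist] using hunit.mul_left_cancel (add_right_cancel hrec)

end Moves

open Operator

/-! ### The vertex model of the HOMFLY polynomial -/

/-- The parameters of a vertex model with labels in `A`: the values of the variables `q` and `a`
and the weights of the labels, which determine the weights of the minima and maxima. -/
structure Weights (A K : Type*) [Fintype A] [LinearOrder A] [Field K] where
  q : K
  a : K
  μ : A → K
  q_ne : q ≠ 0
  a_ne : a ≠ 0
  μ_ne : ∀ i, μ i ≠ 0
  -- These four equations express the first Reidemeister move: two signs of the crossing, and sums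
  -- weighted by `μ` or by its inverse.
  sum_lt : ∀ j, q * μ j + (q - q⁻¹) * ∑ i, (if i < j then μ i else 0) = a⁻¹
  sum_gt : ∀ j, q⁻¹ * μ j - (q - q⁻¹) * ∑ i, (if j < i then μ i else 0) = a
  sum_inv_gt : ∀ j, q * (μ j)⁻¹ + (q - q⁻¹) * ∑ i, (if j < i then (μ i)⁻¹ else 0) = a⁻¹
  sum_inv_lt : ∀ j, q⁻¹ * (μ j)⁻¹ - (q - q⁻¹) * ∑ i, (if i < j then (μ i)⁻¹ else 0) = a

namespace Weights

variable {A K : Type*} [Fintype A] [LinearOrder A] [Field K] (W : Weights A K)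

/-- The weight of a minimum. -/
def cupWeight (o : Bool) (x : A) : K := if o then 1 else W.μ x

/-- The weight of a maximum. -/
def capWeight (o : Bool) (x : A) : K := if o then (W.μ x)⁻¹ else 1

/-- The weight of a crossing, positive if `e = true`, at which the labels follow the strands. -/
def straight (e : Bool) (x y : A) : K :=
  if e then (if x = y then W.a * W.q else W.a) else (if x = y then W.a⁻¹ * W.q⁻¹ else W.a⁻¹)

/-- The weight of a crossing at which the labels follow the smoothing. -/
def turn (e : Bool) (x y : A) : K :=
  if e then (if x < y then W.a * (W.q - W.q⁻¹) else 0)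
  else (if y < x then -(W.a⁻¹ * (W.q - W.q⁻¹)) else 0)

/-- The vertex model. -/
def model : Gen → Operator A K
  | .cup o, F, c => ∑ i, W.cupWeight o i * F (i :: i :: c)
  | .cap o, F, x :: y :: c => if x = y then W.capWeight o x * F c else 0
  | .cap _, _, _ => 0
  | .cross ov true true, F, x :: y :: c =>
      W.straight ov x y * F (y :: x :: c) + W.turn ov x y * F (x :: y :: c)
  | .cross ov false false, F, x :: y :: c =>
      W.straight ov x y * F (y :: x :: c) + W.turn ov y x * F (x :: y :: c)
  -- Crossings of antiparallel strands are parallel crossings bent by a minimum and a maximum, whose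
  -- weights produce `μ i / μ x` here and `1` in the next case. Bending exchanges the sign
  -- convention, hence `!ov`.
  | .cross ov true false, F, x :: y :: c =>
      W.straight (!ov) x y * F (y :: x :: c) +
        if x = y then ∑ i, W.turn (!ov) i x * (W.μ i / W.μ x) * F (i :: i :: c) else 0
  | .cross ov false true, F, x :: y :: c =>
      W.straight (!ov) x y * F (y :: x :: c) +
        if x = y then ∑ i, W.turn (!ov) x i * F (i :: i :: c) else 0
  | .cross _ _ _, _, _ => 0

theorem isLocal_model : IsLocal W.model where
  linear g := by
    constructor
    · intro F G
      funext c
      cases g with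
      | cup o => simp only [model, Pi.add_apply, mul_add, Finset.sum_add_distrib]
      | cap o =>
        rcases c with _ | ⟨x, _ | ⟨y, c⟩⟩ <;> simp only [model, Pi.add_apply, add_zero]
        split_ifs <;> ring
      | cross ov p q =>
        rcases c with _ | ⟨x, _ | ⟨y, c⟩⟩ <;> cases p <;> cases q <;>
          simp only [model, Pi.add_apply, add_zero, mul_add, Finset.sum_add_distrib]
        all_goals try split_ifs
        all_goals ring
    · intro k F
      funext c
      cases g with
      | cup o =>
        simp only [model, Pi.smul_apply, smul_eq_mul, Finset.mul_sum]
        exact Finset.sum_congr rfl fun _ _ => by ring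
      | cap o =>
        rcases c with _ | ⟨x, _ | ⟨y, c⟩⟩ <;> simp only [model, Pi.smul_apply, smul_eq_mul, mul_zero]
        split_ifs <;> ring
      | cross ov p q =>
        rcases c with _ | ⟨x, _ | ⟨y, c⟩⟩ <;> cases p <;> cases q <;>
          simp only [model, Pi.smul_apply, smul_eq_mul, mul_zero, mul_add, Finset.mul_sum, mul_ite,
            mul_left_comm k]
  congr g j F G c h hc := by
    cases g with
    | cup o =>
      exact Finset.sum_congr rfl fun i _ => by
        rw [h _ (by simp [Gen.top, Gen.bottom] at hc ⊢; omega)]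
    | cap o =>
      obtain ⟨x, y, c, rfl⟩ := exists_cons_cons (c := c) (by simp [Gen.bottom] at hc; omega)
      simp only [model]
      rw [h _ (by simp [Gen.top, Gen.bottom] at hc ⊢; omega)]
    | cross ov p q =>
      obtain ⟨x, y, c, rfl⟩ := exists_cons_cons (c := c) (by simp [Gen.bottom] at hc; omega)
      have h' : ∀ x y, F (x :: y :: c) = G (x :: y :: c) := fun x y =>
        h _ (by simp [Gen.top, Gen.bottom] at hc ⊢; omega)
      cases p <;> cases q <;> simp only [model, h']
  natural g n ψ hψ F c hc := by
    have hL := isLinearMap_shift n hψ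
    have hadd : ∀ F G c, shift n ψ (fun d => F d + G d) c = shift n ψ F c + shift n ψ G c :=
      fun F G c => congrFun (hL.map_add F G) c
    have hmul : ∀ k F c, shift n ψ (fun d => k * F d) c = k * shift n ψ F c :=
      fun k F c => congrFun (hL.map_smul k F) c
    have hzero : ∀ c, shift n ψ (fun _ => 0) c = 0 := fun c => congrFun hL.map_zero c
    have hsum : ∀ (F : A → List A → K) c, shift n ψ (fun d => ∑ i, F i d) c =
        ∑ i, shift n ψ (F i) c := fun F c => by
      have := congrFun (map_sum (hL.mk' _) F Finset.univ) c
      simpa [Finset.sum_fn] using this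
    cases g with
    | cup o =>
      have h : W.model (.cup o) F = fun d => ∑ i, W.cupWeight o i * F (i :: i :: d) := rfl
      rw [h]
      simp [Gen.top, Gen.bottom, model, add_comm _ n, shift, hsum, hmul]
    | cap o =>
      obtain ⟨x, y, c, rfl⟩ := exists_cons_cons (c := c) (by simpa [Gen.bottom] using hc)
      by_cases hxy : x = y <;>
        simp [Gen.top, Gen.bottom, model, add_comm _ n, shift, hxy, hmul, hzero]
    | cross ov p q =>
      obtain ⟨x, y, c, rfl⟩ := exists_cons_cons (c := c) (by simpa [Gen.bottom] using hc)
      cases p <;> cases q <;> by_cases hxy : x = y <;>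
        simp [Gen.top, Gen.bottom, model, add_comm _ n, shift, hxy, hmul, hadd, hsum]

theorem zigzag_left (o : Bool) (F : List A → K) (x : A) (c : List A) :
    evalWord W.model [⟨[], .cup o, [o]⟩, ⟨[o], .cap (!o), []⟩] F (x :: c) = F (x :: c) := by
  have := W.μ_ne x
  cases o <;> simp [evalWord, shift, model, cupWeight, capWeight, this]

theorem zigzag_right (o : Bool) (F : List A → K) (x : A) (c : List A) :
    evalWord W.model [⟨[o], .cup (!o), []⟩, ⟨[], .cap o, [o]⟩] F (x :: c) = F (x :: c) := by
  have := W.μ_ne x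
  cases o <;> simp [evalWord, shift, model, cupWeight, capWeight, this]

theorem straight_comm (e : Bool) (x y : A) : W.straight e x y = W.straight e y x := by
  simp [straight, eq_comm]

theorem slide_cap (ov o x : Bool) (F : List A → K) (i j k : A) (c : List A) :
    evalWord W.model [⟨[o], .cross ov x (!o), []⟩, ⟨[], .cap o, [x]⟩] F (i :: j :: k :: c) =
      evalWord W.model [⟨[], .cross (!ov) o x, [!o]⟩, ⟨[x], .cap o, []⟩] F (i :: j :: k :: c) := by
  have hμ : ∀ (t : K) (i j : A) (f : K), t * (W.μ i * (W.μ j)⁻¹) * ((W.μ i)⁻¹ * f) =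
      t * ((W.μ j)⁻¹ * f) := fun t i j f => by have := W.μ_ne i; field_simp
  cases o <;> cases x <;> by_cases hij : i = j <;> by_cases hik : i = k <;>
    by_cases hjk : j = k <;> subst_vars <;>
    simp_all [evalWord, shift, model, capWeight, div_eq_mul_inv]
  all_goals exact .inl (W.straight_comm _ _ _)

theorem slide_cup (ov o x : Bool) (F : List A → K) (i : A) (c : List A) :
    evalWord W.model [⟨[], .cup o, [x]⟩, ⟨[o], .cross ov (!o) x, []⟩] F (i :: c) =
      evalWord W.model [⟨[x], .cup o, []⟩, ⟨[], .cross (!ov) x o, [!o]⟩] F (i :: c) := by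
  have h := W.μ_ne
  have hs := W.straight_comm
  cases o <;> cases x <;>
    simp [evalWord, shift, model, cupWeight, mul_add, Finset.sum_add_distrib, Finset.mul_sum]
  · exact congrArg₂ _ (Finset.sum_congr rfl fun k _ => by rw [hs])
      (Finset.sum_congr rfl fun k _ => by have := h i; field_simp)
  · exact congrArg₂ _ (Finset.sum_congr rfl fun k _ => by rw [hs])
      (Finset.sum_congr rfl fun k _ => by have := h i; field_simp)
  · exact Finset.sum_congr rfl fun k _ => by rw [hs]
  · exact Finset.sum_congr rfl fun k _ => by rw [hs]

/-- This is the weight of a kink; clearing denominators gives `sum_lt` for positive and `sum_gt` for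
negative crossings. -/
theorem straight_add_sum_turn_left (e : Bool) (x : A) :
    W.straight e x x + ∑ i, W.turn e i x * (W.μ i / W.μ x) = (W.μ x)⁻¹ := by
  have h := W.μ_ne x
  have ha := W.a_ne
  cases e with
  | true =>
    have h1 : ∑ i, W.turn true i x * (W.μ i / W.μ x) =
        W.a * (W.q - W.q⁻¹) * (∑ i, if i < x then W.μ i else 0) / W.μ x := by
      rw [Finset.mul_sum, Finset.sum_div]
      exact Finset.sum_congr rfl fun i _ => by simp only [turn, if_true]; split_ifs <;> ring
    have h2 := W.sum_lt x
    rw [h1]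
    simp only [straight]
    set S := ∑ i, if i < x then W.μ i else 0
    have h3 : W.a * (W.q * W.μ x + (W.q - W.q⁻¹) * S) = 1 := by rw [h2, mul_inv_cancel₀ ha]
    simp only [if_true]
    rw [← mul_eq_one_iff_eq_inv₀ h, add_mul, div_mul_cancel₀ _ h]
    linear_combination h3
  | false =>
    have h1 : ∑ i, W.turn false i x * (W.μ i / W.μ x) =
        -(W.a⁻¹ * (W.q - W.q⁻¹) * (∑ i, if x < i then W.μ i else 0)) / W.μ x := by
      rw [Finset.mul_sum, ← Finset.sum_neg_distrib, Finset.sum_div]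
      exact Finset.sum_congr rfl fun i _ => by
        simp only [turn, Bool.false_eq_true, if_false]; split_ifs <;> ring
    have h2 := W.sum_gt x
    rw [h1]
    simp only [straight]
    set S := ∑ i, if x < i then W.μ i else 0
    have h3 : W.a⁻¹ * (W.q⁻¹ * W.μ x - (W.q - W.q⁻¹) * S) = 1 := by rw [h2, inv_mul_cancel₀ ha]
    simp only [if_true]
    rw [← mul_eq_one_iff_eq_inv₀ h, add_mul, div_mul_cancel₀ _ h]
    simp only [Bool.false_eq_true, if_false]
    linear_combination h3

theorem straight_add_sum_turn_right (e : Bool) (x : A) :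
    W.straight e x x * (W.μ x)⁻¹ + ∑ i, W.turn e x i * (W.μ i)⁻¹ = 1 := by
  have ha := W.a_ne
  cases e with
  | true =>
    have h1 : ∑ i, W.turn true x i * (W.μ i)⁻¹ =
        W.a * (W.q - W.q⁻¹) * (∑ i, if x < i then (W.μ i)⁻¹ else 0) := by
      rw [Finset.mul_sum]
      exact Finset.sum_congr rfl fun i _ => by simp only [turn, if_true]; split_ifs <;> ring
    have h2 : W.a * _ = _ := congrArg _ (W.sum_inv_gt x)
    rw [mul_inv_cancel₀ ha] at h2
    rw [h1]
    simp only [straight, if_true]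
    linear_combination h2
  | false =>
    have h1 : ∑ i, W.turn false x i * (W.μ i)⁻¹ =
        -(W.a⁻¹ * (W.q - W.q⁻¹) * (∑ i, if i < x then (W.μ i)⁻¹ else 0)) := by
      rw [Finset.mul_sum, ← Finset.sum_neg_distrib]
      exact Finset.sum_congr rfl fun i _ => by
        simp only [turn, Bool.false_eq_true, if_false]; split_ifs <;> ring
    have h2 : W.a⁻¹ * _ = _ := congrArg _ (W.sum_inv_lt x)
    rw [inv_mul_cancel₀ ha] at h2
    rw [h1]
    simp only [straight, if_true, Bool.false_eq_true, if_false]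
    linear_combination h2

theorem reidemeister1_cap (ov o : Bool) (F : List A → K) (i j : A) (c : List A) :
    evalWord W.model [⟨[], .cross ov o (!o), []⟩, ⟨[], .cap (!o), []⟩] F (i :: j :: c) =
      evalWord W.model [⟨[], .cap o, []⟩] F (i :: j :: c) := by
  have h1 := W.straight_add_sum_turn_left (!ov) i
  have h2 := W.straight_add_sum_turn_right (!ov) i
  have h := W.μ_ne
  by_cases hij : i = j
  · subst hij
    cases o <;> simp [evalWord, shift, model, capWeight]
    · conv_rhs => rw [← one_mul (F c), ← h2, add_mul, Finset.sum_mul]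
      simp only [mul_assoc]
    · rw [← h1, add_mul, Finset.sum_mul]
  · cases o <;> simp [evalWord, shift, model, capWeight, hij, Ne.symm hij]

theorem reidemeister1_cup (ov o : Bool) (F : List A → K) (c : List A) :
    evalWord W.model [⟨[], .cup o, []⟩, ⟨[], .cross ov o (!o), []⟩] F c =
      evalWord W.model [⟨[], .cup (!o), []⟩] F c := by
  have h := W.μ_ne
  cases o <;> simp [evalWord, shift, model, cupWeight, mul_add, Finset.sum_add_distrib,
    Finset.mul_sum] <;> rw [Finset.sum_comm, ← Finset.sum_add_distrib] <;>
    refine Finset.sum_congr rfl fun i _ => ?_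
  · have h1 := W.straight_add_sum_turn_left (!ov) i
    have : (W.straight (!ov) i i + ∑ k, W.turn (!ov) k i * (W.μ k / W.μ i)) * W.μ i * F (i :: i :: c)
        = F (i :: i :: c) := by rw [h1, inv_mul_cancel₀ (h i), one_mul]
    conv_rhs => rw [← this, add_mul, add_mul, Finset.sum_mul, Finset.sum_mul]
    exact congrArg₂ _ (by ring) (Finset.sum_congr rfl fun k _ => by have := h i; field_simp)
  · have h1 := W.straight_add_sum_turn_right (!ov) i
    have : (W.straight (!ov) i i * (W.μ i)⁻¹ + ∑ k, W.turn (!ov) i k * (W.μ k)⁻¹) * W.μ i *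
        F (i :: i :: c) = W.μ i * F (i :: i :: c) := by rw [h1, one_mul]
    conv_rhs => rw [← this, add_mul, add_mul, Finset.sum_mul, Finset.sum_mul]
    exact congrArg₂ _ (by have := h i; field_simp)
      (Finset.sum_congr rfl fun k _ => by have := h i; have := h k; field_simp)

/-- Two crossings of opposite signs between strands with equal orientations cancel. -/
theorem reidemeister2_parallel (ov o : Bool) (F : List A → K) (i j : A) (c : List A) :
    evalWord W.model [⟨[], .cross ov o o, []⟩, ⟨[], .cross (!ov) o o, []⟩] F (i :: j :: c) =
      F (i :: j :: c) := by
  have ha := W.a_ne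
  have hq := W.q_ne
  rcases lt_trichotomy i j with h | h | h
  · have h1 := h.ne
    have h2 := h.ne'
    have h3 := h.not_gt
    cases o <;> cases ov <;> simp [evalWord, shift, model, straight, turn, h, h1, h2, h3] <;>
      field_simp <;> ring
  · subst h
    cases o <;> cases ov <;> simp [evalWord, shift, model, straight, turn] <;> field_simp
  · have h1 := h.ne
    have h2 := h.ne'
    have h3 := h.not_gt
    cases o <;> cases ov <;> simp [evalWord, shift, model, straight, turn, h, h1, h2, h3] <;>
      field_simp <;> ring

/-- The Yang-Baxter equation. -/
theorem reidemeister3_up (F : List A → K) (i j k : A) (c : List A) :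
    evalWord W.model [⟨[], .cross true true true, [true]⟩, ⟨[true], .cross true true true, []⟩,
      ⟨[], .cross true true true, [true]⟩] F (i :: j :: k :: c) =
    evalWord W.model [⟨[true], .cross true true true, []⟩, ⟨[], .cross true true true, [true]⟩,
      ⟨[true], .cross true true true, []⟩] F (i :: j :: k :: c) := by
  -- Only the quadratic relation between the three weights matters. With them abstract, each
  -- relative order of `i`, `j`, `k` leaves a polynomial identity modulo that relation.
  obtain ⟨P, Z, B, key, hm⟩ : ∃ P Z B : K, P * P = B * B + P * Z ∧ ∀ F x y c,
      W.model (.cross true true true) F (x :: y :: c) =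
        (if x = y then P else B) * F (y :: x :: c) + (if x < y then Z else 0) * F (x :: y :: c) :=
    ⟨W.a * W.q, W.a * (W.q - W.q⁻¹), W.a, by have := W.q_ne; field_simp; ring,
      fun _ _ _ _ => rfl⟩
  simp only [evalWord, List.length_cons, List.length_nil, shift, hm]
  rcases lt_trichotomy i j with h1 | h1 | h1 <;> rcases lt_trichotomy j k with h2 | h2 | h2 <;>
    rcases lt_trichotomy i k with h3 | h3 | h3
  all_goals first
    | (exfalso; order)
    | skip
  all_goals
    try have e1 := h1.ne
    try have e1' := h1.ne'
    try have e1'' := h1.not_gt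
    try have e2 := h2.ne
    try have e2' := h2.ne'
    try have e2'' := h2.not_gt
    try have e3 := h3.ne
    try have e3' := h3.ne'
    try have e3'' := h3.not_gt
    try subst h1
    try subst h2
    try subst h3
    simp only [*, if_true, if_false, lt_irrefl]
  all_goals first
    | ring1
    | linear_combination Z * F (i :: j :: j :: c) * key
    | linear_combination -Z * F (i :: j :: j :: c) * key
    | linear_combination Z * F (i :: i :: k :: c) * key

end Weights

open Operator

/-! ### The second Reidemeister move for antiparallel strands. -/

namespace Weights

variable {A K : Type*} [Fintype A] [LinearOrder A] [Field K] (W : Weights A K)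

theorem sum_ite_lt_split (f : A → K) {x y : A} (h : x < y) :
    ∑ i, (if i < y then f i else 0) = ∑ i, (if i < x then f i else 0) + f x +
      ∑ i, (if x < i ∧ i < y then f i else 0) := by
  have : f x = ∑ i, (if i = x then f i else 0) := by simp
  rw [this, ← Finset.sum_add_distrib, ← Finset.sum_add_distrib]
  refine Finset.sum_congr rfl fun i _ => ?_
  rcases lt_trichotomy i x with h1 | h1 | h1
  · simp [h1, h1.ne, h1.not_gt, h1.trans h]
  · simp [h1, h]
  · simp [h1, h1.ne', h1.not_gt]

theorem sum_ite_gt_split (f : A → K) {x y : A} (h : x < y) :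
    ∑ i, (if x < i then f i else 0) = ∑ i, (if y < i then f i else 0) + f y +
      ∑ i, (if x < i ∧ i < y then f i else 0) := by
  have : f y = ∑ i, (if i = y then f i else 0) := by simp
  rw [this, ← Finset.sum_add_distrib, ← Finset.sum_add_distrib]
  refine Finset.sum_congr rfl fun i _ => ?_
  rcases lt_trichotomy i y with h1 | h1 | h1
  · simp [h1, h1.ne, h1.not_gt]
  · simp [h1, h]
  · simp [h1, h1.ne', h1.not_gt, h.trans h1]

theorem sum_between {x y : A} (h : x < y) :
    (W.q - W.q⁻¹) * ∑ i, (if x < i ∧ i < y then W.μ i else 0) =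
      W.q⁻¹ * W.μ x - W.q * W.μ y := by
  have h1 := W.sum_lt x
  have h2 := W.sum_lt y
  rw [sum_ite_lt_split W.μ h] at h2
  linear_combination h2 - h1

theorem sum_inv_between {x y : A} (h : x < y) :
    (W.q - W.q⁻¹) * ∑ i, (if x < i ∧ i < y then (W.μ i)⁻¹ else 0) =
      W.q⁻¹ * (W.μ y)⁻¹ - W.q * (W.μ x)⁻¹ := by
  have h1 := W.sum_inv_gt x
  have h2 := W.sum_inv_gt y
  rw [sum_ite_gt_split (fun i => (W.μ i)⁻¹) h] at h1
  linear_combination h1 - h2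

/-- This is the coefficient of the label `j` when two opposite antiparallel crossings are composed
on equal labels `x`. Two turns pass through a label strictly between `x` and `j`, and `sum_between`
makes their sum cancel the two single-turn terms. -/
theorem sum_turn_mul_turn_left (e : Bool) (x j : A) :
    W.straight e x x * W.turn (!e) x j + W.turn e j x * (W.μ j / W.μ x) * W.straight (!e) j j +
      ∑ i, W.turn e i x * (W.μ i / W.μ x) * W.turn (!e) i j = 0 := by
  have hx := W.μ_ne x
  have ha := W.a_ne
  cases e with
  | true =>
    have h1 : ∑ i, W.turn true i x * (W.μ i / W.μ x) * W.turn false i j =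
        -((W.q - W.q⁻¹) * ((W.q - W.q⁻¹) * ∑ i, if j < i ∧ i < x then W.μ i else 0)) / W.μ x := by
      rw [Finset.mul_sum, Finset.mul_sum, ← Finset.sum_neg_distrib, Finset.sum_div]
      refine Finset.sum_congr rfl fun i _ => ?_
      by_cases h1 : i < x <;> by_cases h2 : j < i <;> simp [turn, h1, h2]
      field_simp
    simp only [Bool.not_true, h1]
    by_cases h : j < x
    · rw [W.sum_between h]
      simp [turn, straight, h]
      field_simp
      ring
    · have : ∀ i, ¬ (j < i ∧ i < x) := fun i hi => h (hi.1.trans hi.2)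
      simp [turn, h, this]
  | false =>
    have h1 : ∑ i, W.turn false i x * (W.μ i / W.μ x) * W.turn true i j =
        -((W.q - W.q⁻¹) * ((W.q - W.q⁻¹) * ∑ i, if x < i ∧ i < j then W.μ i else 0)) / W.μ x := by
      rw [Finset.mul_sum, Finset.mul_sum, ← Finset.sum_neg_distrib, Finset.sum_div]
      refine Finset.sum_congr rfl fun i _ => ?_
      by_cases h1 : x < i <;> by_cases h2 : i < j <;> simp [turn, h1, h2]
      field_simp
    simp only [Bool.not_false, h1]
    by_cases h : x < j
    · rw [W.sum_between h]
      simp [turn, straight, h]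
      field_simp
      ring
    · have : ∀ i, ¬ (x < i ∧ i < j) := fun i hi => h (hi.1.trans hi.2)
      simp [turn, h, this]

theorem sum_turn_mul_turn_right (e : Bool) (x j : A) :
    W.straight e x x * (W.turn (!e) j x * (W.μ j / W.μ x)) + W.turn e x j * W.straight (!e) j j +
      ∑ i, W.turn e x i * (W.turn (!e) j i * (W.μ j / W.μ i)) = 0 := by
  have hx := W.μ_ne x
  have hj := W.μ_ne j
  have ha := W.a_ne
  cases e with
  | true =>
    have h1 : ∑ i, W.turn true x i * (W.turn false j i * (W.μ j / W.μ i)) =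
        -((W.q - W.q⁻¹) * ((W.q - W.q⁻¹) * ∑ i, if x < i ∧ i < j then (W.μ i)⁻¹ else 0)) *
          W.μ j := by
      rw [Finset.mul_sum, Finset.mul_sum, ← Finset.sum_neg_distrib, Finset.sum_mul]
      refine Finset.sum_congr rfl fun i _ => ?_
      by_cases h1 : x < i <;> by_cases h2 : i < j <;> simp [turn, h1, h2]
      field_simp
    simp only [Bool.not_true, h1]
    by_cases h : x < j
    · rw [W.sum_inv_between h]
      simp [turn, straight, h]
      field_simp
      ring
    · have : ∀ i, ¬ (x < i ∧ i < j) := fun i hi => h (hi.1.trans hi.2)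
      simp [turn, h, this]
  | false =>
    have h1 : ∑ i, W.turn false x i * (W.turn true j i * (W.μ j / W.μ i)) =
        -((W.q - W.q⁻¹) * ((W.q - W.q⁻¹) * ∑ i, if j < i ∧ i < x then (W.μ i)⁻¹ else 0)) *
          W.μ j := by
      rw [Finset.mul_sum, Finset.mul_sum, ← Finset.sum_neg_distrib, Finset.sum_mul]
      refine Finset.sum_congr rfl fun i _ => ?_
      by_cases h1 : i < x <;> by_cases h2 : j < i <;> simp [turn, h1, h2]
      field_simp
    simp only [Bool.not_false, h1]
    by_cases h : j < x
    · rw [W.sum_inv_between h]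
      simp [turn, straight, h]
      field_simp
      ring
    · have : ∀ i, ¬ (j < i ∧ i < x) := fun i hi => h (hi.1.trans hi.2)
      simp [turn, h, this]

theorem straight_mul_straight (e : Bool) (x y : A) :
    W.straight e x y * W.straight (!e) y x = 1 := by
  have ha := W.a_ne
  have hq := W.q_ne
  rw [W.straight_comm (!e)]
  cases e <;> by_cases h : x = y <;> simp [straight, h] <;> field_simp

theorem reidemeister2_antiparallel (ov o : Bool) (F : List A → K) (i j : A) (c : List A) :
    evalWord W.model [⟨[], .cross ov o (!o), []⟩, ⟨[], .cross (!ov) (!o) o, []⟩] F (i :: j :: c) =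
      F (i :: j :: c) := by
  by_cases hij : i = j
  · subst hij
    cases o with
    | true =>
      simp only [evalWord, List.length_nil, shift, model, Bool.not_true, if_true, mul_add,
        Finset.mul_sum]
      rw [← mul_assoc, W.straight_mul_straight, Finset.sum_add_distrib, Finset.sum_comm, one_mul,
        add_assoc, ← Finset.sum_add_distrib, ← Finset.sum_add_distrib, add_eq_left]
      refine Finset.sum_eq_zero fun k _ => ?_
      have h := W.sum_turn_mul_turn_left (!ov) i k
      rw [← mul_zero (F (k :: k :: c)), ← h, mul_add, mul_add, Finset.mul_sum, add_assoc]
      exact congrArg₂ _ (by ring) (congrArg₂ _ (by ring) (Finset.sum_congr rfl fun _ _ => by ring))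
    | false =>
      simp only [evalWord, List.length_nil, shift, model, Bool.not_false, if_true, mul_add,
        Finset.mul_sum]
      rw [← mul_assoc, W.straight_mul_straight, Finset.sum_add_distrib, Finset.sum_comm, one_mul,
        add_assoc, ← Finset.sum_add_distrib, ← Finset.sum_add_distrib, add_eq_left]
      refine Finset.sum_eq_zero fun k _ => ?_
      have h := W.sum_turn_mul_turn_right (!ov) i k
      rw [← mul_zero (F (k :: k :: c)), ← h, mul_add, mul_add, Finset.mul_sum, add_assoc]
      exact congrArg₂ _ (by ring) (congrArg₂ _ (by ring) (Finset.sum_congr rfl fun _ _ => by ring))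
  · have h := W.straight_mul_straight (!ov) i j
    cases o <;> simp [evalWord, shift, model, hij, Ne.symm hij, ← mul_assoc] <;>
      simp at h <;> simp [h]

end Weights

open Operator

/-! ### Tangles that a state model does not distinguish -/

section Indistinguishable

variable {A K : Type*} {φ : Gen → Operator A K}

/-- Two tangles with the same boundary have the same operator. -/
structure SameOperator (φ : Gen → Operator A K) (s t : List Bool) (a b : List Slice) : Prop where
  left : IsTangle s a t
  right : IsTangle s b t
  eval : ∀ (F : List A → K) (c : List A), s.length ≤ c.length →
    evalWord φ a F c = evalWord φ b F c

namespace SameOperator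

theorem symm {s t : List Bool} {a b : List Slice} (h : SameOperator φ s t a b) :
    SameOperator φ s t b a :=
  ⟨h.right, h.left, fun F c hc => (h.eval F c hc).symm⟩

theorem trans {s t : List Bool} {a b c : List Slice} (h : SameOperator φ s t a b)
    (h' : SameOperator φ s t b c) : SameOperator φ s t a c :=
  ⟨h.left, h'.right, fun F c hc => (h.eval F c hc).trans (h'.eval F c hc)⟩

theorem extend {s t : List Bool} {a b : List Slice} (h : SameOperator φ s t a b)
    (l r : List Bool) :
    SameOperator φ (l ++ s ++ r) (l ++ t ++ r) (ext l r a) (ext l r b) :=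
  ⟨h.left.ext l r, h.right.ext l r, fun F c hc => by
    rw [evalWord_ext, evalWord_ext]
    exact shift_congr_operator h.eval _ F c (by simp at hc ⊢; omega)⟩

variable [CommSemiring K]

/-- Replace a tangle inside a word. -/
theorem step (hφ : IsLocal φ) {s t s' t' : List Bool} {a b w w' : List Slice}
    (hw : IsTangle s' w t') (h : SameOperator φ s t a b) (ha : a ≠ []) (u v : List Slice)
    (e : w = u ++ (a ++ v)) (e' : w' = u ++ (b ++ v)) : SameOperator φ s' t' w w' := by
  have hw' := hw
  subst e e'
  obtain ⟨s1, hu, hw⟩ := isTangle_append.1 hw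
  obtain ⟨t1, ha1, hv⟩ := isTangle_append.1 hw
  have hs : s1 = s := by
    cases a with
    | nil => exact absurd rfl ha
    | cons x a => exact ha1.1.trans h.left.1.symm
  subst hs
  obtain rfl := ha1.unique h.left
  refine ⟨hw', hu.append (h.right.append hv), fun F c hc => ?_⟩
  simp only [evalWord_append]
  exact hφ.evalWord_congr hu (fun d hd => h.eval _ d hd) c hc

/-- An elementary piece on the left of a tangle can be moved past it. -/
theorem comm_left (hφ : IsLocal φ) {s t : List Bool} {w : List Slice} (hw : IsTangle s w t)
    (l m : List Bool) (g : Gen) :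
    SameOperator φ (l ++ g.bottom ++ m ++ s) (l ++ g.top ++ m ++ t)
      (⟨l, g, m ++ s⟩ :: ext (l ++ g.top ++ m) [] w)
      (ext (l ++ g.bottom ++ m) [] w ++ [⟨l, g, m ++ t⟩]) := by
  have h : SameOperator φ (g.bottom ++ m ++ s) (g.top ++ m ++ t)
      (⟨[], g, m ++ s⟩ :: ext (g.top ++ m) [] w)
      (ext (g.bottom ++ m) [] w ++ [⟨[], g, m ++ t⟩]) := by
    refine ⟨⟨by simp [Slice.bottom], ?_⟩, ?_, fun F c hc => ?_⟩
    · simpa [Slice.top] using hw.ext (g.top ++ m) []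
    · exact (by simpa using hw.ext (g.bottom ++ m) [] :
        IsTangle (g.bottom ++ m ++ s) _ (g.bottom ++ m ++ t)).append
        ⟨by simp [Slice.bottom], by simp [isTangle_nil, Slice.top]⟩
    · rw [evalWord_append, evalWord_ext]
      simp only [evalWord, evalWord_ext, List.length_nil, List.length_append, shift]
      exact hφ.natural g m.length _ (isLinearMap_evalWord hφ w) F c (by simp at hc; omega)
  simpa using h.extend l []

theorem interchange (hφ : IsLocal φ) (g h : Gen) (l m r : List Bool) :
    SameOperator φ (l ++ (g.bottom ++ (m ++ (h.bottom ++ r)))) (l ++ (g.top ++ (m ++ (h.top ++ r))))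
      [⟨l, g, m ++ (h.bottom ++ r)⟩, ⟨l ++ (g.top ++ m), h, r⟩]
      [⟨l ++ (g.bottom ++ m), h, r⟩, ⟨l, g, m ++ (h.top ++ r)⟩] := by
  simpa using (comm_left hφ (s := h.bottom) (t := h.top) (w := [⟨[], h, []⟩])
    ⟨by simp [Slice.bottom], by simp [isTangle_nil, Slice.top]⟩ l m g).extend [] r

end SameOperator

variable [CommSemiring K]

/-- The equation of the third Reidemeister move, for arbitrary crossings. -/
def YangBaxter (φ : Gen → Operator A K) (α β γ p q x : Bool) : Prop :=
  ∀ l r, SameOperator φ (l ++ p :: q :: x :: r) (l ++ x :: q :: p :: r)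
    [⟨l, .cross α p q, x :: r⟩, ⟨l ++ [q], .cross β p x, r⟩, ⟨l, .cross γ q x, p :: r⟩]
    [⟨l ++ [p], .cross γ q x, r⟩, ⟨l, .cross β p x, q :: r⟩, ⟨l ++ [x], .cross α p q, r⟩]

/-- The moves of a state model other than the first and the third Reidemeister move. -/
structure IsPivotal (φ : Gen → Operator A K) : Prop extends IsLocal φ where
  zigzag_left : ∀ o l r, SameOperator φ (l ++ o :: r) (l ++ o :: r)
    [⟨l, .cup o, o :: r⟩, ⟨l ++ [o], .cap (!o), r⟩] []
  slide_cap : ∀ ov o x l r, SameOperator φ (l ++ o :: x :: (!o) :: r) (l ++ x :: r)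
    [⟨l ++ [o], .cross ov x (!o), r⟩, ⟨l, .cap o, x :: r⟩]
    [⟨l, .cross (!ov) o x, (!o) :: r⟩, ⟨l ++ [x], .cap o, r⟩]
  reidemeister2 : ∀ ov p q l r, SameOperator φ (l ++ p :: q :: r) (l ++ p :: q :: r)
    [⟨l, .cross ov p q, r⟩, ⟨l, .cross (!ov) q p, r⟩] []

namespace IsPivotal

variable {α β γ p q x : Bool}

/-- Compose with the inverse of the crossing `α` below and above. The signs become mixed, which is
why `YangBaxter` allows three independent ones. -/
theorem yangBaxter_invert_left (hφ : IsPivotal φ) (h : YangBaxter φ α β γ p q x) :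
    YangBaxter φ (!α) γ β q p x := by
  intro l r
  have hL := hφ.toIsLocal
  have h0 : IsTangle (l ++ q :: p :: x :: r) [⟨l, .cross (!α) q p, x :: r⟩,
      ⟨l, .cross α p q, x :: r⟩, ⟨l ++ [q], .cross β p x, r⟩, ⟨l, .cross γ q x, p :: r⟩,
      ⟨l ++ [x], .cross (!α) q p, r⟩] (l ++ x :: p :: q :: r) := by
    simp [isTangle_cons, isTangle_nil, Slice.bottom, Slice.top, Gen.bottom, Gen.top]
  have h1 := (hφ.reidemeister2 (!α) q p l (x :: r)).step hL h0 (by simp) []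
    [⟨l ++ [q], .cross β p x, r⟩, ⟨l, .cross γ q x, p :: r⟩, ⟨l ++ [x], .cross (!α) q p, r⟩]
    (by simp) rfl
  have h2 := (h l r).step hL h0 (by simp) [⟨l, .cross (!α) q p, x :: r⟩]
    [⟨l ++ [x], .cross (!α) q p, r⟩] rfl rfl
  have h3 := (hφ.reidemeister2 α p q (l ++ [x]) r).step hL h2.right (by simp)
    [⟨l, .cross (!α) q p, x :: r⟩, ⟨l ++ [p], .cross γ q x, r⟩, ⟨l, .cross β p x, q :: r⟩] []
    (by simp) rfl
  exact (h2.trans h3).symm.trans h1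

theorem yangBaxter_invert_right (hφ : IsPivotal φ) (h : YangBaxter φ α β γ p q x) :
    YangBaxter φ β α (!γ) p x q := by
  intro l r
  have hL := hφ.toIsLocal
  have h0 : IsTangle (l ++ p :: x :: q :: r) [⟨l ++ [p], .cross (!γ) x q, r⟩,
      ⟨l ++ [p], .cross γ q x, r⟩, ⟨l, .cross β p x, q :: r⟩, ⟨l ++ [x], .cross α p q, r⟩,
      ⟨l, .cross (!γ) x q, p :: r⟩] (l ++ q :: x :: p :: r) := by
    simp [isTangle_cons, isTangle_nil, Slice.bottom, Slice.top, Gen.bottom, Gen.top]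
  have h1 := (hφ.reidemeister2 (!γ) x q (l ++ [p]) r).step hL h0 (by simp) []
    [⟨l, .cross β p x, q :: r⟩, ⟨l ++ [x], .cross α p q, r⟩, ⟨l, .cross (!γ) x q, p :: r⟩]
    (by simp) rfl
  have h2 := (h l r).symm.step hL h0 (by simp) [⟨l ++ [p], .cross (!γ) x q, r⟩]
    [⟨l, .cross (!γ) x q, p :: r⟩] rfl rfl
  have h3 := (hφ.reidemeister2 γ q x l (p :: r)).step hL h2.right (by simp)
    [⟨l ++ [p], .cross (!γ) x q, r⟩, ⟨l, .cross α p q, x :: r⟩, ⟨l ++ [q], .cross β p x, r⟩] []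
    (by simp) rfl
  exact h1.symm.trans (h2.trans h3)

/-- Bend the left strand around the other two strands. -/
theorem yangBaxter_rotate (hφ : IsPivotal φ) (h : YangBaxter φ α β γ p q x) :
    YangBaxter φ γ (!α) (!β) q x (!p) := by
  intro l r
  have hL := hφ.toIsLocal
  -- the two sides, with the additional strand on the left and the maximum
  have a0 : IsTangle (l ++ (!p) :: p :: q :: x :: (!p) :: r)
      [⟨l ++ [!p, p], .cross γ q x, (!p) :: r⟩, ⟨l ++ [!p, p, x], .cross (!α) q (!p), r⟩,
        ⟨l ++ [!p, p], .cross (!β) x (!p), q :: r⟩, ⟨l ++ [!p], .cap p, x :: q :: r⟩]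
      (l ++ (!p) :: x :: q :: r) := by
    simp [isTangle_cons, isTangle_nil, Slice.bottom, Slice.top, Gen.bottom, Gen.top]
  have a1 := (hφ.slide_cap (!β) p x (l ++ [!p]) (q :: r)).step hL a0 (by simp)
    [⟨l ++ [!p, p], .cross γ q x, (!p) :: r⟩, ⟨l ++ [!p, p, x], .cross (!α) q (!p), r⟩] []
    (by simp) rfl
  have a2 := (SameOperator.interchange hL (.cross β p x) (.cross (!α) q (!p)) (l ++ [!p]) []
    r).symm.step hL a1.right (by simp) [⟨l ++ [!p, p], .cross γ q x, (!p) :: r⟩]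
    [⟨l ++ [!p, x], .cap p, q :: r⟩] (by simp [Gen.bottom, Gen.top]) rfl
  have a3 := (hφ.slide_cap (!α) p q (l ++ [!p, x]) r).step hL a2.right (by simp)
    [⟨l ++ [!p, p], .cross γ q x, (!p) :: r⟩, ⟨l ++ [!p], .cross β p x, q :: (!p) :: r⟩] []
    (by simp [Gen.bottom, Gen.top]) rfl
  have a4 := (h (l ++ [!p]) ((!p) :: r)).symm.step hL a3.right (by simp) []
    [⟨l ++ [!p, x, q], .cap p, r⟩] (by simp) rfl
  have b0 : IsTangle (l ++ (!p) :: p :: q :: x :: (!p) :: r)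
      [⟨l ++ [!p, p, q], .cross (!β) x (!p), r⟩, ⟨l ++ [!p, p], .cross (!α) q (!p), x :: r⟩,
        ⟨l ++ [!p, p, !p], .cross γ q x, r⟩, ⟨l ++ [!p], .cap p, x :: q :: r⟩]
      (l ++ (!p) :: x :: q :: r) := by
    simp [isTangle_cons, isTangle_nil, Slice.bottom, Slice.top, Gen.bottom, Gen.top]
  have b1 := (SameOperator.interchange hL (.cap p) (.cross γ q x) (l ++ [!p]) [] r).symm.step
    hL b0 (by simp) [⟨l ++ [!p, p, q], .cross (!β) x (!p), r⟩,
      ⟨l ++ [!p, p], .cross (!α) q (!p), x :: r⟩] [] (by simp [Gen.bottom, Gen.top]) rfl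
  have b2 := (hφ.slide_cap (!α) p q (l ++ [!p]) (x :: r)).step hL b1.right (by simp)
    [⟨l ++ [!p, p, q], .cross (!β) x (!p), r⟩] [⟨l ++ [!p], .cross γ q x, r⟩]
    (by simp [Gen.bottom, Gen.top]) rfl
  have b3 := (SameOperator.interchange hL (.cross α p q) (.cross (!β) x (!p)) (l ++ [!p]) []
    r).symm.step hL b2.right (by simp) [] [⟨l ++ [!p, q], .cap p, x :: r⟩, ⟨l ++ [!p], .cross γ q x, r⟩]
    (by simp [Gen.bottom, Gen.top]) rfl
  have b4 := (hφ.slide_cap (!β) p x (l ++ [!p, q]) r).step hL b3.right (by simp)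
    [⟨l ++ [!p], .cross α p q, x :: (!p) :: r⟩] [⟨l ++ [!p], .cross γ q x, r⟩]
    (by simp [Gen.bottom, Gen.top]) rfl
  have b5 := (SameOperator.interchange hL (.cross γ q x) (.cap p) (l ++ [!p]) [] r).symm.step
    hL b4.right (by simp) [⟨l ++ [!p], .cross α p q, x :: (!p) :: r⟩,
      ⟨l ++ [!p, q], .cross β p x, (!p) :: r⟩] [] (by simp [Gen.bottom, Gen.top]) rfl
  have hab := (((a1.trans a2).trans a3).trans a4).trans
    (by simpa [Gen.bottom, Gen.top] using (((((b1.trans b2).trans b3).trans b4).trans b5).symm))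
  -- straighten the additional strand
  have key : ∀ w, IsTangle (q :: x :: [!p]) w ((!p) :: x :: [q]) →
      SameOperator φ (l ++ q :: x :: (!p) :: r) (l ++ (!p) :: x :: q :: r)
        (⟨l, .cup (!p), q :: x :: (!p) :: r⟩ ::
          (ext (l ++ [!p, p]) r w ++ [⟨l ++ [!p], .cap p, x :: q :: r⟩])) (ext l r w) := by
    intro w hw
    have c0 : IsTangle (l ++ q :: x :: (!p) :: r) (⟨l, .cup (!p), q :: x :: (!p) :: r⟩ ::
        (ext (l ++ [!p, p]) r w ++ [⟨l ++ [!p], .cap p, x :: q :: r⟩]))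
        (l ++ (!p) :: x :: q :: r) := by
      refine ⟨by simp [Slice.bottom, Gen.bottom], ?_⟩
      exact (by simpa [Slice.top, Gen.top] using hw.ext (l ++ [!p, p]) r :
        IsTangle _ _ (l ++ (!p) :: p :: (!p) :: x :: q :: r)).append
          ⟨by simp [Slice.bottom, Gen.bottom], by simp [isTangle_nil, Slice.top, Gen.top]⟩
    have c1 := ((SameOperator.comm_left hL hw l [] (.cup (!p))).extend [] r).step hL c0
      (by simp) [] [⟨l ++ [!p], .cap p, x :: q :: r⟩] (by simp [Gen.top]) rfl
    have c2 := (hφ.zigzag_left (!p) l (x :: q :: r)).step hL c1.right (by simp) (ext l r w) []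
      (by simp [Gen.bottom]) rfl
    simpa using c1.trans c2
  have k1 := key [⟨[], .cross γ q x, [!p]⟩, ⟨[x], .cross (!α) q (!p), []⟩,
    ⟨[], .cross (!β) x (!p), [q]⟩] ⟨rfl, rfl, rfl, rfl⟩
  have k2 := key [⟨[q], .cross (!β) x (!p), []⟩, ⟨[], .cross (!α) q (!p), [x]⟩,
    ⟨[!p], .cross γ q x, []⟩] ⟨rfl, rfl, rfl, rfl⟩
  have k3 := hab.step hL k1.left (by simp) [⟨l, .cup (!p), q :: x :: (!p) :: r⟩] [] (by simp) rfl
  simpa using k1.symm.trans (k3.trans (by simpa using k2))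

/-- All forms of the third Reidemeister move follow from one of them. -/
theorem yangBaxter_same (hφ : IsPivotal φ) (h : YangBaxter φ true true true true true true)
    (ov p q x : Bool) : YangBaxter φ ov ov ov p q x := by
  have L {α β γ p q x} := hφ.yangBaxter_invert_left (α := α) (β := β) (γ := γ) (p := p)
    (q := q) (x := x)
  have R {α β γ p q x} := hφ.yangBaxter_invert_right (α := α) (β := β) (γ := γ) (p := p)
    (q := q) (x := x)
  have M {α β γ p q x} := hφ.yangBaxter_rotate (α := α) (β := β) (γ := γ) (p := p)
    (q := q) (x := x)
  -- Each line is a path from the known case under the action on signs and orientations. For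
  -- instance `M` three times reverses all orientations, and `L`, `R`, `L` reverses all signs as
  -- well as the order of the strands.
  match ov, p, q, x with
  | true, false, false, false => simpa using M (M (M h))
  | true, false, false, true => simpa using R (M (R (M h)))
  | true, false, true, false => simpa using M (R (M (R h)))
  | true, false, true, true => simpa using L (R (M h))
  | true, true, false, false => simpa using M (M (R (L h)))
  | true, true, false, true => simpa using R (M (L h))
  | true, true, true, false => simpa using M (L (R h))
  | true, true, true, true => simpa using h
  | false, false, false, false => simpa using M (M (M (L (R (L h)))))
  | false, false, false, true => simpa using M (M (M (M (R h))))
  | false, false, true, false => simpa using M (R (M (L (R h))))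
  | false, false, true, true => simpa using L (R (M (L (R (L h)))))
  | false, true, false, false => simpa using M (M (L h))
  | false, true, false, true => simpa using R (M (R (L h)))
  | false, true, true, false => simpa using M (R h)
  | false, true, true, true => simpa using L (R (L h))

end IsPivotal

end Indistinguishable

open Operator

/-! ### Isotopy invariance, skein relation and circle value of the state sum. -/

namespace Weights

variable {A K : Type*} [Fintype A] [LinearOrder A] [Field K] (W : Weights A K)

theorem isPivotal_model : IsPivotal W.model where
  toIsLocal := W.isLocal_model
  zigzag_left o l r := by
    simpa using (⟨⟨rfl, by simp [Slice.bottom, Slice.top, Gen.bottom, Gen.top], rfl⟩, rfl,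
      fun F c hc => by
        obtain ⟨i, c, rfl, -⟩ := exists_cons_of_succ_le_length hc
        exact W.zigzag_left o F i c⟩ : SameOperator W.model [o] [o]
      [⟨[], .cup o, [o]⟩, ⟨[o], .cap (!o), []⟩] []).extend l r
  slide_cap ov o x l r := by
    simpa using (⟨⟨rfl, rfl, rfl⟩, ⟨rfl, rfl, rfl⟩, fun F c hc => by
        obtain ⟨i, j, k, c, rfl⟩ := exists_cons_cons_cons hc
        exact W.slide_cap ov o x F i j k c⟩ : SameOperator W.model [o, x, !o] [x]
      [⟨[o], .cross ov x (!o), []⟩, ⟨[], .cap o, [x]⟩]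
      [⟨[], .cross (!ov) o x, [!o]⟩, ⟨[x], .cap o, []⟩]).extend l r
  reidemeister2 ov p q l r := by
    simpa using (⟨⟨rfl, rfl, rfl⟩, rfl, fun F c hc => by
        obtain ⟨i, j, c, rfl⟩ := exists_cons_cons hc
        by_cases h : p = q
        · subst h
          exact W.reidemeister2_parallel ov p F i j c
        · obtain rfl : q = !p := by revert h; cases p <;> cases q <;> simp
          exact W.reidemeister2_antiparallel ov p F i j c⟩ : SameOperator W.model [p, q] [p, q]
      [⟨[], .cross ov p q, []⟩, ⟨[], .cross (!ov) q p, []⟩] []).extend l r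

theorem yangBaxter (ov p q x : Bool) : YangBaxter W.model ov ov ov p q x := by
  refine W.isPivotal_model.yangBaxter_same (fun l r => ?_) ov p q x
  simpa using (⟨⟨rfl, rfl, rfl, rfl⟩, ⟨rfl, rfl, rfl, rfl⟩, fun F c hc => by
      obtain ⟨i, j, k, c, rfl⟩ := exists_cons_cons_cons hc
      exact W.reidemeister3_up F i j k c⟩ : SameOperator W.model [true, true, true]
        [true, true, true] [⟨[], .cross true true true, [true]⟩,
          ⟨[true], .cross true true true, []⟩, ⟨[], .cross true true true, [true]⟩]
        [⟨[true], .cross true true true, []⟩, ⟨[], .cross true true true, [true]⟩,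
          ⟨[true], .cross true true true, []⟩]).extend l r

theorem isModel_model : IsModel W.model where
  toIsLocal := W.isLocal_model
  move x y s t h hx hi F c hc := by
    obtain rfl | ⟨a, x', rfl⟩ : x = [] ∨ ∃ a x', x = a :: x' := by cases x <;> simp
    · exact absurd rfl h.ne_nil
    have hs := hx.1
    subst hs
    cases h with
    | interchange g h m => exact absurd rfl (hi g h m)
    | zigzag_left o => exact (W.isPivotal_model.zigzag_left o [] []).eval F c hc
    | zigzag_right o =>
      obtain ⟨i, c, rfl, -⟩ := exists_cons_of_succ_le_length hc
      exact W.zigzag_right o F i c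
    | slide_cap ov o x => exact (W.isPivotal_model.slide_cap ov o x [] []).eval F c hc
    | slide_cup ov o x =>
      obtain ⟨i, c, rfl, -⟩ := exists_cons_of_succ_le_length hc
      exact W.slide_cup ov o x F i c
    | reidemeister1_cap ov o =>
      obtain ⟨i, j, c, rfl⟩ := exists_cons_cons hc
      exact W.reidemeister1_cap ov o F i j c
    | reidemeister1_cup ov o => exact W.reidemeister1_cup ov o F c
    | reidemeister2 ov p q => exact (W.isPivotal_model.reidemeister2 ov p q [] []).eval F c hc
    | reidemeister3 ov p q x => exact (W.yangBaxter ov p q x [] []).eval F c hc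

/-- The state sum of a diagram. -/
def stateSum (w : List Slice) : K := evalWord W.model w (closing A K) []

theorem stateSum_iso {a b : List Slice} (h : Iso [] [] a b) : W.stateSum a = W.stateSum b :=
  W.isModel_model.evalWord_iso h _ _ le_rfl

theorem stateSum_move {D E : Diagram} (h : D.Move E) :
    W.stateSum D.word = W.stateSum E.word := by
  obtain ⟨u, v, x, y, l, r, hxy, hD, hE⟩ := h
  have hc := D.closed
  rw [hD, List.append_assoc] at hc
  obtain ⟨s, hu, hc⟩ := isTangle_append.1 hc
  obtain ⟨t, hx, hv⟩ := isTangle_append.1 hc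
  rw [hD, hE]
  simp only [stateSum, evalWord_append]
  exact W.isLocal_model.evalWord_congr hu
    (fun d hd => W.isModel_model.evalWord_move hxy hx hxy.ne_nil _ d hd) [] le_rfl

theorem straight_skein (x y : A) : W.a⁻¹ * W.straight true x y =
    W.a * W.straight false x y + if x = y then W.q - W.q⁻¹ else 0 := by
  have ha := W.a_ne
  by_cases h : x = y <;> simp [straight, h, ha]

theorem turn_skein (x y : A) : W.a⁻¹ * W.turn true x y =
    W.a * W.turn false x y + if x = y then 0 else W.q - W.q⁻¹ := by
  have ha := W.a_ne
  rcases lt_trichotomy x y with h | h | h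
  · simp [turn, h, h.ne, h.not_gt, ha]
  · simp [turn, h]
  · simp [turn, h, h.ne', h.not_gt, ha]

/-- Covers both antiparallel cases: `f`, `g` are the straight weights, `t` the turn weights, and `G`
absorbs the factors `μ`. Straight weights supply the term `i = x` of the smoothing, and turns supply
all others. -/
theorem sum_turn_skein {f g : A → K} (x : A) (G : A → K) (t : Bool → A → K)
    (ht : ∀ i, W.a⁻¹ * t true i = W.a * t false i + if i = x then 0 else W.q - W.q⁻¹)
    (hs : W.a⁻¹ * f x = W.a * g x + (W.q - W.q⁻¹)) :
    W.a⁻¹ * (f x * G x + ∑ i, t true i * G i) =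
      W.a * (g x * G x + ∑ i, t false i * G i) + (W.q - W.q⁻¹) * ∑ i, G i := by
  have h : W.a⁻¹ * ∑ i, t true i * G i =
      W.a * ∑ i, t false i * G i + (W.q - W.q⁻¹) * ∑ i, G i - (W.q - W.q⁻¹) * G x := by
    have h1 : (W.q - W.q⁻¹) * G x = ∑ i, if i = x then (W.q - W.q⁻¹) * G i else 0 := by simp
    rw [h1, Finset.mul_sum, Finset.mul_sum, Finset.mul_sum, ← Finset.sum_add_distrib,
      ← Finset.sum_sub_distrib]
    refine Finset.sum_congr rfl fun i _ => ?_
    rw [← mul_assoc, ht]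
    split_ifs <;> ring
  linear_combination h + G x * hs

theorem model_skein (p q : Bool) (F : List A → K) (c : List A) (hc : 2 ≤ c.length) :
    W.a⁻¹ * W.model (.cross (positiveOver p q) p q) F c =
      W.a * W.model (.cross (!positiveOver p q) p q) F c +
        (W.q - W.q⁻¹) * evalWord W.model (smoothing [] [] p q) F c := by
  obtain ⟨i, j, c, rfl⟩ := exists_cons_cons hc
  by_cases hij : i = j
  · subst hij
    have hs := W.straight_skein i i
    rw [if_pos rfl] at hs
    have ht := W.turn_skein i i
    rw [if_pos rfl] at ht
    cases p <;> cases q <;>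
      simp only [model, positiveOver, smoothing, evalWord, shift, List.length_nil, if_true,
        beq_self_eq_true, Bool.not_true, Bool.not_false, if_false, cupWeight,
        capWeight, show (false == true) = false from rfl,
        show (true == false) = false from rfl, Bool.false_eq_true, Bool.true_eq_false, one_mul]
    · linear_combination F (i :: i :: c) * (hs + ht)
    · exact W.sum_turn_skein (f := W.straight true i) (g := W.straight false i) i
        (fun k => F (k :: k :: c)) (fun e k => W.turn e i k) (fun k => by
          rw [W.turn_skein]; simp only [eq_comm]) hs
    · have h := W.sum_turn_skein (f := W.straight true i) (g := W.straight false i) i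
        (fun k => W.μ k / W.μ i * F (k :: k :: c)) (fun e k => W.turn e k i)
        (fun k => W.turn_skein k i) hs
      have hμ := W.μ_ne i
      simp only [div_self hμ, one_mul, ← mul_assoc] at h
      simp only [← mul_assoc]
      rw [h, mul_assoc _ (W.μ i)⁻¹, Finset.mul_sum]
      simp only [div_eq_inv_mul, mul_assoc, Finset.mul_sum]
    · linear_combination F (i :: i :: c) * (hs + ht)
  · have hs := W.straight_skein i j
    rw [if_neg hij] at hs
    have ht := W.turn_skein i j
    rw [if_neg hij] at ht
    have ht' := W.turn_skein j i
    rw [if_neg (Ne.symm hij)] at ht'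
    cases p <;> cases q <;>
      simp only [model, positiveOver, smoothing, evalWord, shift, List.length_nil, if_true, hij,
        beq_self_eq_true, Bool.not_true, Bool.not_false, if_false, cupWeight,
        capWeight, show (false == true) = false from rfl,
        show (true == false) = false from rfl, Bool.false_eq_true, Bool.true_eq_false, one_mul]
    · linear_combination F (j :: i :: c) * hs + F (i :: j :: c) * ht'
    · linear_combination F (j :: i :: c) * hs
    · linear_combination F (j :: i :: c) * hs
    · linear_combination F (j :: i :: c) * hs + F (i :: j :: c) * ht

theorem stateSum_skein {u v : List Slice} {l r : List Bool} {p q ov : Bool}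
    (h : IsTangle [] (u ++ [⟨l, .cross ov p q, r⟩] ++ v) []) :
    W.a⁻¹ * W.stateSum (u ++ [⟨l, .cross (positiveOver p q) p q, r⟩] ++ v) -
      W.a * W.stateSum (u ++ [⟨l, .cross (!positiveOver p q) p q, r⟩] ++ v) =
        (W.q - W.q⁻¹) * W.stateSum (u ++ smoothing l r p q ++ v) := by
  obtain ⟨hu, -⟩ := h.of_append_singleton
  simp only [stateSum, evalWord_append]
  set F := evalWord W.model v (closing A K)
  have hlin := isLinearMap_evalWord W.isLocal_model u
  have h1 : ∀ d : List A, (Slice.bottom ⟨l, .cross ov p q, r⟩).length ≤ d.length →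
      (W.a⁻¹ • evalWord W.model [⟨l, .cross (positiveOver p q) p q, r⟩] F) d =
      (W.a • evalWord W.model [⟨l, .cross (!positiveOver p q) p q, r⟩] F +
        (W.q - W.q⁻¹) • evalWord W.model (smoothing l r p q) F) d := by
    intro d hd
    have hs : smoothing l r p q = ext l r (smoothing [] [] p q) := by
      cases p <;> cases q <;> simp [smoothing]
    rw [hs, Pi.add_apply, Pi.smul_apply, Pi.smul_apply, Pi.smul_apply, evalWord_ext]
    exact shift_rel (R := fun x y z => W.a⁻¹ * x = W.a * y + (W.q - W.q⁻¹) * z)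
      (W.model_skein p q) l.length F d (by simp [Slice.bottom, Gen.bottom] at hd; omega)
  have h2 := W.isLocal_model.evalWord_congr hu h1 [] le_rfl
  rw [hlin.map_add, hlin.map_smul, hlin.map_smul, hlin.map_smul] at h2
  simp only [Pi.add_apply, Pi.smul_apply, smul_eq_mul] at h2
  rw [h2]
  ring

/-- The difference of `sum_lt` and `sum_gt` at any one label; it gives the value of a circle. -/
theorem sum_μ [Nonempty A] : (W.q - W.q⁻¹) * ∑ i, W.μ i = W.a⁻¹ - W.a := by
  obtain ⟨j⟩ := ‹Nonempty A›
  have h : ∑ i, W.μ i = ∑ i, (if i < j then W.μ i else 0) + W.μ j +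
      ∑ i, (if j < i then W.μ i else 0) := by
    have : W.μ j = ∑ i, (if i = j then W.μ i else 0) := by simp
    rw [this, ← Finset.sum_add_distrib, ← Finset.sum_add_distrib]
    refine Finset.sum_congr rfl fun i _ => ?_
    rcases lt_trichotomy i j with h1 | h1 | h1
    · simp [h1, h1.ne, h1.not_gt]
    · simp [h1]
    · simp [h1, h1.ne', h1.not_gt]
  rw [h]
  linear_combination W.sum_lt j - W.sum_gt j

theorem stateSum_loop [Nonempty A] {u v : List Slice} {l r : List Bool} (o : Bool)
    (hu : IsTangle [] u (l ++ r)) (hv : IsTangle (l ++ r) v []) :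
    (W.q - W.q⁻¹) * W.stateSum (u ++ [⟨l, .cup o, r⟩, ⟨l, .cap o, r⟩] ++ v) =
      (W.a⁻¹ - W.a) * W.stateSum (u ++ v) := by
  -- With orientation `false` the minimum has weight `μ` and the maximum weight `1`, so the circle
  -- contributes the sum of `μ`.
  have h0 : W.stateSum (u ++ [⟨l, .cup o, r⟩, ⟨l, .cap o, r⟩] ++ v) =
      W.stateSum (u ++ [⟨l, .cup false, r⟩, ⟨l, .cap false, r⟩] ++ v) := by
    cases o with
    | false => rfl
    | true =>
      exact W.stateSum_iso (((Iso.loop_reverse true l r).append_left hu).append_right hv)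
  rw [h0]
  simp only [stateSum, evalWord_append]
  set F := evalWord W.model v (closing A K)
  have h1 : ∀ d : List A, (l ++ r).length ≤ d.length →
      evalWord W.model [⟨l, .cup false, r⟩, ⟨l, .cap false, r⟩] F d = ((∑ i, W.μ i) • F) d := by
    intro d hd
    have := evalWord_ext W.model l r [⟨[], .cup false, []⟩, ⟨[], .cap false, []⟩] F
    simp at this
    rw [this, Pi.smul_apply]
    have h2 := shift_rel (k := 0) (R := fun x y _ => x = (∑ i, W.μ i) * y)
      (φ₁ := evalWord W.model [⟨[], .cup false, []⟩, ⟨[], .cap false, []⟩]) (φ₂ := fun F => F)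
      (φ₃ := fun F => F) (fun F c _ => by
        simp [evalWord, shift, model, cupWeight, capWeight, Finset.sum_mul]) l.length F d
        (by simp at hd; omega)
    rw [shift_id] at h2
    exact h2
  rw [W.isLocal_model.evalWord_congr hu h1 [] le_rfl,
    (isLinearMap_evalWord W.isLocal_model u).map_smul, ← W.sum_μ]
  simp only [Pi.smul_apply, smul_eq_mul]
  ring

end Weights

/-! ### Existence of the HOMFLY polynomial -/

theorem sum_fin_ite_lt {K : Type*} [Field K] (f : ℕ → K) (N : ℕ) {j : ℕ} (hj : j ≤ N) :
    ∑ i : Fin N, (if (i : ℕ) < j then f i - f (i + 1) else 0) = f 0 - f j := by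
  rw [Fin.sum_univ_eq_sum_range (fun i => if i < j then f i - f (i + 1) else 0) N,
    ← Finset.sum_filter, ← Finset.sum_range_sub' f j]
  refine Finset.sum_congr ?_ fun _ _ => rfl
  ext i
  simp
  omega

theorem sum_fin_ite_gt {K : Type*} [Field K] (f : ℕ → K) (N : ℕ) {j : ℕ} (hj : j < N) :
    ∑ i : Fin N, (if j < (i : ℕ) then f i - f (i + 1) else 0) = f (j + 1) - f N := by
  have h1 := sum_fin_ite_lt f N le_rfl
  have h2 := sum_fin_ite_lt f N (j := j + 1) hj
  have h3 : ∑ i : Fin N, (if j < (i : ℕ) then f i - f (i + 1) else 0) =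
      ∑ i : Fin N, (if (i : ℕ) < N then f i - f (i + 1) else 0) -
      ∑ i : Fin N, (if (i : ℕ) < j + 1 then f i - f (i + 1) else 0) := by
    rw [← Finset.sum_sub_distrib]
    refine Finset.sum_congr rfl fun i _ => ?_
    rw [if_pos i.2]
    by_cases h : j < (i : ℕ)
    · rw [if_pos h, if_neg (by omega), sub_zero]
    · rw [if_neg h, if_pos (by omega), sub_self]
  rw [h3, h1, h2]
  ring

/-! ### The weights of rank `N`, by telescoping sums. -/

section QuantumWeights

variable {K : Type*} [Field K] {q : K}

/-- Exhibits `(q - q⁻¹) * μ i` as a difference of consecutive terms, so that the partial sums in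
`Weights` telescope; `quantum_inv_sub` does the same for the inverse weights. -/
theorem quantum_sub (hq : q ≠ 0) (N i : ℕ) :
    q ^ ((N : ℤ) - 2 * i) - q ^ ((N : ℤ) - 2 * (i + 1 : ℕ)) =
    (q - q⁻¹) * q ^ ((N : ℤ) - 1 - 2 * i) := by
  have h1 : ((N : ℤ) - 2 * i) = ((N : ℤ) - 1 - 2 * i) + 1 := by ring
  have h2 : ((N : ℤ) - 2 * (i + 1 : ℕ)) = ((N : ℤ) - 1 - 2 * i) - 1 := by push_cast; ring
  rw [h1, h2, zpow_add_one₀ hq, zpow_sub_one₀ hq]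
  ring

theorem quantum_inv_sub (hq : q ≠ 0) (N i : ℕ) :
    -q ^ (2 * (i : ℤ) - N) - -q ^ (2 * ((i + 1 : ℕ) : ℤ) - N) =
    (q - q⁻¹) * (q ^ ((N : ℤ) - 1 - 2 * i))⁻¹ := by
  have h1 : 2 * (i : ℤ) - N = -((N : ℤ) - 1 - 2 * i) - 1 := by ring
  have h2 : 2 * ((i + 1 : ℕ) : ℤ) - N = -((N : ℤ) - 1 - 2 * i) + 1 := by push_cast; ring
  rw [h1, h2, zpow_add_one₀ hq, zpow_sub_one₀ hq, zpow_neg]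
  ring

end QuantumWeights

/-- The weights of the vertex model of the special linear group of rank `N`. -/
def quantumWeights {K : Type*} [Field K] (q : K) (hq : q ≠ 0) (N : ℕ) : Weights (Fin N) K where
  q := q
  a := q ^ (-(N : ℤ))
  μ j := q ^ ((N : ℤ) - 1 - 2 * (j : ℕ))
  q_ne := hq
  a_ne := zpow_ne_zero _ hq
  μ_ne _ := zpow_ne_zero _ hq
  sum_lt j := by
    have h := sum_fin_ite_lt (fun i => q ^ ((N : ℤ) - 2 * i)) N j.2.le
    simp only [quantum_sub hq, ← mul_ite_zero, ← Finset.mul_sum] at h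
    simp only [Fin.lt_def]
    rw [h, ← zpow_one_add₀ hq, ← zpow_neg]
    simp only [Nat.cast_zero, mul_zero, sub_zero, neg_neg]
    rw [show 1 + ((N : ℤ) - 1 - 2 * (j : ℕ)) = N - 2 * (j : ℕ) by ring]
    ring
  sum_gt j := by
    have h := sum_fin_ite_gt (fun i => q ^ ((N : ℤ) - 2 * i)) N j.2
    simp only [quantum_sub hq, ← mul_ite_zero, ← Finset.mul_sum] at h
    simp only [Fin.lt_def]
    rw [h, mul_comm q⁻¹, ← zpow_sub_one₀ hq]
    rw [show (N : ℤ) - 1 - 2 * (j : ℕ) - 1 = N - 2 * ((j : ℕ) + 1 : ℕ) by push_cast; ring,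
      show (N : ℤ) - 2 * N = -N by ring]
    ring
  sum_inv_gt j := by
    have h := sum_fin_ite_gt (fun i => -q ^ (2 * (i : ℤ) - N)) N j.2
    simp only [quantum_inv_sub hq, ← mul_ite_zero, ← Finset.mul_sum] at h
    simp only [Fin.lt_def]
    rw [h, ← zpow_neg, ← zpow_neg, ← zpow_one_add₀ hq]
    rw [show 1 + -((N : ℤ) - 1 - 2 * (j : ℕ)) = 2 * ((j : ℕ) + 1 : ℕ) - N by push_cast; ring,
      show 2 * (N : ℤ) - N = - -N by ring]
    ring
  sum_inv_lt j := by
    have h := sum_fin_ite_lt (fun i => -q ^ (2 * (i : ℤ) - N)) N j.2.le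
    simp only [quantum_inv_sub hq, ← mul_ite_zero, ← Finset.mul_sum] at h
    simp only [Fin.lt_def]
    rw [h, ← zpow_neg, mul_comm q⁻¹, ← zpow_sub_one₀ hq]
    rw [show -((N : ℤ) - 1 - 2 * (j : ℕ)) - 1 = 2 * (j : ℕ) - N by ring]
    simp

/-- A Laurent polynomial that vanishes at infinitely many units is zero. -/
theorem eq_zero_of_eval₂_eq_zero {R S : Type*} [CommRing R] [CommRing S] [IsDomain S]
    {f : R →+* S} (hf : Function.Injective f) {Q : R[T;T⁻¹]} {U : Set Sˣ} (hU : U.Infinite)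
    (h : ∀ u ∈ U, LaurentPolynomial.eval₂ f u Q = 0) : Q = 0 := by
  obtain ⟨n, g, hg⟩ := Q.exists_T_pow
  have hg0 : g.map f = 0 := by
    refine Polynomial.eq_zero_of_infinite_isRoot _
      ((hU.image (Units.val_injective.injOn)).mono ?_)
    rintro _ ⟨u, hu, rfl⟩
    have := congrArg (LaurentPolynomial.eval₂ f u) hg
    rw [map_mul, h u hu, zero_mul, LaurentPolynomial.eval₂_toLaurent] at this
    exact (Polynomial.eval_map f _).trans this
  rw [(Polynomial.map_eq_zero_iff hf).1 hg0, map_zero] at hg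
  exact (LaurentPolynomial.isUnit_T (R := R) n).mul_left_eq_zero.1 hg.symm

/-- The value of a polynomial in `a` and `z` at two nonzero rational numbers. -/
noncomputable def evalRat (a z : ℚˣ) : HomflyRing →+* ℚ :=
  (LaurentPolynomial.eval₂ (RingHom.id ℚ) a).comp
    (LaurentPolynomial.eval₂ (AddMonoidAlgebra.mapRingHom ℤ (Int.castRingHom ℚ))
      (Units.map (LaurentPolynomial.C : ℚ →+* ℚ[T;T⁻¹]).toMonoidHom z))

theorem evalRat_varA (a z : ℚˣ) : evalRat a z varA = a := by
  have h := congrArg (LaurentPolynomial.eval₂ (RingHom.id ℚ) a)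
    ((LaurentPolynomial.eval₂_C (AddMonoidAlgebra.mapRingHom ℤ (Int.castRingHom ℚ))
      (Units.map (LaurentPolynomial.C : ℚ →+* ℚ[T;T⁻¹]).toMonoidHom z) (LaurentPolynomial.T 1)).trans
        (mapRingHom_T _ 1))
  refine h.trans ?_
  simp

theorem evalRat_varA_inv (a z : ℚˣ) : evalRat a z (↑varA⁻¹ : HomflyRing) = (a : ℚ)⁻¹ := by
  have h := congrArg (evalRat a z) varA_inv_mul
  rw [map_mul, map_one, evalRat_varA] at h
  exact eq_inv_of_mul_eq_one_left h

theorem evalRat_varZ (a z : ℚˣ) : evalRat a z varZ = z := by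
  simp [evalRat, varZ]

theorem evalRat_varZInv (a z : ℚˣ) : evalRat a z varZInv = (z : ℚ)⁻¹ := by
  have h := congrArg (evalRat a z) varZ_mul_varZInv
  rw [map_mul, map_one, evalRat_varZ] at h
  exact eq_inv_of_mul_eq_one_right h

/-- The rational values of the parameter `q`. -/
def quantumRat (m : ℕ) : ℚ := m + 2

/-- The offset in `quantumRat` ensures this; it makes `q - q⁻¹` nonzero and the powers of `q`
distinct. -/
theorem one_lt_quantumRat (m : ℕ) : 1 < quantumRat m := by
  have : (0 : ℚ) ≤ m := m.cast_nonneg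
  rw [quantumRat]
  linarith

theorem quantumRat_ne (m : ℕ) : quantumRat m ≠ 0 := (zero_lt_one.trans (one_lt_quantumRat m)).ne'

theorem quantumRat_sub_inv_ne (m : ℕ) : quantumRat m - (quantumRat m)⁻¹ ≠ 0 := by
  have h := one_lt_quantumRat m
  have := inv_lt_one_of_one_lt₀ h
  linarith

theorem quantumRat_sub_inv_injective :
    Function.Injective fun m => quantumRat m - (quantumRat m)⁻¹ := by
  refine StrictMono.injective fun m n h => ?_
  have h1 : quantumRat m < quantumRat n := by simpa [quantumRat] using h
  have h2 := inv_strictAnti₀ (zero_lt_one.trans (one_lt_quantumRat m)) h1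
  linarith

/-- The vertex models with rational parameters. -/
def ratWeights (m n : ℕ) : Weights (Fin (n + 1)) ℚ :=
  quantumWeights (quantumRat m) (quantumRat_ne m) (n + 1)

theorem ratWeights_q (m n : ℕ) : (ratWeights m n).q = quantumRat m := rfl

theorem ratWeights_a (m n : ℕ) : (ratWeights m n).a = quantumRat m ^ (-((n + 1 : ℕ) : ℤ)) := rfl

/-- Here the rank `n + 1` matters: rank zero would give `a = 1`, and `a⁻¹ - a` could not be
cancelled. -/
theorem ratWeights_a_lt_one (m n : ℕ) : (ratWeights m n).a < 1 := by
  rw [ratWeights_a, zpow_neg, zpow_natCast]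
  exact inv_lt_one_of_one_lt₀ (one_lt_pow₀ (one_lt_quantumRat m) n.succ_ne_zero)

theorem ratWeights_inv_sub_ne (m n : ℕ) : (ratWeights m n).a⁻¹ - (ratWeights m n).a ≠ 0 := by
  have h := ratWeights_a_lt_one m n
  have h0 : 0 < (ratWeights m n).a := zpow_pos (zero_lt_one.trans (one_lt_quantumRat m)) _
  have := one_lt_inv₀ h0 |>.2 h
  linarith

/-- The specialisation of the variables that corresponds to a vertex model. -/
noncomputable def evalWeights (m n : ℕ) : HomflyRing →+* ℚ :=
  evalRat (Units.mk0 _ (ratWeights m n).a_ne) (Units.mk0 _ (quantumRat_sub_inv_ne m))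

/-- For each `m` the values of `a` are infinitely many, which kills the specialisation in `z`; the
values of `z` are infinitely many too. -/
theorem eq_zero_of_evalWeights {Q : HomflyRing} (h : ∀ m n, evalWeights m n Q = 0) : Q = 0 := by
  refine eq_zero_of_eval₂_eq_zero (f := AddMonoidAlgebra.mapRingHom ℤ (Int.castRingHom ℚ))
    (AddMonoidAlgebra.map_injective _ Int.cast_injective)
    (U := Set.range fun m => Units.map (LaurentPolynomial.C : ℚ →+* ℚ[T;T⁻¹]).toMonoidHom
      (Units.mk0 _ (quantumRat_sub_inv_ne m))) (Set.infinite_range_of_injective ?_) ?_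
  · refine (Units.map_injective (f := LaurentPolynomial.C.toMonoidHom)
      fun x y h => ?_).comp fun m n h => ?_
    · have h' := congrArg (LaurentPolynomial.eval₂ (RingHom.id ℚ) 1) h
      exact ((LaurentPolynomial.eval₂_C _ _ x).symm.trans h').trans
        (LaurentPolynomial.eval₂_C _ _ y)
    exact quantumRat_sub_inv_injective (congrArg Units.val h)
  · rintro _ ⟨m, rfl⟩
    refine eq_zero_of_eval₂_eq_zero (f := RingHom.id ℚ) Function.injective_id
      (U := Set.range fun n => Units.mk0 _ (ratWeights m n).a_ne)
      (Set.infinite_range_of_injective fun n n' hn => ?_) ?_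
    · have := zpow_right_injective₀ (zero_lt_one.trans (one_lt_quantumRat m))
        (one_lt_quantumRat m).ne' (congrArg Units.val hn)
      simpa using this
    · rintro _ ⟨n, rfl⟩
      exact h m n

/-- The Laurent polynomial `Q` interpolates the normalised state sums of `w`. -/
def Interpolates (Q : HomflyRing) (w : List Slice) : Prop :=
  ∀ m n, evalWeights m n Q * ((ratWeights m n).a⁻¹ - (ratWeights m n).a) =
    (quantumRat m - (quantumRat m)⁻¹) * (ratWeights m n).stateSum w

theorem evalWeights_varA (m n : ℕ) : evalWeights m n varA = (ratWeights m n).a :=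
  evalRat_varA _ _

theorem evalWeights_varA_inv (m n : ℕ) :
    evalWeights m n (↑varA⁻¹ : HomflyRing) = (ratWeights m n).a⁻¹ := evalRat_varA_inv _ _

theorem evalWeights_varZ (m n : ℕ) :
    evalWeights m n varZ = quantumRat m - (quantumRat m)⁻¹ := evalRat_varZ _ _

theorem evalWeights_varZInv (m n : ℕ) :
    evalWeights m n varZInv = (quantumRat m - (quantumRat m)⁻¹)⁻¹ := evalRat_varZInv _ _

theorem Interpolates.unique {Q Q' : HomflyRing} {w : List Slice} (h : Interpolates Q w)
    (h' : Interpolates Q' w) : Q = Q' := by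
  refine sub_eq_zero.1 (eq_zero_of_evalWeights fun m n => ?_)
  rw [map_sub]
  exact sub_eq_zero.2 (mul_right_cancel₀ (ratWeights_inv_sub_ne m n) ((h m n).trans (h' m n).symm))

theorem interpolates_circle (o : Bool) :
    Interpolates 1 [⟨[], .cup o, []⟩, ⟨[], .cap o, []⟩] := by
  intro m n
  have h := (ratWeights m n).stateSum_loop (u := []) (v := []) (l := []) (r := []) o rfl rfl
  rw [map_one, one_mul]
  refine Eq.symm (h.trans ?_)
  simp [Weights.stateSum, evalWord, closing]

/-- The empty diagram is excluded, since its state sum `1` would demand the value `z / (a⁻¹ - a)`,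
which is not a Laurent polynomial. -/
theorem exists_interpolates {w : List Slice} (hw : IsTangle [] w []) :
    w = [] ∨ ∃ Q, Interpolates Q w := by
  refine skein_induction (fun w => w = [] ∨ ∃ Q, Interpolates Q w) (.inl rfl) ?_ ?_ ?_ hw
  · rintro a b h (rfl | ⟨Q, hQ⟩)
    · exact .inl ((h.append_eq_nil_iff (u := []) rfl).1 rfl)
    · exact .inr ⟨Q, fun m n => by rw [hQ m n, (ratWeights m n).stateSum_iso h]⟩
  · rintro u v l r ov p q h h1 h0
    have hu := h.ne_nil (by simp [Slice.bottom, Gen.bottom])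
    obtain ⟨Q1, h1⟩ := h1.resolve_left (by simp)
    obtain ⟨Q0, h0⟩ := h0.resolve_left (by simp [hu])
    right
    by_cases hov : ov = positiveOver p q
    -- The skein relation solved for the negative crossing; the other case solves it for the
    -- positive one.
    · refine ⟨(↑varA⁻¹ : HomflyRing) * ((↑varA⁻¹ : HomflyRing) * Q1 - varZ * Q0), fun m n => ?_⟩
      have hs := (ratWeights m n).stateSum_skein h
      rw [← hov, ratWeights_q] at hs
      have ha := inv_mul_cancel₀ (ratWeights m n).a_ne
      simp only [map_mul, map_sub, evalWeights_varA_inv, evalWeights_varZ]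
      set a := (ratWeights m n).a
      set z := quantumRat m - (quantumRat m)⁻¹
      linear_combination a⁻¹ * a⁻¹ * h1 m n - a⁻¹ * z * h0 m n + a⁻¹ * z * hs +
        z * (ratWeights m n).stateSum (u ++ [⟨l, .cross (!ov) p q, r⟩] ++ v) * ha
    · have hov' : positiveOver p q = !ov := by
        revert hov; cases positiveOver p q <;> cases ov <;> simp
      refine ⟨(↑varA : HomflyRing) * ((↑varA : HomflyRing) * Q1 + varZ * Q0), fun m n => ?_⟩
      have hs := (ratWeights m n).stateSum_skein h
      rw [hov', Bool.not_not, ratWeights_q] at hs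
      have ha := inv_mul_cancel₀ (ratWeights m n).a_ne
      simp only [map_mul, map_add, evalWeights_varA, evalWeights_varZ]
      set a := (ratWeights m n).a
      set z := quantumRat m - (quantumRat m)⁻¹
      linear_combination a * a * h1 m n + a * z * h0 m n - a * z * hs +
        z * (ratWeights m n).stateSum (u ++ [⟨l, .cross (!ov) p q, r⟩] ++ v) * ha
  · rintro u v l r o hu hv h
    right
    by_cases hne : u ++ v = []
    · obtain ⟨rfl, rfl⟩ := List.append_eq_nil_iff.1 hne
      obtain ⟨rfl, rfl⟩ := List.append_eq_nil_iff.1 (isTangle_nil.1 hu).symm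
      exact ⟨1, interpolates_circle o⟩
    · obtain ⟨Q, hQ⟩ := h.resolve_left hne
      refine ⟨((↑varA⁻¹ : HomflyRing) - (↑varA : HomflyRing)) * varZInv * Q, fun m n => ?_⟩
      have hl := (ratWeights m n).stateSum_loop o hu hv
      rw [ratWeights_q] at hl
      have hz := inv_mul_cancel₀ (quantumRat_sub_inv_ne m)
      simp only [map_mul, map_sub, evalWeights_varA, evalWeights_varA_inv, evalWeights_varZInv]
      rw [hl]
      set a := (ratWeights m n).a
      linear_combination (a⁻¹ - a) * (quantumRat m - (quantumRat m)⁻¹)⁻¹ * hQ m n +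
        (a⁻¹ - a) * (ratWeights m n).stateSum (u ++ v) * hz

/-- The HOMFLY polynomial exists. -/
theorem exists_isHomfly : ∃ P, IsHomfly P := by
  have h : ∀ D : Diagram, ∃ Q, Interpolates Q D.word := fun D =>
    (exists_interpolates D.closed).resolve_left D.nonempty
  choose f hf using h
  -- The interpolating polynomials are chosen diagram by diagram; uniqueness makes them invariant
  -- under moves, because the state sums are.
  refine ⟨Quot.lift f fun D E hDE => (hf D).unique fun m n => ?_,
    (hf circle).unique (interpolates_circle true), ?_⟩
  · rw [hf E m n, (ratWeights m n).stateSum_move hDE]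
  · rintro Dp Dm D0 ⟨u, v, l, r, p, q, hp, hm, h0⟩
    change (↑varA⁻¹ : HomflyRing) * f Dp - (↑varA : HomflyRing) * f Dm = varZ * f D0
    refine sub_eq_zero.1 (eq_zero_of_evalWeights fun m n => ?_)
    have hs := (ratWeights m n).stateSum_skein (hp ▸ Dp.closed)
    rw [← hp, ← hm, ← h0, ratWeights_q] at hs
    refine (mul_eq_zero.1 ?_).resolve_right (ratWeights_inv_sub_ne m n)
    simp only [map_mul, map_sub, evalWeights_varA, evalWeights_varA_inv, evalWeights_varZ]
    have e1 := hf Dp m n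
    have e2 := hf Dm m n
    have e3 := hf D0 m n
    set a := (ratWeights m n).a
    set z := quantumRat m - (quantumRat m)⁻¹
    linear_combination a⁻¹ * e1 - a * e2 - z * e3 + z * hs

/-- Existence suffices: the results on twist moves hold for any invariant satisfying `IsHomfly`. -/
theorem isHomfly_homfly : IsHomfly homfly := by
  rw [homfly, dif_pos exists_isHomfly]
  exact exists_isHomfly.choose_spec

end LinkDiagrams

theorem mainTheorem4 (K K' : LinkDiagrams.OrientedLink) (hK : K.IsKnot) :
    (∀ (k : ℕ) (hk : 3 ≤ k) (ζ : ℂ) (hζ : IsPrimitiveRoot ζ (2 * k)),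
      LinkDiagrams.IsTMove (2 * k) K K' →
        LinkDiagrams.evalZ (Units.mk0 (ζ - ζ⁻¹) (LinkDiagrams.rootOfUnity_sub_inv_ne_zero hk hζ))
            (LinkDiagrams.homfly K') =
          LaurentPolynomial.T (2 * (k : ℤ)) *
            LinkDiagrams.evalZ
              (Units.mk0 (ζ - ζ⁻¹) (LinkDiagrams.rootOfUnity_sub_inv_ne_zero hk hζ))
              (LinkDiagrams.homfly K)) ∧
    (LinkDiagrams.IsTMove 4 K K' →
      ∃ p p' : ℤ[T;T⁻¹][X],
        Polynomial.toLaurent p = LinkDiagrams.homfly K ∧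
        Polynomial.toLaurent p' = LinkDiagrams.homfly K' ∧
        LinkDiagrams.modTwo (p'.eval 0) =
          LaurentPolynomial.T 4 * LinkDiagrams.modTwo (p.eval 0)) ∧
    (∀ (k : ℕ) (hk : 2 ≤ k) (ζ : ℂ) (hζ : IsPrimitiveRoot ζ (2 * k)),
      LinkDiagrams.IsTBarMove (2 * k) K K' →
        LinkDiagrams.evalA (Units.mk0 ζ (LinkDiagrams.rootOfUnity_ne_zero hk hζ))
            (LinkDiagrams.homfly K') =
          LinkDiagrams.evalA (Units.mk0 ζ (LinkDiagrams.rootOfUnity_ne_zero hk hζ))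
            (LinkDiagrams.homfly K)) := by
  have hP := LinkDiagrams.isHomfly_homfly
  exact ⟨fun k hk ζ hζ h => LinkDiagrams.evalZ_tMove hP hk hζ h,
    fun h => LinkDiagrams.modTwo_tMove hP hK h,
    fun k hk ζ hζ h => LinkDiagrams.evalA_tBarMove hP hk hζ h⟩
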